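/- Let $X$ be a smooth projective geometrically connected curve over a finite field $\mathbb F_q$ and let $E$ be a field containing $\mathbb F_q$. Products are over $\mathbb F_q$, $\mathrm{Fr}$ denotes the $q$-Frobenius endomorphism, $X\otimes E=X\times\operatorname{Spec}E$, and $\Phi=\mathrm{Id}_X\times \mathrm{Fr}_E: X\otimes E\to X\otimes E$. Let $\alpha,\beta:\operatorname{Spec}E\to X$ be morphisms over $\mathbb F_q$ with graphs $\Gamma_\alpha,\Gamma_\beta\subset X\otimes E$, and assume (+) $\Gamma_{\mathrm{Fr}_X^i\circ\alpha}\cap\Gamma_{\mathrm{Fr}_X^j\circ\beta}=\emptyset$ for all integers $i,j\ge 0$. Let $\mathscr F$ be a shtuka of rank $d$ over $\operatorname{Spec}E$ with zero $\alpha$ and pole $\beta$, that is, a diagram $\Phi^*\mathscr F\xrightarrow{f}\mathscr F'\xleftarrow{g}\mathscr F$ of injective morphisms of locally free sheaves of rank $d$ on $X\otimes E$ such that $\operatorname{coker} f$ is an invertible sheaf on $\Gamma_\alpha$ and $\operatorname{coker} g$ is an invertible sheaf on $\Gamma_\beta$. For a sheaf of modules $\mathscr M$ on $X\otimes E$ write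 $\mathscr M(\beta)=\mathscr M(\Gamma_\beta)$. Via $g$ we have $\mathscr F\subset\mathscr F'\subset\mathscr F(\beta)$, so $f$ gives an injective morphism $\Phi^*\mathscr F\to\mathscr F(\beta)$. Subsheaf means quasi-coherent (equivalently, coherent) $\mathscr O$-submodule. Let $S_1$ (resp. $S_2$) be the poset, ordered by inclusion, of all subsheaves $\mathscr E\subset\mathscr F$ satisfying condition (1) (resp. (2)): (1) the image of $\Phi^*\mathscr E$ in $\mathscr F(\beta)$ is contained in $\mathscr E(\beta)$, the sheaf $\mathscr F/\mathscr E$ is locally free, and the induced morphism $\Phi^*(\mathscr F/\mathscr E)\to(\mathscr F/\mathscr E)(\beta)$ induces an isomorphism $\Phi^*(\mathscr F/\mathscr E)\xrightarrow{\sim}\mathscr F/\mathscr E$ (i.e. it is the composition of such an isomorphism with the canonical morphism $\mathscr F/\mathscr E\to(\mathscr F/\mathscr E)(\beta)$); (2) the image of $\Phi^*\mathscr E$ in $\mathscr F(\beta)$ is $\mathscr E$. Then the poset $S_1$ has a least element, denoted by $\mathscr F^{\mathrm I}$. The poset $S_2$ has a greatest element, denoted by $\mathscr F^{\mathrm{II}}$,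 and $\mathscr F/\mathscr F^{\mathrm{II}}$ is locally free. -/

import Mathlib

open CategoryTheory CategoryTheory.Limits AlgebraicGeometry Opposite

universe u

namespace Drinfeld

noncomputable section

section Frobenius
variable {Fq : Type u} [Field Fq] [Fintype Fq]

theorem add_pow_card (S : Over (Spec (CommRingCat.of Fq))) (U : S.left.Opens)
    (x y : Γ(S.left, U)) :
    (x + y) ^ Fintype.card Fq = x ^ Fintype.card Fq + y ^ Fintype.card Fq := by
  let : Algebra Fq Γ(S.left, U) :=
    ((Scheme.ΓSpecIso (CommRingCat.of Fq)).inv ≫ S.hom.appTop ≫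
      S.left.presheaf.map (homOfLE le_top).op).hom.toAlgebra
  exact map_add (FiniteField.frobeniusAlgHom Fq Γ(S.left, U)) x y

/-- The ring endomorphism `s ↦ s ^ q` of the sections over `U` of a scheme over `𝔽_q`. -/
def frobSections (S : Over (Spec (CommRingCat.of Fq))) (U : S.left.Opens) :
    Γ(S.left, U) →+* Γ(S.left, U) where
  toFun x := x ^ Fintype.card Fq
  map_one' := one_pow _
  map_mul' x y := mul_pow x y _
  map_zero' := zero_pow Fintype.card_ne_zero
  map_add' := add_pow_card S U

/-- The Frobenius endomorphism of a scheme over `𝔽_q`, as a morphism of schemes: the identity on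
points and `s ↦ s ^ q` on sections. -/
def frobScheme (S : Over (Spec (CommRingCat.of Fq))) : S.left ⟶ S.left where
  base := 𝟙 _
  c := { app := fun U => CommRingCat.ofHom (frobSections S U.unop)
         naturality := fun U V f => by
          ext x
          exact (map_pow (S.left.presheaf.map f).hom x _).symm }
  prop x := by
    constructor
    intro t ht
    obtain ⟨U, hx, s, rfl⟩ := S.left.presheaf.exists_germ_eq t
    erw [PresheafedSpace.stalkMap_germ_apply] at ht
    have h : S.left.presheaf.germ U x hx (s ^ Fintype.card Fq) =
        (S.left.presheaf.germ U x hx s) ^ Fintype.card Fq := map_pow _ _ _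
    exact (isUnit_pow_iff Fintype.card_ne_zero).1 (h ▸ ht)

theorem frobScheme_comp_hom (S : Over (Spec (CommRingCat.of Fq))) :
    frobScheme S ≫ S.hom = S.hom := by
  refine ext_of_isAffine ?_
  ext x
  obtain ⟨a, rfl⟩ := (ConcreteCategory.bijective_of_isIso
    (Scheme.ΓSpecIso (CommRingCat.of Fq)).inv).2 x
  have ha : a ^ Fintype.card Fq = a := FiniteField.pow_card a
  change (S.hom.appTop ((Scheme.ΓSpecIso (CommRingCat.of Fq)).inv a)) ^ Fintype.card Fq = _
  rw [← map_pow, ← map_pow, ha]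

/-- The Frobenius endomorphism `Fr_S` relative to `𝔽_q`, as a morphism over `𝔽_q`. -/
def frob (S : Over (Spec (CommRingCat.of Fq))) : S ⟶ S :=
  Over.homMk (frobScheme S) (frobScheme_comp_hom S)

end Frobenius

section Twist

variable {T Z : Scheme.{u}} (γ : T ⟶ Z)

/-- The sections over `U` of the ideal sheaf of `γ`, i.e. of the kernel of `𝒪_Z → γ_* 𝒪_T`. -/
def idealSections (U : Z.Opens) : Ideal Γ(Z, U) := RingHom.ker (γ.app U).hom

theorem map_mem_idealSections {U V : Z.Opens} (h : V ≤ U) {a : Γ(Z, U)}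
    (ha : a ∈ idealSections γ U) : Z.presheaf.map (homOfLE h).op a ∈ idealSections γ V := by
  have ha' : γ.app U a = 0 := ha
  change γ.app V (Z.presheaf.map (homOfLE h).op a) = 0
  have := ConcreteCategory.congr_hom (γ.naturality (homOfLE h).op) a
  simp only [CommRingCat.comp_apply] at this
  rw [this, ha', map_zero]

/-- Restriction of sections of the ideal sheaf. -/
def idealRes {U V : Z.Opens} (h : V ≤ U) (a : idealSections γ U) : idealSections γ V :=
  ⟨Z.presheaf.map (homOfLE h).op a.1, map_mem_idealSections γ h a.2⟩

variable (M : Z.Modules)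

/-- Sections over `U` of the sheaf `ℋom(I, M)`, where `I` is the ideal sheaf of `γ`: families of
`𝒪(V)`-linear maps `I(V) → M(V)`, for `V ⊆ U` open, that are compatible with restriction. -/
@[ext]
structure TwistSections (U : Z.Opens) where
  toLin (V : Z.Opens) (h : V ≤ U) : idealSections γ V →ₗ[Γ(Z, V)] Γ(M, V)
  compat (V W : Z.Opens) (h : V ≤ U) (h' : W ≤ V) (a : idealSections γ V) :
    toLin W (h'.trans h) (idealRes γ h' a) = M.presheaf.map (homOfLE h').op (toLin V h a)

namespace TwistSections
variable {γ M} {U : Z.Opens}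

instance : Zero (TwistSections γ M U) := ⟨⟨fun _ _ => 0, by simp⟩⟩
instance : Add (TwistSections γ M U) := ⟨fun s t => ⟨fun V h => s.toLin V h + t.toLin V h, by
  intro V W h h' a; simp [s.compat V W h h', t.compat V W h h']⟩⟩
instance : Neg (TwistSections γ M U) := ⟨fun s => ⟨fun V h => - s.toLin V h, by
  intro V W h h' a; simp [s.compat V W h h']⟩⟩
instance : SMul Γ(Z, U) (TwistSections γ M U) :=
  ⟨fun r s => ⟨fun V h => Z.presheaf.map (homOfLE h).op r • s.toLin V h, by
    intro V W h h' a
    simp only [LinearMap.smul_apply, s.compat V W h h', Scheme.Modules.map_smul]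
    rw [← CommRingCat.comp_apply, ← Functor.map_comp]; rfl⟩⟩

@[simp] theorem zero_toLin (V h) : (0 : TwistSections γ M U).toLin V h = 0 := rfl
@[simp] theorem add_toLin (s t : TwistSections γ M U) (V h) :
    (s + t).toLin V h = s.toLin V h + t.toLin V h := rfl
@[simp] theorem neg_toLin (s : TwistSections γ M U) (V h) :
    (- s).toLin V h = - s.toLin V h := rfl
@[simp] theorem smul_toLin (r : Γ(Z, U)) (s : TwistSections γ M U) (V h) :
    (r • s).toLin V h = Z.presheaf.map (homOfLE h).op r • s.toLin V h := rfl

instance : AddCommGroup (TwistSections γ M U) where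
  add_assoc a b c := by ext1; funext V h; simp [add_assoc]
  zero_add a := by ext1; funext V h; simp
  add_zero a := by ext1; funext V h; simp
  add_comm a b := by ext1; funext V h; simp [add_comm]
  neg_add_cancel a := by ext1; funext V h; simp
  nsmul := nsmulRec
  zsmul := zsmulRec

instance : Module Γ(Z, U) (TwistSections γ M U) where
  one_smul a := by ext1; funext V h; simp
  mul_smul r r' a := by ext1; funext V h; simp [mul_smul]
  smul_zero r := by ext1; funext V h; simp
  zero_smul a := by ext1; funext V h; simp
  smul_add r a b := by ext1; funext V h; simp
  add_smul r r' a := by ext1; funext V h; simp [add_smul]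

variable (γ M) in
/-- Restriction of sections of `ℋom(I, M)`. -/
def res {U U' : Z.Opens} (h : U' ≤ U) : TwistSections γ M U →+ TwistSections γ M U' where
  toFun s := ⟨fun V hV => s.toLin V (hV.trans h), fun V W _ h' a => s.compat V W _ h' a⟩
  map_zero' := rfl
  map_add' _ _ := rfl

end TwistSections

/-- The presheaf of abelian groups underlying `ℋom(I, M)`. -/
def twistPresheaf : TopCat.Presheaf Ab.{u} Z where
  obj U := AddCommGrpCat.of (TwistSections γ M U.unop)
  map f := AddCommGrpCat.ofHom (TwistSections.res γ M f.unop.le)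

instance (U : (Z.Opens)ᵒᵖ) : Module (Z.ringCatSheaf.obj.obj U) ((twistPresheaf γ M).obj U) :=
  inferInstanceAs (Module Γ(Z, U.unop) (TwistSections γ M U.unop))

theorem eq_of_inf {ι : Type u} {U : ι → Z.Opens} {V : Z.Opens} (hV : V ≤ iSup U)
    {x y : Γ(M, V)}
    (h : ∀ i, M.presheaf.map (homOfLE (inf_le_left : V ⊓ U i ≤ V)).op x =
      M.presheaf.map (homOfLE (inf_le_left : V ⊓ U i ≤ V)).op y) : x = y :=
  TopCat.Sheaf.eq_of_locally_eq' ⟨M.presheaf, M.isSheaf⟩ (fun i => V ⊓ U i) V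
    (fun _ => homOfLE inf_le_left) (by rw [← inf_iSup_eq]; exact le_inf le_rfl hV) x y h

theorem map_map {U V W : Z.Opens} (h : V ≤ U) (h' : W ≤ V) (x : Γ(M, U)) :
    M.presheaf.map (homOfLE h').op (M.presheaf.map (homOfLE h).op x) =
      M.presheaf.map (homOfLE (h'.trans h)).op x := by
  rw [← ConcreteCategory.comp_apply, ← Functor.map_comp]; rfl

theorem ringMap_map {U V W : Z.Opens} (h : V ≤ U) (h' : W ≤ V) (x : Γ(Z, U)) :
    Z.presheaf.map (homOfLE h').op (Z.presheaf.map (homOfLE h).op x) =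
      Z.presheaf.map (homOfLE (h'.trans h)).op x := by
  rw [← CommRingCat.comp_apply, ← Functor.map_comp]; rfl

theorem idealRes_idealRes {U V W : Z.Opens} (h : V ≤ U) (h' : W ≤ V) (a : idealSections γ U) :
    idealRes γ h' (idealRes γ h a) = idealRes γ (h'.trans h) a := by
  refine Subtype.ext ?_
  change Z.presheaf.map _ (Z.presheaf.map _ _) = _
  rw [← CommRingCat.comp_apply, ← Functor.map_comp]; rfl

theorem idealRes_rfl {U : Z.Opens} (a : idealSections γ U) : idealRes γ le_rfl a = a :=
  Subtype.ext (ConcreteCategory.congr_hom (Z.presheaf.map_id (op U)) a.1)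

theorem idealRes_add {U V : Z.Opens} (h : V ≤ U) (a b : idealSections γ U) :
    idealRes γ h (a + b) = idealRes γ h a + idealRes γ h b :=
  Subtype.ext (map_add (Z.presheaf.map (homOfLE h).op).hom a.1 b.1)

theorem idealRes_smul {U V : Z.Opens} (h : V ≤ U) (r : Γ(Z, U)) (a : idealSections γ U) :
    idealRes γ h (r • a) = Z.presheaf.map (homOfLE h).op r • idealRes γ h a :=
  Subtype.ext (map_mul (Z.presheaf.map (homOfLE h).op).hom r a.1)

theorem TwistSections.toLin_congr {ι : Type u} {U : ι → Z.Opens}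
    {sf : ∀ i, TwistSections γ M (U i)}
    (hsf : ∀ i j, TwistSections.res γ M (inf_le_left : U i ⊓ U j ≤ U i) (sf i) =
      TwistSections.res γ M (inf_le_right : U i ⊓ U j ≤ U j) (sf j))
    (i j : ι) (V : Z.Opens) (hi : V ≤ U i) (hj : V ≤ U j) :
    (sf i).toLin V hi = (sf j).toLin V hj :=
  congrArg (fun s => TwistSections.toLin s V (le_inf hi hj)) (hsf i j)

theorem TwistSections.existsUnique_glue {ι : Type u} (U : ι → Z.Opens)
    (sf : ∀ i, TwistSections γ M (U i))
    (hsf : ∀ i j, TwistSections.res γ M (inf_le_left : U i ⊓ U j ≤ U i) (sf i) =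
      TwistSections.res γ M (inf_le_right : U i ⊓ U j ≤ U j) (sf j)) :
    ∃! s : TwistSections γ M (iSup U), ∀ i, TwistSections.res γ M (le_iSup U i) s = sf i := by
  have key : ∀ (V : Z.Opens) (_ : V ≤ iSup U) (a : idealSections γ V), ∃ y : Γ(M, V),
      ∀ i, M.presheaf.map (homOfLE (inf_le_left : V ⊓ U i ≤ V)).op y =
        (sf i).toLin (V ⊓ U i) inf_le_right (idealRes γ inf_le_left a) := by
    intro V hV a
    obtain ⟨y, hy, -⟩ := TopCat.Sheaf.existsUnique_gluing' ⟨M.presheaf, M.isSheaf⟩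
      (fun i => V ⊓ U i) V (fun _ => homOfLE inf_le_left)
      (by rw [← inf_iSup_eq]; exact le_inf le_rfl hV)
      (fun i => (sf i).toLin (V ⊓ U i) inf_le_right (idealRes γ inf_le_left a)) (by
        intro i j
        have e1 := (sf i).compat (V ⊓ U i) ((V ⊓ U i) ⊓ (V ⊓ U j)) inf_le_right inf_le_left
          (idealRes γ inf_le_left a)
        have e2 := (sf j).compat (V ⊓ U j) ((V ⊓ U i) ⊓ (V ⊓ U j)) inf_le_right inf_le_right
          (idealRes γ inf_le_left a)
        rw [idealRes_idealRes] at e1 e2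
        refine e1.symm.trans (Eq.trans ?_ e2)
        rw [TwistSections.toLin_congr γ M hsf i j])
    exact ⟨y, hy⟩
  choose y hy using key
  have hy' : ∀ (V : Z.Opens) (hV : V ≤ iSup U) (a : idealSections γ V) (i : ι) (W : Z.Opens)
      (hW : W ≤ V) (hWi : W ≤ U i), M.presheaf.map (homOfLE hW).op (y V hV a) =
        (sf i).toLin W hWi (idealRes γ hW a) := by
    intro V hV a i W hW hWi
    have h1 := congrArg (M.presheaf.map (homOfLE (le_inf hW hWi)).op) (hy V hV a i)
    rw [map_map, ← (sf i).compat, idealRes_idealRes] at h1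
    exact h1
  have hadd : ∀ V hV a b, y V hV (a + b) = y V hV a + y V hV b := by
    intro V hV a b
    refine eq_of_inf M hV fun i => ?_
    rw [map_add, hy, hy, hy, idealRes_add, map_add]
  have hsmul : ∀ V hV (r : Γ(Z, V)) a, y V hV (r • a) = r • y V hV a := by
    intro V hV r a
    refine eq_of_inf M hV fun i => ?_
    rw [hy, idealRes_smul, map_smul, Scheme.Modules.map_smul, hy]
  have hcompat : ∀ (V W : Z.Opens) (hV : V ≤ iSup U) (hWV : W ≤ V) (a : idealSections γ V),
      y W (hWV.trans hV) (idealRes γ hWV a) = M.presheaf.map (homOfLE hWV).op (y V hV a) := by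
    intro V W hV hWV a
    refine eq_of_inf M (hWV.trans hV) fun i => ?_
    rw [hy, map_map, idealRes_idealRes, hy' V hV a i (W ⊓ U i) (inf_le_left.trans hWV) inf_le_right]
  refine ⟨⟨fun V hV => ⟨⟨y V hV, hadd V hV⟩, hsmul V hV⟩, hcompat⟩, ?_, ?_⟩
  · intro i
    refine TwistSections.ext ?_
    funext V hV
    refine LinearMap.ext fun a => ?_
    have h1 := hy' V (hV.trans (le_iSup U i)) a i V le_rfl hV
    rw [idealRes_rfl] at h1
    refine Eq.trans ?_ h1
    exact (ConcreteCategory.congr_hom (M.presheaf.map_id (op V)) _).symm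
  · intro s hs
    refine TwistSections.ext ?_
    funext V hV
    refine LinearMap.ext fun a => ?_
    refine eq_of_inf M hV fun i => ?_
    refine Eq.trans ?_ (hy V hV a i).symm
    rw [← s.compat, ← hs i]
    rfl

theorem twistPresheaf_isSheaf : (twistPresheaf γ M).IsSheaf := by
  rw [TopCat.Presheaf.isSheaf_iff_isSheafUniqueGluing]
  intro ι U sf hsf
  exact TwistSections.existsUnique_glue γ M U sf hsf

/-- The sheaf of modules `ℋom(I, M)`, where `I` is the ideal sheaf of `γ`. When `γ` is the
immersion of an effective Cartier divisor `D`, the sheaf `I` is invertible with inverse `𝒪(D)`, and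
this is the twist `M(D) = M ⊗ 𝒪(D)`. -/
def twist : Z.Modules where
  val := PresheafOfModules.ofPresheaf (R := Z.ringCatSheaf.obj) (twistPresheaf γ M) (by
    intro U V f r m
    refine TwistSections.ext ?_
    funext W hW
    refine congrArg (fun c => c • TwistSections.toLin m W (hW.trans f.unop.le)) ?_
    exact (ringMap_map f.unop.le hW r).symm)
  isSheaf := twistPresheaf_isSheaf γ M

/-- The morphism `M(D) → N(D)` induced by a morphism `M → N`. -/
def twistMap {M N : Z.Modules} (φ : M ⟶ N) : twist γ M ⟶ twist γ N where
  val := PresheafOfModules.homMk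
    { app U := AddCommGrpCat.ofHom
        { toFun (s : TwistSections γ M U.unop) : TwistSections γ N U.unop :=
            ⟨fun V hV => { toFun a := φ.app V (s.toLin V hV a)
                           map_add' a b := by simp
                           map_smul' r a := by simp }, by
              intro V W h h' a
              have := ConcreteCategory.congr_hom (φ.mapPresheaf.naturality (homOfLE h').op) (s.toLin V h a)
              change φ.app W (s.toLin W _ (idealRes γ h' a)) = _
              rw [s.compat V W h h']
              exact this⟩
          map_zero' := by
            refine TwistSections.ext ?_
            funext V hV
            refine LinearMap.ext fun a => map_zero (φ.app V).hom
          map_add' s t := by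
            refine TwistSections.ext ?_
            funext V hV
            refine LinearMap.ext fun a => map_add (φ.app V).hom _ _ }
      naturality U V f := rfl } (by
    intro U r s
    refine TwistSections.ext ?_
    funext V hV
    refine LinearMap.ext fun a => Scheme.Modules.Hom.app_smul (U := V) φ _ _)

theorem app_map {M N : Z.Modules} (φ : M ⟶ N) {U V : Z.Opens} (h : V ≤ U)
    (x : Γ(M, U)) :
    φ.app V (M.presheaf.map (homOfLE h).op x) = N.presheaf.map (homOfLE h).op (φ.app U x) :=
  ConcreteCategory.congr_hom (φ.mapPresheaf.naturality (homOfLE h).op) x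

/-- The functor `M ↦ Γ(M, U)`. -/
def sectionsFunctor (U : Z.Opens) : Z.Modules ⥤ Ab.{u} :=
  Scheme.Modules.toPresheaf Z ⋙ (evaluation _ _).obj (op U)

instance (U : Z.Opens) : PreservesLimits (sectionsFunctor U) := by
  have : PreservesLimits ((evaluation (TopologicalSpace.Opens Z)ᵒᵖ Ab.{u}).obj (op U)) :=
    inferInstance
  exact comp_preservesLimits (Scheme.Modules.toPresheaf Z)
    ((evaluation (TopologicalSpace.Opens Z)ᵒᵖ Ab.{u}).obj (op U))

instance (U : Z.Opens) : (sectionsFunctor U).PreservesZeroMorphisms where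
  map_zero _ _ := rfl

theorem app_injective {M N : Z.Modules} (φ : M ⟶ N) [Mono φ] (U : Z.Opens) :
    Function.Injective (φ.app U) :=
  (AddCommGrpCat.mono_iff_injective _).1 (inferInstanceAs (Mono ((sectionsFunctor U).map φ)))

theorem exists_app_eq_of_cokernel {M N : Z.Modules} (φ : M ⟶ N) [Mono φ] (U : Z.Opens)
    (n : Γ(N, U)) (hn : (cokernel.π φ).app U n = 0) : ∃ m : Γ(M, U), φ.app U m = n := by
  let S := ShortComplex.mk φ (cokernel.π φ) (cokernel.condition φ)
  have hS : S.Exact := ShortComplex.exact_cokernel φ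
  have : Mono S.f := ‹Mono φ›
  have h := hS.map_of_mono_of_preservesKernel (sectionsFunctor U) inferInstance inferInstance
  exact (ShortComplex.ab_exact_iff _).1 h n hn

theorem exists_app_eq_smul {M N : Z.Modules} (φ : M ⟶ N) [Mono φ] (L : T.Modules)
    (e : cokernel φ ≅ (Scheme.Modules.pushforward γ).obj L) (U : Z.Opens)
    (a : idealSections γ U) (n : Γ(N, U)) : ∃ m : Γ(M, U), φ.app U m = a.1 • n := by
  refine exists_app_eq_of_cokernel φ U _ ?_
  apply app_injective e.hom U
  rw [map_zero, Scheme.Modules.Hom.app_smul, Scheme.Modules.Hom.app_smul]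
  have ha : γ.app U a.1 = 0 := a.2
  have h (x : Γ(L, γ ⁻¹ᵁ U)) : γ.app U a.1 • x = 0 := by rw [ha, zero_smul]
  exact h _

/-- For a monomorphism `φ : M → N` with `I N ⊆ φ(M)` and a section `n` of `N` over `U`, the map
`I(U) → M(U)` that sends `a` to the unique `m` with `φ m = a n`. -/
def colonLin {M N : Z.Modules} (φ : M ⟶ N) [Mono φ]
    (hφ : ∀ (U : Z.Opens) (a : idealSections γ U) (n : Γ(N, U)),
      ∃ m : Γ(M, U), φ.app U m = a.1 • n) (U : Z.Opens) (n : Γ(N, U)) :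
    idealSections γ U →ₗ[Γ(Z, U)] Γ(M, U) where
  toFun a := (hφ U a n).choose
  map_add' a b := app_injective φ U (by
    rw [map_add, (hφ U _ n).choose_spec, (hφ U _ n).choose_spec, (hφ U _ n).choose_spec]
    exact add_smul _ _ _)
  map_smul' r a := app_injective φ U (by
    rw [Scheme.Modules.Hom.app_smul, (hφ U _ n).choose_spec, (hφ U _ n).choose_spec]
    exact mul_smul _ _ _)

theorem app_colonLin {M N : Z.Modules} (φ : M ⟶ N) [Mono φ]
    (hφ : ∀ (U : Z.Opens) (a : idealSections γ U) (n : Γ(N, U)),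
      ∃ m : Γ(M, U), φ.app U m = a.1 • n) (U : Z.Opens) (n : Γ(N, U)) (a : idealSections γ U) :
    φ.app U (colonLin γ φ hφ U n a) = a.1 • n :=
  (hφ U a n).choose_spec

/-- The section of `ℋom(I, M)` given by a section `n` of `N` when `I N ⊆ φ(M)`. -/
def colonSections {M N : Z.Modules} (φ : M ⟶ N) [Mono φ]
    (hφ : ∀ (U : Z.Opens) (a : idealSections γ U) (n : Γ(N, U)),
      ∃ m : Γ(M, U), φ.app U m = a.1 • n) (U : Z.Opens) (n : Γ(N, U)) : TwistSections γ M U where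
  toLin V h := colonLin γ φ hφ V (N.presheaf.map (homOfLE h).op n)
  compat V W h h' a := app_injective φ W (by
    rw [app_colonLin, app_map, app_colonLin, Scheme.Modules.map_smul, map_map]
    rfl)

theorem colonSections_add {M N : Z.Modules} (φ : M ⟶ N) [Mono φ]
    (hφ : ∀ (U : Z.Opens) (a : idealSections γ U) (n : Γ(N, U)),
      ∃ m : Γ(M, U), φ.app U m = a.1 • n) (U : Z.Opens) (n n' : Γ(N, U)) :
    colonSections γ φ hφ U (n + n') = colonSections γ φ hφ U n + colonSections γ φ hφ U n' := by
  refine TwistSections.ext ?_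
  funext V hV
  refine LinearMap.ext fun a => app_injective φ V ?_
  refine (app_colonLin γ φ hφ V _ a).trans ?_
  rw [map_add, smul_add, ← app_colonLin γ φ hφ V _ a, ← app_colonLin γ φ hφ V _ a]
  exact (map_add _ _ _).symm

/-- For a monomorphism `φ : M → N` with `I N ⊆ φ(M)`, the canonical morphism `N → M(D)`. It is the
only morphism that sends each section `n` to a section whose value at `a ∈ I` is the `m` with
`φ m = a n`, and its composition with `φ` is the canonical morphism `M → M(D)`. -/
def colonHom {M N : Z.Modules} (φ : M ⟶ N) [Mono φ]
    (hφ : ∀ (U : Z.Opens) (a : idealSections γ U) (n : Γ(N, U)),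
      ∃ m : Γ(M, U), φ.app U m = a.1 • n) : N ⟶ twist γ M where
  val := PresheafOfModules.homMk
    { app U := AddCommGrpCat.ofHom
        (AddMonoidHom.mk' (colonSections γ φ hφ U.unop) (colonSections_add γ φ hφ U.unop))
      naturality U V f := by
        ext n
        refine TwistSections.ext ?_
        funext W hW
        exact congrArg (colonLin γ φ hφ W) (map_map N f.unop.le hW n) } (by
    intro U r n
    refine TwistSections.ext ?_
    funext V hV
    refine LinearMap.ext fun a => app_injective φ V ?_
    refine (app_colonLin γ φ hφ V _ a).trans ?_
    refine Eq.trans ?_ (Scheme.Modules.Hom.app_smul φ _ _).symm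
    refine Eq.trans ?_ (congrArg _ (app_colonLin γ φ hφ V _ a).symm)
    refine (congrArg _ (Scheme.Modules.map_smul N (homOfLE hV) r n)).trans ?_
    exact smul_comm _ _ _)

/-- The canonical morphism `M → M(D)`, which sends `m` to the map `a ↦ a m`. -/
def toTwist (M : Z.Modules) : M ⟶ twist γ M :=
  colonHom γ (𝟙 M) fun _ a n => ⟨a.1 • n, rfl⟩

end Twist

section LocallyFree

variable {Z : Scheme.{u}}

/-- Locally free of rank `d`: locally isomorphic to `𝒪 ^ d`. -/
def IsLocallyFreeOfRank (M : Z.Modules) (d : ℕ) : Prop :=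
  ∃ q : SheafOfModules.LocalGeneratorsData.{u} M, q.IsLocallyFreeData ∧
    ∀ i, Nonempty ((q.generators i).I ≃ Fin d)

/-- Locally free sheaves of modules (the rank may vary). -/
abbrev IsLocallyFree (M : Z.Modules) : Prop := SheafOfModules.IsLocallyFree M

/-- Quasi-coherent sheaves of modules. -/
abbrev IsQuasicoherent (M : Z.Modules) : Prop := SheafOfModules.IsQuasicoherent M

end LocallyFree

section Shtuka

variable {Fq : Type u} [Field Fq] [Fintype Fq] {X S : Over (Spec (CommRingCat.of Fq))}

/-- The fibre product `X × S` over `𝔽_q`. -/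
abbrev prod (X S : Over (Spec (CommRingCat.of Fq))) : Scheme.{u} := pullback X.hom S.hom

variable (X S) in
/-- The endomorphism `Φ = Id_X × Fr_S` of `X × S`. -/
def Phi : prod X S ⟶ prod X S :=
  pullback.lift (pullback.fst X.hom S.hom) (pullback.snd X.hom S.hom ≫ (frob S).left) (by
    rw [Category.assoc, Over.w, pullback.condition])

/-- The graph `S → X × S` of a morphism `S → X` over `𝔽_q`. -/
def graph (α : S ⟶ X) : S.left ⟶ prod X S :=
  pullback.lift α.left (𝟙 S.left) (by rw [Over.w, Category.id_comp])

/-- The `i`-th power of the Frobenius endomorphism of `X`. -/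
def frobPow (X : Over (Spec (CommRingCat.of Fq))) : ℕ → (X ⟶ X)
  | 0 => 𝟙 X
  | i + 1 => frobPow X i ≫ frob X

/-- The condition (+): the graphs of `Fr_X ^ i ∘ α` and `Fr_X ^ j ∘ β` are disjoint subsets of
`X × S` for all `i, j ≥ 0`. -/
def FrobDisjoint (α β : S ⟶ X) : Prop :=
  ∀ i j : ℕ, Disjoint (Set.range (graph (α ≫ frobPow X i))) (Set.range (graph (β ≫ frobPow X j)))

/-- The cokernel of `φ` is an invertible sheaf on the graph of `α`. -/
def CokernelInvertibleOn {M N : (prod X S).Modules} (φ : M ⟶ N) (α : S ⟶ X) : Prop :=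
  ∃ L : S.left.Modules, IsLocallyFreeOfRank L 1 ∧
    Nonempty (cokernel φ ≅ (Scheme.Modules.pushforward (graph α)).obj L)

/-- A (right) shtuka of rank `d` over `S` with zero `α` and pole `β`: a diagram
`Φ^* F → F' ← F` of injective morphisms `f`, `g` of locally free sheaves of rank `d` on `X × S`
such that the cokernel of `f` is an invertible sheaf on the graph of `α` and the cokernel of `g` is
an invertible sheaf on the graph of `β`. -/
structure Shtuka (α β : S ⟶ X) (d : ℕ) where
  F : (prod X S).Modules
  F' : (prod X S).Modules
  f : (Scheme.Modules.pullback (Phi X S)).obj F ⟶ F'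
  g : F ⟶ F'
  locallyFree : IsLocallyFreeOfRank F d
  locallyFree' : IsLocallyFreeOfRank F' d
  mono_f : Mono f
  mono_g : Mono g
  cokernel_f : CokernelInvertibleOn f α
  cokernel_g : CokernelInvertibleOn g β

namespace Shtuka

variable {α β : S ⟶ X} {d : ℕ} (𝓕 : Shtuka α β d)

theorem exists_g_eq_smul (U : (prod X S).Opens) (a : idealSections (graph β) U)
    (n : Γ(𝓕.F', U)) : ∃ m : Γ(𝓕.F, U), 𝓕.g.app U m = a.1 • n := by
  have := 𝓕.mono_g
  obtain ⟨L, -, ⟨e⟩⟩ := 𝓕.cokernel_g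
  exact exists_app_eq_smul (graph β) 𝓕.g L e U a n

/-- The canonical morphism `F' → F(β)`, which extends `F → F(β)`. -/
def toPole : 𝓕.F' ⟶ twist (graph β) 𝓕.F :=
  have := 𝓕.mono_g
  colonHom (graph β) 𝓕.g 𝓕.exists_g_eq_smul

/-- The morphism `Φ^* F → F(β)` of the shtuka. -/
def phi : (Scheme.Modules.pullback (Phi X S)).obj 𝓕.F ⟶ twist (graph β) 𝓕.F :=
  𝓕.f ≫ 𝓕.toPole

/-- The image of `Φ^* E` in `F(β)`, for a subsheaf `E` of `F`. -/
def frobImage (E : Subobject 𝓕.F) : Subobject (twist (graph β) 𝓕.F) :=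
  imageSubobject ((Scheme.Modules.pullback (Phi X S)).map E.arrow ≫ 𝓕.phi)

/-- Membership in the poset `S₁`: `E` is a (quasi-coherent) subsheaf of `F`, the image of `Φ^* E` in
`F(β)` is contained in `E(β)`, the quotient `F/E` is locally free, and the morphism
`Φ^*(F/E) → (F/E)(β)` induced by `Φ^* F → F(β)` is the composition of an isomorphism
`θ : Φ^*(F/E) ≅ F/E` with the canonical morphism `F/E → (F/E)(β)`. -/
structure IsTrivialQuotientSub (E : Subobject 𝓕.F) : Prop where
  quasicoherent : IsQuasicoherent (E : (prod X S).Modules)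
  frobImage_le : 𝓕.frobImage E ≤ imageSubobject (twistMap (graph β) E.arrow)
  locallyFree : IsLocallyFree (cokernel E.arrow)
  exists_iso : ∃ θ : (Scheme.Modules.pullback (Phi X S)).obj (cokernel E.arrow) ≅ cokernel E.arrow,
    (Scheme.Modules.pullback (Phi X S)).map (cokernel.π E.arrow) ≫ θ.hom ≫
        toTwist (graph β) (cokernel E.arrow) =
      𝓕.phi ≫ twistMap (graph β) (cokernel.π E.arrow)

/-- Membership in the poset `S₂`: `E` is a (quasi-coherent) subsheaf of `F`, and the image of
`Φ^* E` in `F(β)` is `E`. -/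
structure IsTrivialSub (E : Subobject 𝓕.F) : Prop where
  quasicoherent : IsQuasicoherent (E : (prod X S).Modules)
  frobImage_eq : 𝓕.frobImage E = imageSubobject (E.arrow ≫ toTwist (graph β) 𝓕.F)

end Shtuka

end Shtuka

end

end Drinfeld

/-!
`X` is smooth and geometrically connected, so `X ⊗ E` is an integral curve, smooth over `E`, and
the functions on its nonempty affine opens form Dedekind domains (`isIntegral_of_smooth`,
`isDedekindDomain_sections`). Everything is done on the *cylinders* `V ⊗ E` with `V ⊆ X` affine
open. They form an affine cover of `X ⊗ E`, and each of them is its own preimage under `Φ`. Write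
`A` for the functions on `V ⊗ E`. Then `Φ` is a ring endomorphism `σ` of `A` over the Frobenius `τ`
of `E`, and `A` is the base change of itself along `τ`, because it is `E ⊗ A₀` with `A₀` fixed by
`σ`. A `τ`-basis of `E` is thus a `σ`-basis of `A`; this is recorded in `FrobData`. The sections of
`Φ^* M` are the base change of the sections of `M` along `σ` (`bijective_twistSum_frobUnit`), so a
shtuka becomes a linear injection `g : F → F'` together with a `σ`-semilinear map `φ : F → F'`
whose linear extension to the base change of `F` is injective, with `F'` killed by the ideal of
`Γ_β` modulo `g F` and by the ideal of `Γ_α` modulo the span of `φ F`.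

**Dimension count.** Base change along `τ` preserves dimensions over `E`. It also preserves the
dimension of the part of a finite dimensional `A`-module supported on a set `S` of primes, if `S` is
stable under `σ` (`FrobData.dimOn_eq_of_twistSum`). Take for `S` the `Φ`-orbit of `Γ_α`, in both
directions. It contains `Γ_α` by definition. It does not contain `Γ_β`: since `Ψ = Fr_X × Id`
satisfies `Ψ Φ = Fr`, which is the identity on points, and moves `Γ_γ` to `Γ_{Fr_X γ}`, a point of
`Γ_β` in the orbit would violate the disjointness assumption (`graph_notMem_orbitPoints`). Hence if
two lattices, related by base change to each other, differ only by a quotient at the zero in one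
direction and a quotient at the pole in the other, then the two quotients are supported on
complementary sets while their dimensions have to agree on each of the two; so both vanish
(`eq_of_dimOn_eq`).

**The second poset.** On cylinders, membership says that `φ` and `g` send the submodule to the same
submodule of `F'` (`Shtuka.isTrivialSub_iff`). This is stable under arbitrary sums, which gives the
greatest element. By the dimension count, applied to the saturation of a member modulo that member,
the saturation is again a member (`FrobData.frobSpan_saturation_eq`). So the greatest element is
saturated, its quotient is torsion-free, and a coherent torsion-free sheaf on a regular curve is
locally free.

**The first poset.** On cylinders, membership of a saturated subsheaf says that `g⁻¹ φ` induces a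
semilinear endomorphism of the quotient that identifies the quotient with its own base change
(`FrobData.TrivialQuotient`). If this holds for the quotients `Q₁` and `Q₂` of `F` by two members,
then the quotient by the intersection is the image `H` of `F` in `Q₁ × Q₂`. The base change of `H`
differs from `H` only at the zero and at the pole, in opposite directions, so the dimension count,
inside the saturation of `H`, gives that `H` coincides with its base change
(`FrobData.TrivialQuotient.prod`). The poset is therefore closed under finite intersections, and as
its members are saturated, a member of minimal rank is the least one.
-/

set_option linter.unusedSectionVars false

namespace Drinfeld

/-! ### Modules supported on a set of primes -/

section Support

variable {A : Type*} [CommRing A] (S : Set (Ideal A)) (T : Type*) [AddCommGroup T] [Module A T]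

/-- The elements of `T` whose support (the primes containing the annihilator) lies in `S`. -/
def supportedOn : Submodule A T where
  carrier := {t | ∀ p : Ideal A, p.IsPrime → (∀ a : A, a • t = 0 → a ∈ p) → p ∈ S}
  zero_mem' p hp h := (hp.ne_top ((Ideal.eq_top_iff_one p).2 (h 1 (smul_zero _)))).elim
  add_mem' {s t} hs ht p hp h := by
    by_contra hpS
    have h1 : ∃ a : A, a • s = 0 ∧ a ∉ p := by
      by_contra! h'
      exact hpS (hs p hp h')
    have h2 : ∃ a : A, a • t = 0 ∧ a ∉ p := by
      by_contra! h'
      exact hpS (ht p hp h')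
    obtain ⟨a, ha, hap⟩ := h1
    obtain ⟨b, hb, hbp⟩ := h2
    have : a * b ∈ p := h _ (by
      rw [smul_add, mul_comm, mul_smul, ha, smul_zero, mul_comm, mul_smul, hb, smul_zero, add_zero])
    exact (hp.mem_or_mem this).elim hap hbp
  smul_mem' c t ht p hp h :=
    ht p hp fun a ha => h a (by rw [smul_comm, ha, smul_zero])

variable {S T}

theorem eq_zero_of_mem_supportedOn {t : T} (h : t ∈ supportedOn S T) (h' : t ∈ supportedOn Sᶜ T) :
    t = 0 := by
  by_contra ht
  obtain ⟨m, hm, hle⟩ := Ideal.exists_le_maximal (Ideal.torsionOf A T t) (by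
    rw [Ne, Ideal.torsionOf_eq_top_iff]; exact ht)
  have hle' : ∀ a : A, a • t = 0 → a ∈ m := fun a ha =>
    hle ((Ideal.mem_torsionOf_iff t a).2 ha)
  exact h' m hm.isPrime hle' (h m hm.isPrime hle')

theorem map_mem_supportedOn {T' : Type*} [AddCommGroup T'] [Module A T'] (f : T →ₗ[A] T') {t : T}
    (ht : t ∈ supportedOn S T) : f t ∈ supportedOn S T' := fun p hp h =>
  ht p hp fun a ha => h a (by rw [← map_smul, ha, map_zero])

theorem mem_supportedOn_of_map {T' : Type*} [AddCommGroup T'] [Module A T'] (f : T →ₗ[A] T')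
    (hf : Function.Injective f) {t : T} (ht : f t ∈ supportedOn S T') : t ∈ supportedOn S T :=
  fun p hp h => ht p hp fun a ha => h a (hf (by rw [map_smul, ha, map_zero]))

variable (E : Type*) [Field E] [Algebra E A] [Module E T] [IsScalarTower E A T]

/-- A module of finite dimension is the sum of its parts supported on `S` and off `S`: the
spectrum of `A / Ann t` is finite and discrete, so an idempotent separates the two parts. -/
theorem exists_add_supportedOn [Module.Finite E T] (S : Set (Ideal A)) (t : T) :
    ∃ r ∈ supportedOn S T, ∃ s ∈ supportedOn Sᶜ T, r + s = t := by
  let R := A ⧸ Ideal.torsionOf A T t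
  have hfin : Module.Finite E R := by
    let f : R →ₗ[E] T :=
      ((Submodule.subtype _).comp
        (Ideal.quotTorsionOfEquivSpanSingleton A T t).toLinearMap).restrictScalars E
    have hf : Function.Injective f :=
      (Submodule.injective_subtype _).comp (Ideal.quotTorsionOfEquivSpanSingleton A T t).injective
    exact Module.Finite.of_injective f hf
  have : IsArtinianRing R := IsArtinianRing.of_finite E R
  obtain ⟨e, he, heS⟩ := PrimeSpectrum.exists_idempotent_basicOpen_eq_of_isClopen
    (s := {p : PrimeSpectrum R | p.asIdeal.comap (Ideal.Quotient.mk _) ∈ S})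
    ⟨isClosed_discrete _, isOpen_discrete _⟩
  obtain ⟨a, rfl⟩ := Ideal.Quotient.mk_surjective e
  have h0 : (1 - a) * a ∈ Ideal.torsionOf A T t := by
    rw [← Ideal.Quotient.eq_zero_iff_mem, map_mul, map_sub, map_one, sub_mul, one_mul, he.eq,
      sub_self]
  rw [Ideal.mem_torsionOf_iff] at h0
  have key (p : Ideal A) (hp : p.IsPrime) (hle : Ideal.torsionOf A T t ≤ p) : p ∈ S ↔ a ∉ p := by
    have hk : RingHom.ker (Ideal.Quotient.mk (Ideal.torsionOf A T t)) ≤ p := by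
      rwa [Ideal.mk_ker]
    have hp' := Ideal.map_isPrime_of_surjective Ideal.Quotient.mk_surjective hk
    have hc : (p.map (Ideal.Quotient.mk (Ideal.torsionOf A T t))).comap
        (Ideal.Quotient.mk _) = p := by
      rw [Ideal.comap_map_of_surjective _ Ideal.Quotient.mk_surjective, ← RingHom.ker_eq_comap_bot,
        sup_eq_left]
      exact hk
    have := Set.ext_iff.1 heS ⟨_, hp'⟩
    simp only [Set.mem_ofPred_eq, SetLike.mem_coe, PrimeSpectrum.mem_basicOpen] at this
    rw [hc] at this
    rw [this, ← Ideal.mem_comap, hc]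
  refine ⟨a • t, ?_, (1 - a) • t, ?_, ?_⟩
  · intro p hp h
    refine (key p hp fun c hc => h c ?_).2 fun hap => ?_
    · rw [smul_comm, (Ideal.mem_torsionOf_iff t c).1 hc, smul_zero]
    · have := h (1 - a) (by rw [← mul_smul]; exact h0)
      exact hp.ne_top ((Ideal.eq_top_iff_one p).2 (by simpa using p.add_mem this hap))
  · intro p hp h hpS
    refine (key p hp fun c hc => h c ?_).1 hpS (h a ?_)
    · rw [smul_comm, (Ideal.mem_torsionOf_iff t c).1 hc, smul_zero]
    · rw [← mul_smul, mul_comm]; exact h0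
  · rw [← add_smul]; simp

theorem finite_supportedOn [Module.Finite E T] (S : Set (Ideal A)) :
    Module.Finite E (supportedOn S T) :=
  Module.Finite.of_injective ((supportedOn S T).subtype.restrictScalars E)
    (Submodule.injective_subtype _)

variable (S T) in
/-- The dimension of the part of `T` supported on `S`. -/
noncomputable def dimOn : ℕ := Module.finrank E (supportedOn S T)

theorem dimOn_congr {T' : Type*} [AddCommGroup T'] [Module A T'] [Module E T']
    [IsScalarTower E A T'] (e : T ≃ₗ[A] T') : dimOn S T E = dimOn S T' E := by
  refine LinearEquiv.finrank_eq (LinearEquiv.restrictScalars E (LinearEquiv.ofLinearMap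
    (e.toLinearMap.restrict (p := supportedOn S T) (q := supportedOn S T')
      fun t ht => map_mem_supportedOn e.toLinearMap ht)
    (e.symm.toLinearMap.restrict (p := supportedOn S T') (q := supportedOn S T)
      fun t ht => map_mem_supportedOn e.symm.toLinearMap ht) ?_ ?_))
  · ext t; simp
  · ext t; simp

/-- `dimOn` is additive in short exact sequences. -/
theorem dimOn_add {T₁ T₃ : Type*} [AddCommGroup T₁] [Module A T₁] [Module E T₁]
    [IsScalarTower E A T₁] [AddCommGroup T₃] [Module A T₃] [Module E T₃]
    [IsScalarTower E A T₃] [Module.Finite E T] (i : T₁ →ₗ[A] T) (p : T →ₗ[A] T₃)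
    (hi : Function.Injective i) (hp : Function.Surjective p) (hex : Function.Exact i p) :
    dimOn S T E = dimOn S T₁ E + dimOn S T₃ E := by
  let i' : supportedOn S T₁ →ₗ[E] supportedOn S T :=
    (i.restrict fun t ht => map_mem_supportedOn i ht).restrictScalars E
  let p' : supportedOn S T →ₗ[E] supportedOn S T₃ :=
    (p.restrict fun t ht => map_mem_supportedOn p ht).restrictScalars E
  have hi' : Function.Injective i' := fun x y h => Subtype.ext (hi (congrArg Subtype.val h))
  have hp' : Function.Surjective p' := by
    rintro ⟨t, ht⟩
    obtain ⟨s, rfl⟩ := hp t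
    obtain ⟨r, hr, r', hr', rfl⟩ := exists_add_supportedOn E S s
    have h0 : p r' = 0 := by
      refine eq_zero_of_mem_supportedOn (S := S) ?_ (map_mem_supportedOn p hr')
      have := Submodule.sub_mem _ ht (map_mem_supportedOn p hr)
      rwa [map_add, add_sub_cancel_left] at this
    exact ⟨⟨r, hr⟩, Subtype.ext (by change p r = p (r + r'); rw [map_add, h0, add_zero])⟩
  have hker : LinearMap.ker p' = LinearMap.range i' := by
    ext ⟨x, hx⟩
    constructor
    · intro h
      obtain ⟨y, rfl⟩ := (hex x).1 (congrArg Subtype.val h)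
      exact ⟨⟨y, mem_supportedOn_of_map i hi hx⟩, rfl⟩
    · rintro ⟨y, hy⟩
      have : i y.1 = x := congrArg Subtype.val hy
      exact Subtype.ext ((hex x).2 ⟨_, this⟩)
  have := finite_supportedOn (T := T) E S
  have h1 := p'.finrank_range_add_finrank_ker
  rw [LinearMap.range_eq_top.2 hp', finrank_top, hker, LinearMap.finrank_range_of_inj hi'] at h1
  rw [dimOn, dimOn, dimOn, ← h1, add_comm]

theorem dimOn_add_compl [Module.Finite E T] :
    dimOn S T E + dimOn Sᶜ T E = Module.finrank E T := by
  have h : IsCompl ((supportedOn S T).restrictScalars E)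
      ((supportedOn Sᶜ T).restrictScalars E) := by
    constructor
    · rw [Submodule.disjoint_def]
      exact fun x h h' => eq_zero_of_mem_supportedOn h h'
    · rw [codisjoint_iff, eq_top_iff]
      intro t _
      obtain ⟨r, hr, s, hs, h⟩ := exists_add_supportedOn E S t
      exact Submodule.mem_sup.2 ⟨r, hr, s, hs, h⟩
  exact Submodule.finrank_add_eq_of_isCompl h

theorem subsingleton_of_dimOn_eq_zero [Module.Finite E T] (h : dimOn S T E = 0)
    (h' : dimOn Sᶜ T E = 0) : Subsingleton T := by
  have := dimOn_add_compl (S := S) (T := T) E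
  rw [h, h'] at this
  exact Module.finrank_zero_iff.1 this.symm

theorem dimOn_eq_zero_of_smul_eq_zero {I : Ideal A}
    (hI : ∀ p : Ideal A, p.IsPrime → I ≤ p → p ∉ S) (hT : ∀ a ∈ I, ∀ t : T, a • t = 0) :
    dimOn S T E = 0 := by
  have : supportedOn S T = ⊥ := by
    rw [eq_bot_iff]
    intro t ht
    refine eq_zero_of_mem_supportedOn ht fun p hp h => hI p hp fun a ha => h a (hT a ha t)
  rw [dimOn, this]
  exact finrank_bot E T

/-! The quotient `U / V` of two submodules `V ≤ U` of `W` is written `U ⧸ V.submoduleOf U`. -/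

section Quotients

variable {W : Type*} [AddCommGroup W] [Module A W] [Module E W] [IsScalarTower E A W]

theorem dimOn_quotient_add {V V' U : Submodule A W} (h : V ≤ V') (h' : V' ≤ U)
    [Module.Finite E (U ⧸ V.submoduleOf U)] :
    dimOn S (U ⧸ V.submoduleOf U) E =
      dimOn S (V' ⧸ V.submoduleOf V') E + dimOn S (U ⧸ V'.submoduleOf U) E := by
  let i : (V' ⧸ V.submoduleOf V') →ₗ[A] (U ⧸ V.submoduleOf U) :=
    Submodule.mapQ _ _ (Submodule.inclusion h') fun x hx => hx
  let p : (U ⧸ V.submoduleOf U) →ₗ[A] (U ⧸ V'.submoduleOf U) :=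
    Submodule.mapQ _ _ LinearMap.id fun x hx => h hx
  refine dimOn_add E i p ?_ ?_ ?_
  · rw [injective_iff_map_eq_zero]
    intro x hx
    obtain ⟨x, rfl⟩ := Submodule.Quotient.mk_surjective _ x
    have hx' : Submodule.inclusion h' x ∈ V.submoduleOf U := (Submodule.Quotient.mk_eq_zero _).1 hx
    exact (Submodule.Quotient.mk_eq_zero _).2 hx'
  · intro y
    obtain ⟨y, rfl⟩ := Submodule.Quotient.mk_surjective _ y
    exact ⟨Submodule.Quotient.mk y, rfl⟩
  · intro y
    obtain ⟨y, rfl⟩ := Submodule.Quotient.mk_surjective _ y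
    constructor
    · intro hy
      have hy' : y ∈ V'.submoduleOf U := (Submodule.Quotient.mk_eq_zero _).1 hy
      exact ⟨Submodule.Quotient.mk ⟨y, hy'⟩, rfl⟩
    · rintro ⟨z, hz⟩
      obtain ⟨z, rfl⟩ := Submodule.Quotient.mk_surjective _ z
      rw [← hz]
      exact (Submodule.Quotient.mk_eq_zero _).2 z.2

theorem finite_quotient_of_le {V V' U : Submodule A W} (h : V ≤ V')
    [Module.Finite E (U ⧸ V.submoduleOf U)] : Module.Finite E (U ⧸ V'.submoduleOf U) := by
  let p : (U ⧸ V.submoduleOf U) →ₗ[A] (U ⧸ V'.submoduleOf U) :=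
    Submodule.mapQ _ _ LinearMap.id fun x hx => h hx
  refine Module.Finite.of_surjective (p.restrictScalars E) fun y => ?_
  obtain ⟨y, rfl⟩ := Submodule.Quotient.mk_surjective _ y
  exact ⟨Submodule.Quotient.mk y, rfl⟩

/-- Two submodules coincide if the parts on `S` and off `S` of their quotients by the
intersection have the same dimension, `I ⊆ A` is supported off `S` and sends the second into the
first, and `J ⊆ A` is supported on `S` and sends the first into the second. -/
theorem eq_of_dimOn_eq {U₁ U₂ : Submodule A W} {I J : Ideal A}
    [Module.Finite E (U₁ ⧸ (U₁ ⊓ U₂).submoduleOf U₁)]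
    [Module.Finite E (U₂ ⧸ (U₁ ⊓ U₂).submoduleOf U₂)]
    (h : dimOn S (U₁ ⧸ (U₁ ⊓ U₂).submoduleOf U₁) E = dimOn S (U₂ ⧸ (U₁ ⊓ U₂).submoduleOf U₂) E)
    (h' : dimOn Sᶜ (U₁ ⧸ (U₁ ⊓ U₂).submoduleOf U₁) E =
      dimOn Sᶜ (U₂ ⧸ (U₁ ⊓ U₂).submoduleOf U₂) E)
    (hI : ∀ p : Ideal A, p.IsPrime → I ≤ p → p ∉ S) (hJ : ∀ p : Ideal A, p.IsPrime → J ≤ p → p ∈ S)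
    (hIU : ∀ a ∈ I, ∀ x ∈ U₂, a • x ∈ U₁) (hJU : ∀ a ∈ J, ∀ x ∈ U₁, a • x ∈ U₂) : U₁ = U₂ := by
  have h1 : dimOn Sᶜ (U₁ ⧸ (U₁ ⊓ U₂).submoduleOf U₁) E = 0 := by
    refine dimOn_eq_zero_of_smul_eq_zero E (I := J) (fun p hp hle => not_not.2 (hJ p hp hle)) ?_
    intro a ha t
    obtain ⟨t, rfl⟩ := Submodule.Quotient.mk_surjective _ t
    exact (Submodule.Quotient.mk_eq_zero _).2 ⟨U₁.smul_mem a t.2, hJU a ha _ t.2⟩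
  have h2 : dimOn S (U₂ ⧸ (U₁ ⊓ U₂).submoduleOf U₂) E = 0 := by
    refine dimOn_eq_zero_of_smul_eq_zero E (I := I) hI ?_
    intro a ha t
    obtain ⟨t, rfl⟩ := Submodule.Quotient.mk_surjective _ t
    exact (Submodule.Quotient.mk_eq_zero _).2 ⟨hIU a ha _ t.2, U₂.smul_mem a t.2⟩
  have s1 := subsingleton_of_dimOn_eq_zero E (h.trans h2) h1
  have s2 := subsingleton_of_dimOn_eq_zero E h2 (h'.symm.trans h1)
  refine le_antisymm (fun x hx => ?_) fun x hx => ?_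
  · exact ((Submodule.Quotient.mk_eq_zero _).1 (s1.elim (Submodule.Quotient.mk ⟨x, hx⟩) 0)).2
  · exact ((Submodule.Quotient.mk_eq_zero _).1 (s2.elim (Submodule.Quotient.mk ⟨x, hx⟩) 0)).1

end Quotients

end Support

/-! ### Semilinear maps that span a base change -/

/-- A ring endomorphism `σ` of an algebra `A` over a field `E`, lying over an endomorphism `τ` of
`E`, such that `A` is the base change of itself along `τ`. This is expressed by a basis `b` of `E`
over `τ E` whose image is a basis of `A` over `σ A`. Every nonzero element of `A` divides a nonzero
element of `σ A`. -/
structure FrobData (E A : Type u) [Field E] [CommRing A] [Algebra E A] where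
  τ : E →+* E
  σ : A →+* A
  σ_algebraMap (c : E) : σ (algebraMap E A c) = algebraMap E A (τ c)
  ι : Type u
  b : ι → E
  bijE : Function.Bijective fun x : ι →₀ E => x.sum fun i c => b i * τ c
  bijA : Function.Bijective fun x : ι →₀ A => x.sum fun i a => algebraMap E A (b i) * σ a
  exists_dvd (a : A) (ha : a ≠ 0) : ∃ a' ≠ 0, a ∣ σ a'

/-- The saturation of a submodule: the elements with a nonzero multiple in it. -/
def saturation {A W : Type*} [CommRing A] [IsDomain A] [AddCommGroup W] [Module A W]
    (X : Submodule A W) : Submodule A W where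
  carrier := {w | ∃ c : A, c ≠ 0 ∧ c • w ∈ X}
  zero_mem' := ⟨1, one_ne_zero, by simp⟩
  add_mem' := by
    rintro v w ⟨c, hc, hv⟩ ⟨d, hd, hw⟩
    refine ⟨c * d, mul_ne_zero hc hd, ?_⟩
    rw [smul_add]
    refine X.add_mem ?_ ?_
    · rw [mul_comm, mul_smul]; exact X.smul_mem _ hv
    · rw [mul_smul]; exact X.smul_mem _ hw
  smul_mem' := by
    rintro a w ⟨c, hc, hw⟩
    exact ⟨c, hc, by rw [smul_comm]; exact X.smul_mem _ hw⟩

theorem le_saturation {A W : Type*} [CommRing A] [IsDomain A] [AddCommGroup W] [Module A W]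
    (X : Submodule A W) : X ≤ saturation X := fun w hw => ⟨1, one_ne_zero, by simpa using hw⟩

namespace FrobData

variable {E A : Type u} [Field E] [CommRing A] [Algebra E A] (D : FrobData E A)

section TwistSum

variable {F W : Type*} [AddCommGroup F] [AddCommGroup W] [Module E W]

/-- The map `(x i) ↦ ∑ b i • φ (x i)`. For a semilinear map `φ` it is the linear extension of `φ`
to the base change of `F`, because `b` is a basis. -/
noncomputable def twistSum (φ : F →+ W) : (D.ι →₀ F) →+ W :=
  Finsupp.liftAddHom fun i => (DistribSMul.toAddMonoidHom W (D.b i)).comp φ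

theorem twistSum_apply (φ : F →+ W) (x : D.ι →₀ F) :
    D.twistSum φ x = x.sum fun i m => D.b i • φ m := rfl

@[simp] theorem twistSum_single (φ : F →+ W) (i : D.ι) (m : F) :
    D.twistSum φ (Finsupp.single i m) = D.b i • φ m := by
  simp [twistSum]

variable {T T' : Type*} [AddCommGroup T] [Module E T] [AddCommGroup T'] [Module E T']
  (φ : T →ₛₗ[D.τ] T')

/-- A semilinear map with injective linear extension preserves linear independence: expand the
coefficients of a relation in the basis `b`. -/
theorem linearIndependent_of_twistSum {J : Type*} [Fintype J] {t : J → T}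
    (ht : LinearIndependent E t) (hφ : Function.Injective (D.twistSum φ.toAddMonoidHom)) :
    LinearIndependent E fun j => φ (t j) := by
  rw [Fintype.linearIndependent_iff]
  intro g hg j
  choose c hc using fun j => D.bijE.2 (g j)
  have h0 : (∑ j, (c j).mapRange (fun r => r • t j) (zero_smul _ _)) = 0 := by
    refine hφ ?_
    rw [map_sum, map_zero, ← hg]
    refine Finset.sum_congr rfl fun j _ => ?_
    rw [twistSum_apply, Finsupp.sum_mapRange_index (by simp), ← hc]
    simp [Finsupp.sum, Finset.sum_smul, mul_smul]
  have h1 (i : D.ι) : ∑ j, c j i • t j = 0 := by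
    have := DFunLike.congr_fun h0 i
    simpa using this
  have h2 (i : D.ι) (j : J) : c j i = 0 := Fintype.linearIndependent_iff.1 ht _ (h1 i) j
  have : c j = 0 := Finsupp.ext fun i => h2 i j
  rw [← hc, this]
  simp

theorem span_eq_top_of_twistSum {J : Type*} {t : J → T}
    (ht : Submodule.span E (Set.range t) = ⊤)
    (hφ : Function.Surjective (D.twistSum φ.toAddMonoidHom)) :
    Submodule.span E (Set.range fun j => φ (t j)) = ⊤ := by
  have h1 (x : T) : φ x ∈ Submodule.span E (Set.range fun j => φ (t j)) := by
    have hx : x ∈ Submodule.span E (Set.range t) := ht ▸ trivial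
    induction hx using Submodule.span_induction with
    | mem x hx => obtain ⟨j, rfl⟩ := hx; exact Submodule.subset_span ⟨j, rfl⟩
    | zero => simp
    | add x y _ _ hx hy => rw [map_add]; exact Submodule.add_mem _ hx hy
    | smul a x _ hx => rw [map_smulₛₗ]; exact Submodule.smul_mem _ _ hx
  rw [eq_top_iff]
  intro y _
  obtain ⟨x, rfl⟩ := hφ y
  exact Submodule.sum_mem _ fun i _ => Submodule.smul_mem _ _ (h1 _)

end TwistSum

section Modules

variable {F W : Type*} [AddCommGroup F] [Module A F]
  [AddCommGroup W] [Module A W] [Module E W] [IsScalarTower E A W] (φ : F →ₛₗ[D.σ] W)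

/-- The submodule spanned by the image of a submodule under a semilinear map. -/
def frobSpan (X : Submodule A F) : Submodule A W := Submodule.span A (φ '' X)

variable {φ} in
theorem mem_frobSpan_of_mem {X : Submodule A F} {x : F} (hx : x ∈ X) : φ x ∈ D.frobSpan φ X :=
  Submodule.subset_span ⟨x, hx, rfl⟩

theorem frobSpan_mono {X Y : Submodule A F} (h : X ≤ Y) : D.frobSpan φ X ≤ D.frobSpan φ Y :=
  Submodule.span_mono (Set.image_mono h)

theorem smul_mem_range_twistSum (X : Submodule A F) (a : A) {x : F} (hx : x ∈ X) :
    ∃ y : D.ι →₀ F, (∀ i, y i ∈ X) ∧ D.twistSum φ.toAddMonoidHom y = a • φ x := by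
  obtain ⟨c, rfl⟩ := D.bijA.2 a
  refine ⟨c.mapRange (fun r => r • x) (zero_smul _ _), fun i => X.smul_mem _ hx, ?_⟩
  rw [twistSum_apply, Finsupp.sum_mapRange_index (by simp)]
  simp [Finsupp.sum, Finset.sum_smul, mul_smul, map_smulₛₗ]

variable {φ} in
/-- The span of `φ X` is the image of the base change of `X`. -/
theorem mem_frobSpan_iff {X : Submodule A F} {w : W} :
    w ∈ D.frobSpan φ X ↔
      ∃ y : D.ι →₀ F, (∀ i, y i ∈ X) ∧ D.twistSum φ.toAddMonoidHom y = w := by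
  constructor
  · intro hw
    let G : AddSubmonoid W :=
      { carrier := {w | ∃ y : D.ι →₀ F, (∀ i, y i ∈ X) ∧ D.twistSum φ.toAddMonoidHom y = w}
        zero_mem' := ⟨0, fun _ => X.zero_mem, map_zero _⟩
        add_mem' := by
          rintro _ _ ⟨y, hy, rfl⟩ ⟨z, hz, rfl⟩
          exact ⟨y + z, fun i => X.add_mem (hy i) (hz i), map_add _ _ _⟩ }
    let N : Submodule A W :=
      { G with
        smul_mem' := by
          rintro a _ ⟨y, hy, rfl⟩
          change a • D.twistSum φ.toAddMonoidHom y ∈ G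
          rw [twistSum_apply, Finsupp.sum, Finset.smul_sum]
          refine G.sum_mem fun i _ => ?_
          rw [← algebraMap_smul A (D.b i) (φ.toAddMonoidHom (y i)), ← mul_smul]
          exact D.smul_mem_range_twistSum φ X _ (hy i) }
    have hle : D.frobSpan φ X ≤ N := by
      refine Submodule.span_le.2 ?_
      rintro _ ⟨x, hx, rfl⟩
      obtain ⟨y, hy, h⟩ := D.smul_mem_range_twistSum φ X 1 hx
      exact ⟨y, hy, by rw [h, one_smul]⟩
    exact hle hw
  · rintro ⟨y, hy, rfl⟩
    refine Submodule.sum_mem _ fun i _ => ?_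
    change D.b i • φ (y i) ∈ _
    rw [← algebraMap_smul A]
    exact Submodule.smul_mem _ _ (D.mem_frobSpan_of_mem (hy i))

theorem frobSpan_iSup {κ : Sort*} (X : κ → Submodule A F) :
    D.frobSpan φ (⨆ k, X k) = ⨆ k, D.frobSpan φ (X k) := by
  refine le_antisymm (Submodule.span_le.2 ?_) (iSup_le fun k => D.frobSpan_mono φ (le_iSup X k))
  rintro _ ⟨x, hx, rfl⟩
  refine Submodule.iSup_induction X (motive := fun x => φ x ∈ ⨆ k, D.frobSpan φ (X k)) hx ?_ ?_ ?_
  · exact fun k x hx => le_iSup (fun k => D.frobSpan φ (X k)) k (D.mem_frobSpan_of_mem hx)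
  · rw [map_zero]; exact zero_mem _
  · intro x y hx hy; rw [map_add]; exact add_mem hx hy

variable {φ}

theorem mem_of_mem_frobSpan (hφ : Function.Injective (D.twistSum φ.toAddMonoidHom))
    {X : Submodule A F} {y : D.ι →₀ F} (h : D.twistSum φ.toAddMonoidHom y ∈ D.frobSpan φ X)
    (i : D.ι) : y i ∈ X := by
  obtain ⟨x, hx, hxy⟩ := D.mem_frobSpan_iff.1 h
  rw [← hφ hxy]
  exact hx i

theorem smul_twistSum (a : A) (y : D.ι →₀ F) :
    D.σ a • D.twistSum φ.toAddMonoidHom y = D.twistSum φ.toAddMonoidHom (a • y) := by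
  rw [twistSum_apply, twistSum_apply, Finsupp.sum_smul_index' (by simp), Finsupp.smul_sum]
  refine Finset.sum_congr rfl fun i _ => ?_
  simp only [LinearMap.toAddMonoidHom_coe, map_smulₛₗ]
  rw [smul_comm]

section Saturation

variable [IsDomain A]

theorem σ_ne_zero {a : A} (ha : a ≠ 0) : D.σ a ≠ 0 := by
  intro h
  have hE : ∃ i, D.b i ≠ 0 := by
    by_contra! h0
    obtain ⟨x, hx⟩ := D.bijE.2 1
    simp [h0, Finsupp.sum] at hx
  obtain ⟨i, -⟩ := hE
  have : Finsupp.single i a = 0 := D.bijA.1 (by simp [h])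
  exact ha (Finsupp.single_eq_zero.1 this)

theorem frobSpan_saturation_le (X : Submodule A F) :
    D.frobSpan φ (saturation X) ≤ saturation (D.frobSpan φ X) := by
  refine Submodule.span_le.2 ?_
  rintro _ ⟨x, ⟨c, hc, hx⟩, rfl⟩
  exact ⟨D.σ c, D.σ_ne_zero hc, by rw [← map_smulₛₗ]; exact D.mem_frobSpan_of_mem hx⟩

/-- An element of the base change of `F` that is torsion modulo the base change of `X` lies in the
base change of the saturation of `X`, since denominators can be taken in `σ A`. -/
theorem mem_frobSpan_saturation (hφ : Function.Injective (D.twistSum φ.toAddMonoidHom))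
    {X : Submodule A F} {w : W} (hw : w ∈ D.frobSpan φ ⊤) (h : w ∈ saturation (D.frobSpan φ X)) :
    w ∈ D.frobSpan φ (saturation X) := by
  obtain ⟨y, -, rfl⟩ := D.mem_frobSpan_iff.1 hw
  obtain ⟨c, hc, h⟩ := h
  obtain ⟨a, ha, d, hd⟩ := D.exists_dvd c hc
  have h' : D.twistSum φ.toAddMonoidHom (a • y) ∈ D.frobSpan φ X := by
    rw [← smul_twistSum, hd, mul_comm, mul_smul]
    exact Submodule.smul_mem _ _ h
  exact D.mem_frobSpan_iff.2 ⟨y, fun i => ⟨a, ha, D.mem_of_mem_frobSpan hφ h' i⟩, rfl⟩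

end Saturation

section Dimension

/-- The set `S` of primes is stable under `σ`. -/
def Stable (S : Set (Ideal A)) : Prop := ∀ p : Ideal A, p.IsPrime → (p.comap D.σ ∈ S ↔ p ∈ S)

theorem Stable.compl {S : Set (Ideal A)} (hS : D.Stable S) : D.Stable Sᶜ := fun p hp =>
  not_congr (hS p hp)

variable {T T' : Type*} [AddCommGroup T] [Module A T] [Module E T] [IsScalarTower E A T]
  [AddCommGroup T'] [Module A T'] [Module E T'] [IsScalarTower E A T']

/-- A `σ`-semilinear map is `τ`-semilinear over `E`. -/
def toSemilinear (φ : T →ₛₗ[D.σ] T') : T →ₛₗ[D.τ] T' where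
  toFun := φ
  map_add' := map_add φ
  map_smul' c t := by
    rw [← algebraMap_smul A c t, map_smulₛₗ, σ_algebraMap, algebraMap_smul]

theorem map_mem_supportedOn_twist {S : Set (Ideal A)} (hS : D.Stable S) (φ : T →ₛₗ[D.σ] T') {t : T}
    (ht : t ∈ supportedOn S T) : φ t ∈ supportedOn S T' := fun p hp h =>
  (hS p hp).1 (ht _ (Ideal.IsPrime.comap _) fun a ha =>
    h (D.σ a) (by rw [← map_smulₛₗ, ha, map_zero]))

theorem finite_of_twistSum [Module.Finite E T] (φ : T →ₛₗ[D.σ] T')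
    (hφ : Function.Surjective (D.twistSum φ.toAddMonoidHom)) : Module.Finite E T' := by
  have := D.span_eq_top_of_twistSum (D.toSemilinear φ) (Module.finBasis E T).span_eq hφ
  exact ⟨Submodule.fg_def.2 ⟨_, Set.finite_range _, this⟩⟩

theorem dimOn_le_of_twistSum [Module.Finite E T] [Module.Finite E T'] {S : Set (Ideal A)}
    (hS : D.Stable S) (φ : T →ₛₗ[D.σ] T')
    (hφ : Function.Injective (D.twistSum φ.toAddMonoidHom)) : dimOn S T E ≤ dimOn S T' E := by
  have := finite_supportedOn (T := T) E S
  have := finite_supportedOn (T := T') E S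
  have h1 := D.linearIndependent_of_twistSum (D.toSemilinear φ)
    (t := fun j => ((Module.finBasis E (supportedOn S T) j : supportedOn S T) : T))
    ((Module.finBasis E (supportedOn S T)).linearIndependent.map'
      ((supportedOn S T).subtype.restrictScalars E)
      (LinearMap.ker_eq_bot.2 (Submodule.injective_subtype _))) hφ
  have h2 : LinearIndependent E fun j =>
      (⟨φ (Module.finBasis E (supportedOn S T) j : supportedOn S T),
        D.map_mem_supportedOn_twist hS φ (Submodule.coe_mem _)⟩ : supportedOn S T') :=
    LinearIndependent.of_comp ((supportedOn S T').subtype.restrictScalars E) h1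
  simpa [dimOn] using h2.fintype_card_le_finrank

/-- Base change along `τ` preserves dimensions, and hence the dimensions of the parts supported on
and off a stable set of primes. -/
theorem dimOn_eq_of_twistSum [Module.Finite E T] {S : Set (Ideal A)}
    (hS : D.Stable S) (φ : T →ₛₗ[D.σ] T')
    (hφ : Function.Bijective (D.twistSum φ.toAddMonoidHom)) : dimOn S T E = dimOn S T' E := by
  have := D.finite_of_twistSum φ hφ.2
  have h1 := D.dimOn_le_of_twistSum hS φ hφ.1
  have h2 := D.dimOn_le_of_twistSum (hS.compl D) φ hφ.1
  have h3 : Module.finrank E T' ≤ Module.finrank E T := by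
    have := finrank_le_of_span_eq_top
      (D.span_eq_top_of_twistSum (D.toSemilinear φ) (Module.finBasis E T).span_eq hφ.2)
    simpa using this
  have h4 := dimOn_add_compl (S := S) (T := T) E
  have h5 := dimOn_add_compl (S := S) (T := T') E
  omega

end Dimension

end Modules

end FrobData

/-! ### Frobenius-stable lattices -/

/-- A finitely generated torsion module over a one-dimensional domain of finite type over a field
has finite dimension. -/
theorem finite_of_torsion {E A T : Type*} [Field E] [CommRing A] [IsDomain A]
    [Ring.DimensionLEOne A] [Algebra E A] [Algebra.FiniteType E A] [AddCommGroup T] [Module A T]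
    [Module E T]
    [IsScalarTower E A T] [Module.Finite A T] (hT : ∀ t : T, ∃ c : A, c ≠ 0 ∧ c • t = 0) :
    Module.Finite E T := by
  obtain ⟨s, hs⟩ := Module.Finite.fg_top (R := A) (M := T)
  choose c hc hct using hT
  let C := ∏ t ∈ s, c t
  have hC : C ≠ 0 := Finset.prod_ne_zero_iff.2 fun t _ => hc t
  have hCT (t : T) : C • t = 0 := by
    have ht : t ∈ Submodule.span A (s : Set T) := hs ▸ trivial
    induction ht using Submodule.span_induction with
    | mem x hx =>
      obtain ⟨d, hd⟩ := Finset.dvd_prod_of_mem c hx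
      change (∏ t ∈ s, c t) • x = 0
      rw [hd, mul_comm, mul_smul, hct, smul_zero]
    | zero => simp
    | add x y _ _ hx hy => rw [smul_add, hx, hy, add_zero]
    | smul a x _ hx => rw [smul_comm, hx, smul_zero]
  let I := Ideal.span {C}
  have : Ring.KrullDimLE 0 (A ⧸ I) := by
    refine Ring.KrullDimLE.mk₀ fun p hp => ?_
    have hq : (p.comap (Ideal.Quotient.mk I)).IsPrime := Ideal.IsPrime.comap _
    have hq0 : p.comap (Ideal.Quotient.mk I) ≠ ⊥ := by
      intro h
      have : C ∈ p.comap (Ideal.Quotient.mk I) := by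
        rw [Ideal.mem_comap, Ideal.Quotient.eq_zero_iff_mem.2 (Ideal.mem_span_singleton_self C)]
        exact zero_mem _
      rw [h] at this
      exact hC this
    have := Ring.DimensionLEOne.maximalOfPrime hq0 hq
    rw [← Ideal.map_comap_of_surjective _ Ideal.Quotient.mk_surjective p]
    refine (Ideal.map_eq_top_or_isMaximal_of_surjective _ Ideal.Quotient.mk_surjective
      this).resolve_left fun h => hp.ne_top ?_
    rwa [Ideal.map_comap_of_surjective _ Ideal.Quotient.mk_surjective] at h
  have : Module.Finite E (A ⧸ I) := (Module.finite_iff_krullDimLE_zero E (A ⧸ I)).2 inferInstance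
  have hI : Module.IsTorsionBySet A T I := fun t a => by
    obtain ⟨d, hd⟩ := Ideal.mem_span_singleton.1 a.2
    rw [hd, mul_comm, mul_smul, hCT, smul_zero]
  let : Module (A ⧸ I) T := hI.module
  have : IsScalarTower A (A ⧸ I) T := hI.isScalarTower
  have : IsScalarTower E (A ⧸ I) T := ⟨fun c x t => by
    obtain ⟨a, rfl⟩ := Ideal.Quotient.mk_surjective x
    exact smul_assoc c a t⟩
  have : Module.Finite (A ⧸ I) T := Module.Finite.of_restrictScalars_finite A (A ⧸ I) T
  exact Module.Finite.trans (A ⧸ I) T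

namespace FrobData

variable {E A : Type u} [Field E] [CommRing A] [Algebra E A] (D : FrobData E A)
variable {F W : Type*} [AddCommGroup F] [Module A F] [Module E F] [IsScalarTower E A F]
  [AddCommGroup W] [Module A W] [Module E W] [IsScalarTower E A W] {φ : F →ₛₗ[D.σ] W}
  {g : F →ₗ[A] W}

/-- The semilinear map on quotients of submodules. -/
noncomputable def quotientMap (X Y : Submodule A F) (φ : F →ₛₗ[D.σ] W) :
    (Y ⧸ X.submoduleOf Y) →ₛₗ[D.σ]
      (D.frobSpan φ Y ⧸ (D.frobSpan φ X).submoduleOf (D.frobSpan φ Y)) :=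
  Submodule.mapQ _ _ (φ.restrict fun _ hx => D.mem_frobSpan_of_mem hx)
    fun _ hx => D.mem_frobSpan_of_mem (φ := φ) hx

theorem twistSum_quotientMap (X Y : Submodule A F) (y : D.ι →₀ Y) :
    D.twistSum (D.quotientMap X Y φ).toAddMonoidHom (y.mapRange (Submodule.mkQ _) (map_zero _)) =
      Submodule.Quotient.mk ⟨D.twistSum φ.toAddMonoidHom (y.mapRange Subtype.val rfl),
        D.mem_frobSpan_iff.2 ⟨_, fun i => (y i).2, rfl⟩⟩ := by
  induction y using Finsupp.induction_linear with
  | zero => simp; rfl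
  | add x y hx hy =>
    rw [Finsupp.mapRange_add (map_add _), map_add, hx, hy, ← Submodule.Quotient.mk_add]
    congr 1
    refine Subtype.ext ?_
    exact ((congrArg _ (Finsupp.mapRange_add (fun _ _ => rfl) x y)).trans (map_add _ _ _)).symm
  | single i m =>
    simp only [Finsupp.mapRange_single, twistSum_single]
    rfl

theorem bijective_twistSum_quotientMap (hφ : Function.Injective (D.twistSum φ.toAddMonoidHom))
    (X Y : Submodule A F) :
    Function.Bijective (D.twistSum (D.quotientMap X Y φ).toAddMonoidHom) := by
  constructor
  · rw [injective_iff_map_eq_zero]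
    intro y hy
    obtain ⟨y, rfl⟩ := Finsupp.mapRange_surjective (Submodule.mkQ _) (map_zero _)
      (Submodule.mkQ_surjective _) y
    rw [twistSum_quotientMap, Submodule.Quotient.mk_eq_zero] at hy
    refine Finsupp.ext fun i => ?_
    exact (Submodule.Quotient.mk_eq_zero _).2 (D.mem_of_mem_frobSpan hφ hy i)
  · intro w
    obtain ⟨⟨w, hw⟩, rfl⟩ := Submodule.Quotient.mk_surjective _ w
    obtain ⟨y, hy, rfl⟩ := D.mem_frobSpan_iff.1 hw
    obtain ⟨y, rfl⟩ : ∃ z : D.ι →₀ Y, z.mapRange Subtype.val rfl = y := by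
      refine ⟨Finsupp.onFinset y.support (fun i => ⟨y i, hy i⟩) fun i h => ?_, ?_⟩
      · rw [Finsupp.mem_support_iff]
        exact fun h' => h (Subtype.ext h')
      · ext i; rfl
    exact ⟨_, D.twistSum_quotientMap X Y y⟩

theorem finite_frobSpan_quotient (hφ : Function.Injective (D.twistSum φ.toAddMonoidHom))
    (X Y : Submodule A F) [Module.Finite E (Y ⧸ X.submoduleOf Y)] :
    Module.Finite E (D.frobSpan φ Y ⧸ (D.frobSpan φ X).submoduleOf (D.frobSpan φ Y)) :=
  D.finite_of_twistSum _ (D.bijective_twistSum_quotientMap hφ X Y).2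

theorem dimOn_frobSpan_quotient {S : Set (Ideal A)} (hS : D.Stable S)
    (hφ : Function.Injective (D.twistSum φ.toAddMonoidHom))
    (X Y : Submodule A F) [Module.Finite E (Y ⧸ X.submoduleOf Y)] :
    dimOn S (D.frobSpan φ Y ⧸ (D.frobSpan φ X).submoduleOf (D.frobSpan φ Y)) E =
      dimOn S (Y ⧸ X.submoduleOf Y) E :=
  (D.dimOn_eq_of_twistSum hS _ (D.bijective_twistSum_quotientMap hφ X Y)).symm

end FrobData

section MapQuotient

variable {E A : Type u} [Field E] [CommRing A] [Algebra E A]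
variable {F W : Type*} [AddCommGroup F] [Module A F] [Module E F] [IsScalarTower E A F]
  [AddCommGroup W] [Module A W] [Module E W] [IsScalarTower E A W] {g : F →ₗ[A] W}

/-- An injective linear map identifies quotients of submodules with those of their images. -/
noncomputable def mapQuotientEquiv (hg : Function.Injective g) (X Y : Submodule A F) :
    (Y ⧸ X.submoduleOf Y) ≃ₗ[A] (Y.map g ⧸ (X.map g).submoduleOf (Y.map g)) :=
  Submodule.Quotient.equiv _ _ (Submodule.equivMapOfInjective g hg Y) (by
    ext ⟨w, hw⟩
    obtain ⟨y, hy, rfl⟩ := hw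
    constructor
    · rintro ⟨⟨x, hx⟩, hxX, h⟩
      refine ⟨x, hxX, ?_⟩
      exact congrArg Subtype.val h
    · rintro ⟨x, hx, h⟩
      obtain rfl := hg h
      exact ⟨⟨x, hy⟩, hx, rfl⟩)

theorem finite_map_quotient (hg : Function.Injective g) (X Y : Submodule A F)
    [Module.Finite E (Y ⧸ X.submoduleOf Y)] :
    Module.Finite E (Y.map g ⧸ (X.map g).submoduleOf (Y.map g)) :=
  Module.Finite.equiv ((mapQuotientEquiv hg X Y).restrictScalars E)

theorem dimOn_map_quotient (S : Set (Ideal A)) (hg : Function.Injective g) (X Y : Submodule A F) :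
    dimOn S (Y.map g ⧸ (X.map g).submoduleOf (Y.map g)) E = dimOn S (Y ⧸ X.submoduleOf Y) E :=
  (dimOn_congr E (mapQuotientEquiv hg X Y)).symm

theorem finite_quotient_inf {U V V' : Submodule A W} [Module.Finite E (U ⧸ V.submoduleOf U)]
    [Module.Finite E (U ⧸ V'.submoduleOf U)] : Module.Finite E (U ⧸ (V ⊓ V').submoduleOf U) := by
  let i₁ : (U ⧸ (V ⊓ V').submoduleOf U) →ₗ[A] (U ⧸ V.submoduleOf U) :=
    Submodule.mapQ _ _ LinearMap.id (Submodule.comap_mono inf_le_left)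
  let i₂ : (U ⧸ (V ⊓ V').submoduleOf U) →ₗ[A] (U ⧸ V'.submoduleOf U) :=
    Submodule.mapQ _ _ LinearMap.id (Submodule.comap_mono inf_le_right)
  refine Module.Finite.of_injective ((i₁.prod i₂).restrictScalars E) ?_
  rw [LinearMap.coe_restrictScalars, injective_iff_map_eq_zero]
  intro x hx
  obtain ⟨x, rfl⟩ := Submodule.Quotient.mk_surjective _ x
  have h1 : (Submodule.Quotient.mk x : U ⧸ V.submoduleOf U) = 0 := congrArg Prod.fst hx
  have h2 : (Submodule.Quotient.mk x : U ⧸ V'.submoduleOf U) = 0 := congrArg Prod.snd hx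
  rw [Submodule.Quotient.mk_eq_zero] at h1 h2 ⊢
  exact ⟨h1, h2⟩

theorem finite_quotient_of_le_right {U U' V : Submodule A W} (h : U' ≤ U)
    [Module.Finite E (U ⧸ V.submoduleOf U)] : Module.Finite E (U' ⧸ V.submoduleOf U') := by
  let i : (U' ⧸ V.submoduleOf U') →ₗ[A] (U ⧸ V.submoduleOf U) :=
    Submodule.mapQ _ _ (Submodule.inclusion h) fun x hx => hx
  refine Module.Finite.of_injective (i.restrictScalars E) ?_
  rw [LinearMap.coe_restrictScalars, injective_iff_map_eq_zero]
  intro x hx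
  obtain ⟨x, rfl⟩ := Submodule.Quotient.mk_surjective _ x
  have h1 : (Submodule.Quotient.mk (Submodule.inclusion h x) : U ⧸ V.submoduleOf U) = 0 := hx
  rw [Submodule.Quotient.mk_eq_zero] at h1 ⊢
  exact h1

end MapQuotient

namespace FrobData

variable {E A : Type u} [Field E] [CommRing A] [IsDomain A] [Algebra E A] (D : FrobData E A)
variable {F W : Type*} [AddCommGroup F] [Module A F] [Module E F] [IsScalarTower E A F]
  [AddCommGroup W] [Module A W] [Module E W] [IsScalarTower E A W] {φ : F →ₛₗ[D.σ] W}
  {g : F →ₗ[A] W} {S : Set (Ideal A)} {I J : Ideal A}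

/-- If the base change of `X` agrees with `X` inside `W`, then so does that of its saturation `N`:
the dimensions of the parts on `S` and off `S` of `N / X` are the same before and after base
change, whereas the two images of `N` can only differ by a quotient on `S` and a quotient off `S`,
in opposite directions. -/
theorem frobSpan_saturation_eq (hS : D.Stable S)
    (hφ : Function.Injective (D.twistSum φ.toAddMonoidHom)) (hg : Function.Injective g)
    (hI : ∀ p : Ideal A, p.IsPrime → I ≤ p → p ∉ S) (hJ : ∀ p : Ideal A, p.IsPrime → J ≤ p → p ∈ S)
    (hIg : ∀ a ∈ I, ∀ w : W, a • w ∈ LinearMap.range g)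
    (hJφ : ∀ a ∈ J, ∀ w : W, a • w ∈ D.frobSpan φ ⊤)
    {X : Submodule A F} (hX : D.frobSpan φ X = X.map g)
    [Module.Finite E (saturation X ⧸ X.submoduleOf (saturation X))] :
    D.frobSpan φ (saturation X) = (saturation X).map g := by
  have h1 : X.map g ≤ (saturation X).map g := Submodule.map_mono (le_saturation X)
  have h2 : X.map g ≤ D.frobSpan φ (saturation X) := hX ▸ D.frobSpan_mono φ (le_saturation X)
  have f1 := finite_map_quotient (E := E) hg X (saturation X)
  have f2 := D.finite_frobSpan_quotient hφ X (saturation X)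
  have d1 T := dimOn_map_quotient (E := E) T hg X (saturation X)
  have d2 T (hT : D.Stable T) := D.dimOn_frobSpan_quotient hT hφ X (saturation X)
  rw [hX] at f2 d2
  have e1 T := dimOn_quotient_add E (S := T) (le_inf h1 h2) inf_le_left
  have e2 T := dimOn_quotient_add E (S := T) (le_inf h1 h2) inf_le_right
  have := finite_quotient_of_le E (le_inf h1 h2) (U := (saturation X).map g)
  have := finite_quotient_of_le E (le_inf h1 h2) (U := D.frobSpan φ (saturation X))
  refine (eq_of_dimOn_eq E (S := S) (I := I) (J := J) ?_ ?_ hI hJ ?_ ?_).symm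
  · have := e1 S; have := e2 S; have := d1 S; have := d2 S hS
    omega
  · have := e1 Sᶜ; have := e2 Sᶜ; have := d1 Sᶜ; have := d2 Sᶜ (hS.compl D)
    omega
  · intro a ha w hw
    obtain ⟨m, hm⟩ := hIg a ha w
    obtain ⟨c, hc, hcw⟩ := D.frobSpan_saturation_le X hw
    rw [hX] at hcw
    obtain ⟨x, hx, hxw⟩ := hcw
    refine ⟨m, ⟨c, hc, ?_⟩, hm⟩
    have : g (c • m) = g (a • x) := by
      rw [map_smul, map_smul, hm, hxw, smul_comm]
    rw [hg this]
    exact X.smul_mem a hx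
  · rintro a ha _ ⟨m, ⟨c, hc, hm⟩, rfl⟩
    refine D.mem_frobSpan_saturation hφ (hJφ a ha _) ⟨c, hc, ?_⟩
    rw [hX, smul_comm]
    exact Submodule.smul_mem _ _ ⟨_, hm, map_smul g c m⟩

/-- If the base change of `M` is identified with `M` inside `W`, and the base change of a submodule
`H` of full rank in its saturation can only differ from `H` by a quotient on `S` and a quotient
off `S`, in opposite directions, then it agrees with `H`. -/
theorem frobSpan_eq_map_of_smul_mem (hS : D.Stable S)
    (hφ : Function.Injective (D.twistSum φ.toAddMonoidHom)) (hg : Function.Injective g)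
    (hI : ∀ p : Ideal A, p.IsPrime → I ≤ p → p ∉ S) (hJ : ∀ p : Ideal A, p.IsPrime → J ≤ p → p ∈ S)
    (hI0 : I ≠ ⊥) (hJ0 : J ≠ ⊥) (htop : D.frobSpan φ ⊤ = LinearMap.range g) {H : Submodule A F}
    (hIH : ∀ a ∈ I, ∀ w ∈ D.frobSpan φ H, a • w ∈ H.map g)
    (hJH : ∀ a ∈ J, ∀ w ∈ H.map g, a • w ∈ D.frobSpan φ H)
    [Module.Finite E (saturation H ⧸ H.submoduleOf (saturation H))] :
    D.frobSpan φ H = H.map g := by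
  have hB : D.frobSpan φ (saturation H) = (saturation H).map g := by
    refine le_antisymm (fun w hw => ?_) ?_
    · obtain ⟨m, rfl⟩ : w ∈ LinearMap.range g := htop ▸ D.frobSpan_mono φ le_top hw
      obtain ⟨c, hc, hcw⟩ := D.frobSpan_saturation_le H hw
      obtain ⟨a, haI, ha⟩ := Submodule.exists_mem_ne_zero_of_ne_bot hI0
      obtain ⟨x, hx, hxw⟩ := hIH a haI _ hcw
      refine ⟨m, ⟨a * c, mul_ne_zero ha hc, ?_⟩, rfl⟩
      rw [← map_smul, ← map_smul] at hxw
      rw [mul_smul, ← hg hxw]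
      exact hx
    · rintro _ ⟨m, ⟨c, hc, hm⟩, rfl⟩
      obtain ⟨a, haJ, ha⟩ := Submodule.exists_mem_ne_zero_of_ne_bot hJ0
      refine D.mem_frobSpan_saturation hφ (htop ▸ ⟨m, rfl⟩) ⟨a * c, mul_ne_zero ha hc, ?_⟩
      rw [mul_smul, ← map_smul]
      exact hJH a haJ _ ⟨_, hm, rfl⟩
  have h1 : H.map g ≤ (saturation H).map g := Submodule.map_mono (le_saturation H)
  have h2 : D.frobSpan φ H ≤ (saturation H).map g := hB ▸ D.frobSpan_mono φ (le_saturation H)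
  have f1 := finite_map_quotient (E := E) hg H (saturation H)
  have f2 := D.finite_frobSpan_quotient hφ H (saturation H)
  have d1 T := dimOn_map_quotient (E := E) T hg H (saturation H)
  have d2 T (hT : D.Stable T) := D.dimOn_frobSpan_quotient hT hφ H (saturation H)
  rw [hB] at f2 d2
  generalize (saturation H).map g = U at *
  have f3 := finite_quotient_inf (E := E) (U := U) (V := H.map g) (V' := D.frobSpan φ H)
  have e1 T := dimOn_quotient_add E (S := T) (V := H.map g ⊓ D.frobSpan φ H) inf_le_left h1
  have e2 T := dimOn_quotient_add E (S := T) (V := H.map g ⊓ D.frobSpan φ H) inf_le_right h2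
  have := finite_quotient_of_le_right (E := E) (V := H.map g ⊓ D.frobSpan φ H) h1
  have := finite_quotient_of_le_right (E := E) (V := H.map g ⊓ D.frobSpan φ H) h2
  refine (eq_of_dimOn_eq E (S := S) (I := I) (J := J) ?_ ?_ hI hJ hIH hJH).symm
  · have := e1 S; have := e2 S; have := d1 S; have := d2 S hS
    omega
  · have := e1 Sᶜ; have := e2 Sᶜ; have := d1 Sᶜ; have := d2 Sᶜ (hS.compl D)
    omega

end FrobData

/-! ### Sections of sheaves of modules -/

section Sections

variable {Z : Scheme.{u}} {M N P : Z.Modules} {U V W : Z.Opens}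

/-- Restriction of sections of a sheaf of modules. -/
noncomputable def res (M : Z.Modules) (h : V ≤ U) : Γ(M, U) →+ Γ(M, V) :=
  (M.presheaf.map (homOfLE h).op).hom

/-- Restriction of functions. -/
noncomputable def rres (h : V ≤ U) : Γ(Z, U) →+* Γ(Z, V) :=
  (Z.presheaf.map (homOfLE h).op).hom

@[simp] theorem res_res (h : V ≤ U) (h' : W ≤ V) (x : Γ(M, U)) :
    res M h' (res M h x) = res M (h'.trans h) x := map_map M h h' x

@[simp] theorem rres_rres (h : V ≤ U) (h' : W ≤ V) (x : Γ(Z, U)) :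
    rres h' (rres h x) = rres (h'.trans h) x := ringMap_map h h' x

@[simp] theorem res_rfl (x : Γ(M, U)) : res M le_rfl x = x :=
  ConcreteCategory.congr_hom (M.presheaf.map_id (op U)) x

@[simp] theorem rres_rfl (x : Γ(Z, U)) : rres le_rfl x = x :=
  ConcreteCategory.congr_hom (Z.presheaf.map_id (op U)) x

theorem res_smul (h : V ≤ U) (r : Γ(Z, U)) (x : Γ(M, U)) :
    res M h (r • x) = rres h r • res M h x := Scheme.Modules.map_smul _ _ _ _

theorem app_res (φ : M ⟶ N) (h : V ≤ U) (x : Γ(M, U)) :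
    φ.app V (res M h x) = res N h (φ.app U x) := app_map φ h x

theorem isUnit_rres_basicOpen {f : Γ(Z, U)} (h : V ≤ Z.basicOpen f) :
    IsUnit (rres (h.trans (Z.basicOpen_le f)) f) := by
  rw [← rres_rres (Z.basicOpen_le f) h]
  exact (RingedSpace.isUnit_res_basicOpen Z.toRingedSpace f).map _

/-- The map on sections over `U` as a linear map. -/
noncomputable def appLin (φ : M ⟶ N) (U : Z.Opens) : Γ(M, U) →ₗ[Γ(Z, U)] Γ(N, U) where
  toFun := φ.app U
  map_add' := map_add (φ.app U).hom
  map_smul' := Scheme.Modules.Hom.app_smul φ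

@[simp] theorem appLin_apply (φ : M ⟶ N) (x : Γ(M, U)) : appLin φ U x = φ.app U x := rfl

@[simp] theorem comp_app_apply (φ : M ⟶ N) (ψ : N ⟶ P) (x : Γ(M, U)) :
    (φ ≫ ψ).app U x = ψ.app U (φ.app U x) := rfl

theorem eq_zero_of_locally {x : Γ(M, U)}
    (h : ∀ z ∈ U, ∃ (V : Z.Opens) (hV : V ≤ U), z ∈ V ∧ res M hV x = 0) : x = 0 := by
  choose V hV hz hx using fun z : U => h z.1 z.2
  refine TopCat.Sheaf.eq_of_locally_eq' ⟨M.presheaf, M.isSheaf⟩ V U (fun z => homOfLE (hV z))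
    (fun z hz' => TopologicalSpace.Opens.mem_iSup.2 ⟨⟨z, hz'⟩, hz _⟩) x 0 fun z => ?_
  exact (hx z).trans (map_zero (res M (hV z))).symm

theorem exists_affine_le {z : Z} (hz : z ∈ U) : ∃ W ≤ U, IsAffineOpen W ∧ z ∈ W := by
  obtain ⟨W, hW, hzW, hWU⟩ := TopologicalSpace.Opens.isBasis_iff_nbhd.1 Z.isBasis_affineOpens hz
  exact ⟨W, hWU, hW, hzW⟩

theorem mono_of_app_injective (φ : M ⟶ N) (h : ∀ U, Function.Injective (φ.app U)) : Mono φ := by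
  refine Preadditive.mono_of_cancel_zero φ fun {P} g hg => ?_
  refine Scheme.Modules.hom_ext _ _ fun U => ?_
  ext x
  refine h U ?_
  have : (g ≫ φ).app U x = 0 := by rw [hg]; rfl
  exact this.trans (map_zero (φ.app U).hom).symm

/-- The two conditions that express that the sections over the basic open subsets of `W` are the
localizations of the sections over `W`. -/
structure Localizes (M : Z.Modules) (W : Z.Opens) : Prop where
  exists_res_eq (f : Γ(Z, W)) (s : Γ(M, Z.basicOpen f)) : ∃ (n : ℕ) (t : Γ(M, W)),
    res M (Z.basicOpen_le f) t = rres (Z.basicOpen_le f) f ^ n • s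
  exists_pow_smul_eq_zero (f : Γ(Z, W)) (t : Γ(M, W)) (ht : res M (Z.basicOpen_le f) t = 0) :
    ∃ n : ℕ, f ^ n • t = 0

theorem smul_eq_zero_iff_of_isUnit {r : Γ(Z, U)} (hr : IsUnit r) {x : Γ(M, U)} :
    r • x = 0 ↔ x = 0 := hr.smul_eq_zero

/-- A family of opens that covers `Z`. -/
def Covers (C : Set Z.Opens) : Prop := ∀ z : Z, ∃ W ∈ C, z ∈ W

theorem covers_affine : Covers {W : Z.Opens | IsAffineOpen W} := fun z =>
  let ⟨W, _, hW, hz⟩ := exists_affine_le (U := ⊤) (z := z) trivial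
  ⟨W, hW, hz⟩

variable {C : Set Z.Opens}

theorem Covers.exists_basicOpen_le (hC : Covers C) (hCa : ∀ W ∈ C, IsAffineOpen W) {z : Z}
    (hz : z ∈ U) : ∃ W ∈ C, ∃ f : Γ(Z, W), Z.basicOpen f ≤ U ∧ z ∈ Z.basicOpen f := by
  obtain ⟨W, hW, hzW⟩ := hC z
  obtain ⟨f, hf, hz'⟩ := (hCa W hW).exists_basicOpen_le ⟨z, hz⟩ hzW
  exact ⟨W, hW, f, hf, hz'⟩

/-- A morphism whose source is the localization of its sections over the members of an affine
cover is determined by its values there. -/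
theorem eq_zero_of_app_eq_zero (hC : Covers C) (hCa : ∀ W ∈ C, IsAffineOpen W)
    (hM : ∀ W ∈ C, Localizes M W) (φ : M ⟶ N) (h : ∀ W ∈ C, ∀ x, φ.app W x = 0) : φ = 0 := by
  refine Scheme.Modules.hom_ext _ _ fun U => ?_
  ext x
  refine eq_zero_of_locally fun z hz => ?_
  obtain ⟨W, hW, f, hf, hz'⟩ := hC.exists_basicOpen_le hCa hz
  refine ⟨_, hf, hz', ?_⟩
  obtain ⟨n, t, ht⟩ := (hM W hW).exists_res_eq f (res M hf x)
  rw [← smul_eq_zero_iff_of_isUnit ((isUnit_rres_basicOpen (f := f) le_rfl).pow n), ← app_res,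
    ← Scheme.Modules.Hom.app_smul, ← ht, app_res, h W hW, map_zero]

theorem app_injective_of_cover (hC : Covers C) (hCa : ∀ W ∈ C, IsAffineOpen W)
    (hM : ∀ W ∈ C, Localizes M W) (hN : ∀ W ∈ C, Localizes N W) (φ : M ⟶ N)
    (h : ∀ W ∈ C, Function.Injective (φ.app W)) (U : Z.Opens) : Function.Injective (φ.app U) := by
  refine (injective_iff_map_eq_zero (φ.app U).hom).2 fun x hx => ?_
  refine eq_zero_of_locally fun z hz => ?_
  obtain ⟨W, hW, f, hf, hz'⟩ := hC.exists_basicOpen_le hCa hz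
  refine ⟨_, hf, hz', ?_⟩
  obtain ⟨n, t, ht⟩ := (hM W hW).exists_res_eq f (res M hf x)
  have h1 : res N (Z.basicOpen_le f) (φ.app W t) = 0 := by
    have hx' : φ.app U x = 0 := hx
    rw [← app_res, ht, Scheme.Modules.Hom.app_smul, app_res, hx', map_zero, smul_zero]
  obtain ⟨m, hm⟩ := (hN W hW).exists_pow_smul_eq_zero f _ h1
  rw [← Scheme.Modules.Hom.app_smul] at hm
  have h2 : f ^ m • t = 0 := h W hW (hm.trans (map_zero (φ.app W).hom).symm)
  rw [← smul_eq_zero_iff_of_isUnit ((isUnit_rres_basicOpen (f := f) le_rfl).pow n), ← ht,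
    ← smul_eq_zero_iff_of_isUnit ((isUnit_rres_basicOpen (f := f) le_rfl).pow m), ← map_pow,
    ← res_smul, h2, map_zero]

theorem epi_of_app_surjective (hC : Covers C) (hCa : ∀ W ∈ C, IsAffineOpen W)
    (hN : ∀ W ∈ C, Localizes N W) (φ : M ⟶ N)
    (h : ∀ W ∈ C, Function.Surjective (φ.app W)) : Epi φ := by
  refine Preadditive.epi_of_cancel_zero φ fun {P} g hg => ?_
  refine eq_zero_of_app_eq_zero hC hCa hN g fun W hW x => ?_
  obtain ⟨y, rfl⟩ := h W hW x
  have : (φ ≫ g).app W y = 0 := by rw [hg]; rfl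
  exact this

/-- A morphism factors through a monomorphism if it does so on the sections over the members of an
affine cover. -/
theorem exists_factor_of_app (hC : Covers C) (hCa : ∀ W ∈ C, IsAffineOpen W)
    (hM : ∀ W ∈ C, Localizes M W) (φ : M ⟶ P) (i : N ⟶ P) [Mono i]
    (h : ∀ W ∈ C, ∀ x, ∃ y, i.app W y = φ.app W x) : ∃ ψ : M ⟶ N, ψ ≫ i = φ := by
  have h0 : φ ≫ cokernel.π i = 0 := by
    refine eq_zero_of_app_eq_zero hC hCa hM _ fun W hW x => ?_
    obtain ⟨y, hy⟩ := h W hW x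
    rw [comp_app_apply, ← hy, ← comp_app_apply, cokernel.condition]
    rfl
  exact ⟨Abelian.monoLift i φ h0, Abelian.monoLift_comp i φ h0⟩

end Sections

/-! ### Quasi-coherence and local freeness on affine covers -/

noncomputable section
variable {Z : Scheme.{u}} {W : Z.Opens} (hW : IsAffineOpen W)

/-- Sheaves on the spectrum of `Γ(Z, W)` as sheaves on the site of opens of `W`. -/
def specToOver : SheafOfModules.{u} (Spec Γ(Z, W)).ringCatSheaf ⥤
    SheafOfModules.{u} (Z.ringCatSheaf.over W) :=
  (Scheme.Modules.restrictFunctor hW.isoSpec.hom ⋙ (Scheme.Modules.overEquiv W).inverse :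
    (Spec Γ(Z, W)).Modules ⥤ _)

instance : (specToOver hW).IsLeftAdjoint :=
  inferInstanceAs ((Scheme.Modules.restrictFunctor hW.isoSpec.hom ⋙
    (Scheme.Modules.overEquiv W).inverse : (Spec Γ(Z, W)).Modules ⥤ _).IsLeftAdjoint)

instance : PreservesColimitsOfSize.{u, u} (specToOver hW) :=
  (Adjunction.ofIsLeftAdjoint (specToOver hW)).leftAdjoint_preservesColimits

/-- The structure sheaf of the spectrum corresponds to the structure sheaf of `W`. -/
def specToOverUnit : SheafOfModules.unit (Z.ringCatSheaf.over W) ≅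
    (specToOver hW).obj (SheafOfModules.unit _) :=
  (Scheme.Modules.overEquiv W).unitIso.app _ ≪≫
    (Scheme.Modules.overEquiv W).inverse.mapIso
      ((Scheme.Modules.restrictUnitIso hW.isoSpec.hom)).symm

/-- The restriction of `M` to the spectrum corresponds to the restriction of `M` to `W`. -/
def specToOverRestrict (M : Z.Modules) :
    (specToOver hW).obj (M.restrict hW.fromSpec) ≅ M.over W :=
  (Scheme.Modules.overEquiv W).inverse.mapIso
    (((Scheme.Modules.restrictFunctorComp hW.isoSpec.hom hW.fromSpec).symm ≪≫
      Scheme.Modules.restrictFunctorCongr (g := W.ι) (by simp) ≪≫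
      (Scheme.Modules.overFunctorEquiv W).symm).app M) ≪≫
    ((Scheme.Modules.overEquiv W).unitIso.app _).symm

/-- The presentation of a sheaf on the site of opens of `W` obtained from a presentation on the
spectrum. -/
def presentationOver (M : Z.Modules) (P : (M.restrict hW.fromSpec).Presentation) :
    (M.over W).Presentation :=
  SheafOfModules.Presentation.ofIsIso.{u, u, u} (specToOverRestrict hW M).hom
    (P.map (specToOver hW) (specToOverUnit hW))

/-- Quasi-coherence follows from presentations on the spectra of the members of an affine cover. -/
theorem isQuasicoherent_of_presentation {C : Set Z.Opens} (hC : Covers C)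
    (hCa : ∀ W ∈ C, IsAffineOpen W) (M : Z.Modules)
    (P : ∀ (W : Z.Opens) (hW : IsAffineOpen W), W ∈ C →
      Nonempty (M.restrict hW.fromSpec).Presentation) : IsQuasicoherent M :=
  let q : SheafOfModules.QuasicoherentData.{u} (R := Z.ringCatSheaf) M :=
    { I := C
      X := Subtype.val
      coversTop := by
        rw [Opens.coversTop_iff (T := Z)]
        refine eq_top_iff.2 fun z _ => ?_
        obtain ⟨W, hW, hz⟩ := hC z
        exact TopologicalSpace.Opens.mem_iSup.2 ⟨⟨W, hW⟩, hz⟩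
      presentation W := presentationOver (hCa _ W.2) M (P _ (hCa _ W.2) W.2).some }
  SheafOfModules.QuasicoherentData.isQuasicoherent (M := M) q

theorem presentation_of_isIso {R : CommRingCat.{u}} (M : (Spec R).Modules) [IsIso M.fromTildeΓ] :
    Nonempty M.Presentation :=
  have : IsIso (C := SheafOfModules (Spec R).ringCatSheaf) M.fromTildeΓ := ‹_›
  ⟨SheafOfModules.Presentation.ofIsIso.{u, u, u} M.fromTildeΓ
    (presentationTilde.{u} _ .univ (by simp) _ (Submodule.span_eq _))⟩

theorem nonempty_presentation_restrict (M : Z.Modules) (hM : IsQuasicoherent M) :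
    Nonempty (M.restrict hW.fromSpec).Presentation := by
  have : M.IsQuasicoherent := hM
  exact presentation_of_isIso _

/-- A generating family of the sheaf on the site of opens of `W` obtained from a trivialization on
the spectrum. -/
def generatorsOver (M : Z.Modules) {I : Type u}
    (e : SheafOfModules.free I ≅ M.restrict hW.fromSpec) :
    (M.over W).GeneratingSections :=
  (SheafOfModules.free.generatingSections I).ofEpi
    (SheafOfModules.mapFreeIso (specToOver hW) I (specToOverUnit hW) ≪≫
      (specToOver hW).mapIso e ≪≫ specToOverRestrict hW M).hom

theorem isIso_generatorsOver_π (M : Z.Modules) {I : Type u}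
    (e : SheafOfModules.free I ≅ M.restrict hW.fromSpec) : IsIso (generatorsOver hW M e).π := by
  rw [generatorsOver, SheafOfModules.GeneratingSections.ofEpi_π]
  have h : IsIso (SheafOfModules.free.generatingSections (R := Z.ringCatSheaf.over W) I).π :=
    (SheafOfModules.free.generatingSections_π (R := Z.ringCatSheaf.over W) I).symm ▸
      (inferInstance : IsIso (𝟙 (SheafOfModules.free (R := Z.ringCatSheaf.over W) I)))
  exact IsIso.comp_isIso' h (Iso.isIso_hom _)

/-- Local generators of a sheaf that is free on the members of an affine cover. -/
def localGenerators {C : Set Z.Opens} (hC : Covers C) (hCa : ∀ W ∈ C, IsAffineOpen W)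
    (M : Z.Modules) (I : C → Type u)
    (e : ∀ W : C, SheafOfModules.free (I W) ≅ M.restrict (hCa _ W.2).fromSpec) :
    SheafOfModules.LocalGeneratorsData.{u} (R := Z.ringCatSheaf) M where
  I := C
  X := Subtype.val
  coversTop := by
    rw [Opens.coversTop_iff (T := Z)]
    refine eq_top_iff.2 fun z _ => ?_
    obtain ⟨W, hW, hz⟩ := hC z
    exact TopologicalSpace.Opens.mem_iSup.2 ⟨⟨W, hW⟩, hz⟩
  generators W := generatorsOver (hCa _ W.2) M (e W)

theorem isLocallyFreeData_localGenerators {C : Set Z.Opens} (hC : Covers C)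
    (hCa : ∀ W ∈ C, IsAffineOpen W) (M : Z.Modules) (I : C → Type u)
    (e : ∀ W : C, SheafOfModules.free (I W) ≅ M.restrict (hCa _ W.2).fromSpec) :
    (localGenerators hC hCa M I e).IsLocallyFreeData where
  isIso W := isIso_generatorsOver_π (hCa _ W.2) M (e W)

/-- Local freeness follows from trivializations on the spectra of the members of an affine cover. -/
theorem isLocallyFree_of_iso {C : Set Z.Opens} (hC : Covers C)
    (hCa : ∀ W ∈ C, IsAffineOpen W) (M : Z.Modules)
    (h : ∀ (W : Z.Opens) (hW : IsAffineOpen W), W ∈ C → ∃ I : Type u,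
      Nonempty (SheafOfModules.free I ≅ M.restrict hW.fromSpec)) : IsLocallyFree M := by
  choose I e using fun W : C => h W (hCa _ W.2) W.2
  have h1 : ∃ q : SheafOfModules.LocalGeneratorsData.{u} (R := Z.ringCatSheaf) M,
      q.IsLocallyFreeData :=
    ⟨_, isLocallyFreeData_localGenerators hC hCa M I fun W => (e W).some⟩
  exact SheafOfModules.IsLocallyFree.mk (R := Z.ringCatSheaf) (M := M) h1

end

/-! ### Sections of quasi-coherent sheaves over affine opens -/

noncomputable section
variable {Z : Scheme.{u}} {W : Z.Opens} (hW : IsAffineOpen W)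

theorem fromSpec_image_top : hW.fromSpec ''ᵁ ⊤ = W := by
  simp

/-- Sections of the restriction to the spectrum. -/
def specSections (M : Z.Modules) {U : (Spec Γ(Z, W)).Opens} {V : Z.Opens}
    (h : hW.fromSpec ''ᵁ U = V) : Γ(M, V) ≃+ Γ(M.restrict hW.fromSpec, U) where
  toFun := res M h.le
  invFun := res M h.ge
  left_inv x := by subst h; simp
  right_inv x := by
    subst h
    exact (res_rfl (M := M) _).trans (res_rfl (M := M) x)
  map_add' := map_add _

theorem map_specSections (M : Z.Modules) {U U' : (Spec Γ(Z, W)).Opens} {V V' : Z.Opens}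
    (h : hW.fromSpec ''ᵁ U = V) (h' : hW.fromSpec ''ᵁ U' = V') (hU : U' ≤ U) (hV : V' ≤ V)
    (x : Γ(M, V)) : (M.restrict hW.fromSpec).presheaf.map (homOfLE hU).op (specSections hW M h x) =
      specSections hW M h' (res M hV x) := by
  subst h h'
  change res M hV (res M le_rfl x) = res M le_rfl (res M hV x)
  rw [res_rfl, res_rfl]

theorem specSections_smul (M : Z.Modules) {U : (Spec Γ(Z, W)).Opens} {V : Z.Opens}
    (h : hW.fromSpec ''ᵁ U = V) (hV : V ≤ W) (a : Γ(Z, W)) (x : Γ(M, V)) :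
    specSections hW M h (rres hV a • x) = a • specSections hW M h x := by
  subst h
  rw [Scheme.Modules.smul_Spec_def]
  change res M le_rfl (rres hV a • x) = (hW.fromSpec.appIso U).inv _ • res M le_rfl x
  rw [res_smul, rres_rfl]
  congr 1
  apply (ConcreteCategory.bijective_of_isIso (hW.fromSpec.appIso U).hom).1
  rw [Iso.inv_hom_id_apply]
  have h1 := ConcreteCategory.congr_hom (hW.fromSpec.naturality (homOfLE hV).op) a
  have h2 := ConcreteCategory.congr_hom hW.fromSpec_app_self a
  simp only [CommRingCat.comp_apply] at h1 h2
  rw [h2] at h1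
  rw [Scheme.Hom.appIso_hom, CommRingCat.comp_apply]
  refine (congrArg _ h1).trans ?_
  simp only [← CommRingCat.comp_apply]
  rfl

/-- The sections of a quasi-coherent sheaf over the basic opens of an affine open are localizations,
because the restriction to the spectrum is the sheaf associated with its global sections. -/
theorem localizes_of_isQuasicoherent (hW : IsAffineOpen W) (M : Z.Modules)
    (hM : IsQuasicoherent M) : Localizes M W := by
  have : M.IsQuasicoherent := hM
  have h := (isIso_fromTildeΓ_iff_isLocalizing (M.restrict hW.fromSpec)).1 inferInstance
  constructor
  · intro f s
    have e : hW.fromSpec ''ᵁ (PrimeSpectrum.basicOpen f) = Z.basicOpen f :=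
      hW.fromSpec_image_basicOpen f
    obtain ⟨⟨t, ⟨_, n, rfl⟩⟩, ht⟩ := (h f).surj (specSections hW M e s)
    obtain ⟨t, rfl⟩ := (specSections hW M (fromSpec_image_top hW)).surjective t
    refine ⟨n, t, (specSections hW M e).injective ?_⟩
    rw [← map_pow]
    refine Eq.trans ?_ (ht.symm.trans (specSections_smul hW M e (Z.basicOpen_le f) (f ^ n) s).symm)
    exact (map_specSections hW M (fromSpec_image_top hW) e le_top _ t).symm
  · intro f t ht
    have e : hW.fromSpec ''ᵁ (PrimeSpectrum.basicOpen f) = Z.basicOpen f :=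
      hW.fromSpec_image_basicOpen f
    have ht' := map_specSections hW M (fromSpec_image_top hW) e le_top (Z.basicOpen_le f) t
    rw [ht, map_zero] at ht'
    obtain ⟨⟨_, n, rfl⟩, hc⟩ := (h f).exists_of_eq
      (x₁ := specSections hW M (fromSpec_image_top hW) t)
      (x₂ := 0) (ht'.trans (map_zero _).symm)
    refine ⟨n, (specSections hW M (fromSpec_image_top hW)).injective ?_⟩
    have := specSections_smul hW M (fromSpec_image_top hW) le_rfl (f ^ n) t
    rw [rres_rfl] at this
    rw [this, map_zero]
    refine Eq.trans ?_ (hc.trans (smul_zero _))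
    rfl

theorem isIso_fromTildeΓ_of_localizes (M : Z.Modules) (hM : Localizes M W) :
    IsIso (M.restrict hW.fromSpec).fromTildeΓ := by
  rw [isIso_fromTildeΓ_iff_isLocalizing]
  intro f
  have e : hW.fromSpec ''ᵁ (PrimeSpectrum.basicOpen f) = Z.basicOpen f :=
    hW.fromSpec_image_basicOpen f
  refine IsLocalizedModule.Away.mk_of_addCommGroup ?_ ?_ ?_
  · exact Scheme.Modules.isUnit_algebraMap_end_of_le_basicOpen f le_rfl
  · intro s
    obtain ⟨s, rfl⟩ := (specSections hW M e).surjective s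
    obtain ⟨n, t, ht⟩ := hM.exists_res_eq f s
    refine ⟨n, specSections hW M (fromSpec_image_top hW) t, ?_⟩
    have h1 := map_specSections hW M (fromSpec_image_top hW) e le_top (Z.basicOpen_le f) t
    rw [ht, ← map_pow] at h1
    exact (h1.trans (specSections_smul hW M e (Z.basicOpen_le f) (f ^ n) s)).symm
  · intro t ht
    obtain ⟨t, rfl⟩ := (specSections hW M (fromSpec_image_top hW)).surjective t
    have h1 := map_specSections hW M (fromSpec_image_top hW) e le_top (Z.basicOpen_le f) t
    have h2 : res M (Z.basicOpen_le f) t = 0 := (specSections hW M e).injective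
      (h1.symm.trans (Eq.trans ht (map_zero (specSections hW M e)).symm))
    obtain ⟨n, hn⟩ := hM.exists_pow_smul_eq_zero f t h2
    refine ⟨n, ?_⟩
    have h3 := specSections_smul hW M (fromSpec_image_top hW) le_rfl (f ^ n) t
    rw [rres_rfl, hn, map_zero] at h3
    exact h3.symm

/-- A sheaf of modules is quasi-coherent if the sections over basic opens of the members of an
affine cover are localizations. -/
theorem isQuasicoherent_of_localizes {C : Set Z.Opens} (hC : Covers C)
    (hCa : ∀ W ∈ C, IsAffineOpen W) (M : Z.Modules) (hM : ∀ W ∈ C, Localizes M W) :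
    IsQuasicoherent M :=
  isQuasicoherent_of_presentation hC hCa M fun W hW hWC =>
    have := isIso_fromTildeΓ_of_localizes hW M (hM W hWC)
    presentation_of_isIso _

end

/-! ### Cokernels, epimorphisms, and sheaves supported on an affine open -/

noncomputable section
variable {Z : Scheme.{u}} {W : Z.Opens} (hW : IsAffineOpen W)

/-- The sections over an affine open as the global sections of the restriction to the spectrum. -/
def specTop (M : Z.Modules) :
    Γ(M, W) ≃ₗ[Γ(Z, W)] moduleSpecΓFunctor.obj (M.restrict hW.fromSpec) where
  __ := specSections hW M (fromSpec_image_top hW)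
  map_smul' r x := by
    have := specSections_smul hW M (fromSpec_image_top hW) le_rfl r x
    rw [rres_rfl] at this
    exact this

theorem map_specTop {M N : Z.Modules} (φ : M ⟶ N) (x : Γ(M, W)) :
    moduleSpecΓFunctor.map ((Scheme.Modules.restrictFunctor hW.fromSpec).map φ)
      (specTop hW M x) = specTop hW N (φ.app W x) :=
  app_res φ (fromSpec_image_top hW).le x

/-- A cokernel of sheaves that are associated with modules is associated with a module. -/
theorem isIso_fromTildeΓ_cokernel {R : CommRingCat.{u}} {M N : (Spec R).Modules} (φ : M ⟶ N)
    [IsIso M.fromTildeΓ] [IsIso N.fromTildeΓ] : IsIso (cokernel φ).fromTildeΓ := by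
  rw [isIso_fromTildeΓ_iff]
  obtain ⟨M', ⟨eM⟩⟩ := isIso_fromTildeΓ_iff.1 ‹IsIso M.fromTildeΓ›
  obtain ⟨N', ⟨eN⟩⟩ := isIso_fromTildeΓ_iff.1 ‹IsIso N.fromTildeΓ›
  let g := (tilde.functor R).preimage (eM.hom ≫ φ ≫ eN.inv)
  let e : cokernel ((tilde.functor R).map g) ≅ cokernel φ := cokernel.mapIso _ _ eM eN (by
    have hg : (tilde.functor R).map g = eM.hom ≫ φ ≫ eN.inv := (tilde.functor R).map_preimage _
    rw [hg]
    simp)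
  exact ⟨cokernel g, ⟨PreservesCokernel.iso (tilde.functor R) g ≪≫ e⟩⟩

theorem isQuasicoherent_cokernel {M N : Z.Modules} (hM : IsQuasicoherent M)
    (hN : IsQuasicoherent N) (φ : M ⟶ N) : IsQuasicoherent (cokernel φ) := by
  have : M.IsQuasicoherent := hM
  have : N.IsQuasicoherent := hN
  refine isQuasicoherent_of_presentation covers_affine (fun _ h => h) _ fun W hW _ => ?_
  have h1 := isIso_fromTildeΓ_cokernel
    ((Scheme.Modules.restrictFunctor hW.fromSpec).map φ)
  have h2 : IsIso ((cokernel φ).restrict hW.fromSpec).fromTildeΓ := by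
    rw [isIso_fromTildeΓ_iff] at h1 ⊢
    obtain ⟨K, ⟨e⟩⟩ := h1
    exact ⟨K, ⟨e ≪≫ (PreservesCokernel.iso (Scheme.Modules.restrictFunctor hW.fromSpec) φ).symm⟩⟩
  exact presentation_of_isIso _

theorem map_surjective_of_epi {R : CommRingCat.{u}} {M N : (Spec R).Modules} (q : M ⟶ N)
    [hM : IsIso M.fromTildeΓ] [hN : IsIso N.fromTildeΓ] [Epi q] :
    Function.Surjective (moduleSpecΓFunctor.map q) := by
  have h1 := (tilde.adjunction (R := R)).counit.naturality q
  have hM' : IsIso ((tilde.adjunction (R := R)).counit.app M) := hM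
  have hN' : IsIso ((tilde.adjunction (R := R)).counit.app N) := hN
  have h2 : Epi ((tilde.functor R).map (moduleSpecΓFunctor.map q)) := by
    have h3 : (tilde.functor R).map (moduleSpecΓFunctor.map q) =
      ((tilde.adjunction (R := R)).counit.app M ≫ q) ≫
        inv ((tilde.adjunction (R := R)).counit.app N) := (IsIso.eq_comp_inv _).2 h1
    rw [h3]
    exact epi_comp _ _
  rw [← ModuleCat.epi_iff_surjective]
  exact (tilde.functor _).epi_of_epi_map h2

/-- Affine opens have no first cohomology: an epimorphism of quasi-coherent sheaves is surjective on
sections. -/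
theorem app_surjective_of_epi (hW : IsAffineOpen W) {M N : Z.Modules} (hM : IsQuasicoherent M)
    (hN : IsQuasicoherent N) (φ : M ⟶ N) [Epi φ] : Function.Surjective (φ.app W) := by
  have : M.IsQuasicoherent := hM
  have : N.IsQuasicoherent := hN
  have h3 := map_surjective_of_epi ((Scheme.Modules.restrictFunctor hW.fromSpec).map φ)
  intro y
  obtain ⟨x, hx⟩ := h3 (specTop hW N y)
  obtain ⟨x, rfl⟩ := (specTop hW M).surjective x
  exact ⟨x, (specTop hW N).injective ((map_specTop hW φ x).symm.trans hx)⟩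

theorem localizes (M : Z.Modules) (hM : IsQuasicoherent M) :
    ∀ W ∈ {W : Z.Opens | IsAffineOpen W}, Localizes M W :=
  fun _ hW => localizes_of_isQuasicoherent hW M hM

/-- A morphism from a quasi-coherent sheaf to a sheaf supported on an affine open is determined
by its values there. -/
theorem eq_zero_of_supported (hW : IsAffineOpen W) {M L : Z.Modules} (hM : Localizes M W)
    (hL : ∀ U, Function.Injective (res L (inf_le_left : U ⊓ W ≤ U))) (φ : M ⟶ L)
    (h : ∀ x, φ.app W x = 0) : φ = 0 := by
  refine Scheme.Modules.hom_ext _ _ fun U => ?_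
  ext x
  refine hL U ?_
  refine Eq.trans ?_ (map_zero (res L _)).symm
  refine eq_zero_of_locally fun z hz => ?_
  obtain ⟨f, hf, hz'⟩ := hW.exists_basicOpen_le ⟨z, hz⟩ hz.2
  refine ⟨_, hf, hz', ?_⟩
  obtain ⟨n, t, ht⟩ := hM.exists_res_eq f (res M (hf.trans inf_le_left) x)
  rw [← smul_eq_zero_iff_of_isUnit ((isUnit_rres_basicOpen (f := f) le_rfl).pow n), res_res,
    ← app_res, ← Scheme.Modules.Hom.app_smul, ← ht, app_res, h, map_zero]

/-- A linear map between objects of the category of modules, as a morphism. -/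
abbrev linHom {R : Type u} [Ring R] {A B : ModuleCat.{u} R} (l : A →ₗ[R] B) : A ⟶ B :=
  ModuleCat.ofHom l

/-- A linear map on global sections over an affine scheme comes from a morphism if the source is
quasi-coherent. -/
theorem exists_map_eq {R : CommRingCat.{u}} {M N : (Spec R).Modules} [hM : IsIso M.fromTildeΓ]
    (l : moduleSpecΓFunctor.obj M →ₗ[R] moduleSpecΓFunctor.obj N) :
    ∃ h : M ⟶ N, ∀ x, moduleSpecΓFunctor.map h x = l x := by
  have hM' : IsIso ((tilde.adjunction (R := R)).counit.app M) := hM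
  let l' : moduleSpecΓFunctor.obj M ⟶ moduleSpecΓFunctor.obj N := linHom l
  refine ⟨inv ((tilde.adjunction (R := R)).counit.app M) ≫
    (tilde.adjunction.homEquiv _ _).symm l', fun x => ?_⟩
  suffices h : moduleSpecΓFunctor.map (inv ((tilde.adjunction (R := R)).counit.app M) ≫
      (tilde.adjunction.homEquiv _ _).symm l') = l' from
    (ConcreteCategory.congr_hom h x).trans rfl
  apply (tilde.adjunction.homEquiv _ _).symm.injective
  rw [Adjunction.homEquiv_counit, (tilde.adjunction (R := R)).counit_naturality]
  exact IsIso.hom_inv_id_assoc ((tilde.adjunction (R := R)).counit.app M) _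

/-- A linear map from the sections over an affine open `W` of a quasi-coherent sheaf to those of a
sheaf supported on `W` comes from a morphism. The target is the direct image of its restriction to
`W`. -/
theorem exists_hom_of_supported (hW : IsAffineOpen W) {M L : Z.Modules} (hM : IsQuasicoherent M)
    (hL : ∀ U, Function.Bijective (res L (inf_le_left : U ⊓ W ≤ U)))
    (l : Γ(M, W) →ₗ[Γ(Z, W)] Γ(L, W)) : ∃ φ : M ⟶ L, ∀ x, φ.app W x = l x := by
  have : M.IsQuasicoherent := hM
  let adj := Scheme.Modules.restrictAdjunction hW.fromSpec
  have hη : IsIso (adj.unit.app L) := by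
    rw [Scheme.Modules.Hom.isIso_iff_isIso_app]
    intro U
    rw [ConcreteCategory.isIso_iff_bijective]
    have e : hW.fromSpec ''ᵁ hW.fromSpec ⁻¹ᵁ U = U ⊓ W := by
      rw [Scheme.Hom.image_preimage_eq_opensRange_inf, hW.opensRange_fromSpec, inf_comm]
    have h1 := hL U
    change Function.Bijective (res L (hW.fromSpec.image_preimage_le U))
    generalize_proofs h2
    generalize hW.fromSpec ''ᵁ hW.fromSpec ⁻¹ᵁ U = T at *
    subst e
    exact h1
  obtain ⟨h0, h0'⟩ := exists_map_eq
    ((specTop hW L).toLinearMap ∘ₗ l ∘ₗ (specTop hW M).symm.toLinearMap)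
  let φ : M ⟶ L := adj.homEquiv _ _ h0 ≫ inv (adj.unit.app L)
  have hφ : (Scheme.Modules.restrictFunctor hW.fromSpec).map φ = h0 := by
    apply (adj.homEquiv _ _).injective
    rw [Adjunction.homEquiv_unit, adj.unit_naturality]
    simp [φ]
  refine ⟨φ, fun x => (specTop hW L).injective ?_⟩
  rw [← map_specTop, hφ, h0']
  simp

end

/-! ### Local freeness on sections -/

noncomputable section
variable {Z : Scheme.{u}} {W : Z.Opens} (hW : IsAffineOpen W)

/-- The global sections of `M^~`. -/
def tildeTop {R : CommRingCat.{u}} (M : ModuleCat.{u} R) :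
    M ≃ₗ[R] moduleSpecΓFunctor.obj (tilde M) :=
  (asIso ((tilde.adjunction (R := R)).unit.app M)).toLinearEquiv

/-- A module over `Γ(Z, W)` is the module of sections over `W` of a sheaf supported on `W`. -/
theorem exists_supported (hW : IsAffineOpen W) (Q : ModuleCat.{u} Γ(Z, W)) : ∃ L : Z.Modules,
    (∀ U, Function.Bijective (res L (inf_le_left : U ⊓ W ≤ U))) ∧
      Nonempty (Q ≃ₗ[Γ(Z, W)] Γ(L, W)) := by
  let L : Z.Modules := (Scheme.Modules.pushforward hW.fromSpec).obj (tilde Q)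
  refine ⟨L, fun U => ?_, ?_⟩
  · have e : hW.fromSpec ⁻¹ᵁ (U ⊓ W) = hW.fromSpec ⁻¹ᵁ U := by
      refine le_antisymm (hW.fromSpec.preimage_mono inf_le_left) fun z hz => ⟨hz, ?_⟩
      have : z ∈ hW.fromSpec ⁻¹ᵁ W := by rw [hW.fromSpec_preimage_self]; trivial
      exact this
    change Function.Bijective (res (tilde Q) (hW.fromSpec.preimage_mono inf_le_left))
    generalize_proofs h
    generalize hW.fromSpec ⁻¹ᵁ (U ⊓ W) = T at *
    subst e
    convert Function.bijective_id
    ext x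
    simp
  · have e : hW.fromSpec ⁻¹ᵁ W = ⊤ := hW.fromSpec_preimage_self
    refine ⟨(tildeTop Q).trans
      { toFun x := res (tilde Q) (le_top : hW.fromSpec ⁻¹ᵁ W ≤ ⊤) x
        invFun x := res (tilde Q) e.ge x
        left_inv x := (res_res (M := tilde Q) _ _ x).trans (res_rfl (M := tilde Q) x)
        right_inv x := (res_res (M := tilde Q) _ _ x).trans (res_rfl (M := tilde Q) x)
        map_add' := map_add (res (tilde Q) (le_top : hW.fromSpec ⁻¹ᵁ W ≤ ⊤))
        map_smul' := ?_ }⟩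
    intro r x
    refine (res_smul (M := tilde Q) (le_top : hW.fromSpec ⁻¹ᵁ W ≤ ⊤) _ x).trans ?_
    change _ = (hW.fromSpec.app W r •
      res (tilde Q) (le_top : hW.fromSpec ⁻¹ᵁ W ≤ ⊤) x : Γ(tilde Q, hW.fromSpec ⁻¹ᵁ W))
    rw [hW.fromSpec_app_self]
    rfl

/-- The trivialization on an affine open of a sheaf that is free on a larger open. -/
theorem nonempty_iso_of_over (M : Z.Modules) {U : Z.Opens} (h : W ≤ U) {I : Type u}
    (e : SheafOfModules.free I ≅ M.over U) :
    Nonempty (SheafOfModules.free I ≅ M.restrict hW.fromSpec) := by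
  let v : Spec Γ(Z, W) ⟶ U := hW.isoSpec.inv ≫ Z.homOfLE h
  let F : SheafOfModules.{u} (Z.ringCatSheaf.over U) ⥤
    SheafOfModules.{u} (Spec Γ(Z, W)).ringCatSheaf :=
    ((Scheme.Modules.overEquiv U).functor ⋙ Scheme.Modules.restrictFunctor v :
      _ ⥤ (Spec Γ(Z, W)).Modules)
  have : F.IsLeftAdjoint := inferInstanceAs (((Scheme.Modules.overEquiv U).functor ⋙
    Scheme.Modules.restrictFunctor v : _ ⥤ (Spec Γ(Z, W)).Modules).IsLeftAdjoint)
  have : PreservesColimitsOfSize.{u, u} F :=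
    (Adjunction.ofIsLeftAdjoint F).leftAdjoint_preservesColimits
  let e' : F.obj (M.over U) ≅ M.restrict hW.fromSpec :=
    (Functor.isoWhiskerRight (Scheme.Modules.overFunctorEquiv U) (Scheme.Modules.restrictFunctor v)
      ≪≫ (Scheme.Modules.restrictFunctorComp v U.ι).symm ≪≫
      Scheme.Modules.restrictFunctorCongr (g := hW.fromSpec) (by simp [v])).app M
  exact ⟨SheafOfModules.mapFreeIso F I (Scheme.Modules.restrictUnitIso v).symm ≪≫
    F.mapIso e ≪≫ e'⟩

theorem nonempty_linearEquiv_of_over (hW : IsAffineOpen W) (M : Z.Modules) {U : Z.Opens}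
    (h : W ≤ U) {I : Type u} (e : SheafOfModules.free I ≅ M.over U) :
    Nonempty ((I →₀ Γ(Z, W)) ≃ₗ[Γ(Z, W)] Γ(M, W)) := by
  obtain ⟨e'⟩ := nonempty_iso_of_over hW M h e
  let e'' : tilde (ModuleCat.of Γ(Z, W) (I →₀ Γ(Z, W))) ≅ M.restrict hW.fromSpec :=
    tildeFinsupp I ≪≫ e'
  exact ⟨(tildeTop (ModuleCat.of Γ(Z, W) (I →₀ Γ(Z, W)))).trans
    ((moduleSpecΓFunctor.mapIso e'').toLinearEquiv.trans (specTop hW M).symm)⟩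

theorem nonempty_free_iso (M : Z.Modules) (hM : IsQuasicoherent M) {I : Type u}
    (e : (I →₀ Γ(Z, W)) ≃ₗ[Γ(Z, W)] Γ(M, W)) :
    Nonempty (SheafOfModules.free I ≅ M.restrict hW.fromSpec) := by
  have : M.IsQuasicoherent := hM
  let e1 : ModuleCat.of Γ(Z, W) (I →₀ Γ(Z, W)) ≅ moduleSpecΓFunctor.obj (M.restrict hW.fromSpec) :=
    (e.trans (specTop hW M)).toModuleIso
  have h1 : IsIso (M.restrict hW.fromSpec).fromTildeΓ :=
    Scheme.Modules.isIso_fromTildeΓ_of_isQuasicoherent _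
  let e2 := asIso (M.restrict hW.fromSpec).fromTildeΓ
  exact ⟨(tildeFinsupp I).symm ≪≫ (tilde.functor _).mapIso e1 ≪≫ e2⟩

theorem isLocallyFree_of_linearEquiv (M : Z.Modules) (hM : IsQuasicoherent M)
    (h : ∀ z : Z, ∃ W : Z.Opens, IsAffineOpen W ∧ z ∈ W ∧ ∃ I : Type u,
      Nonempty ((I →₀ Γ(Z, W)) ≃ₗ[Γ(Z, W)] Γ(M, W))) : IsLocallyFree M := by
  refine isLocallyFree_of_iso (C := {W | IsAffineOpen W ∧ ∃ I : Type u,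
      Nonempty ((I →₀ Γ(Z, W)) ≃ₗ[Γ(Z, W)] Γ(M, W))}) ?_ (fun W hW => hW.1) M ?_
  · intro z
    obtain ⟨W, hW, hz, hI⟩ := h z
    exact ⟨W, ⟨hW, hI⟩, hz⟩
  · rintro W hW ⟨-, I, ⟨e⟩⟩
    exact ⟨I, nonempty_free_iso hW M hM e⟩

/-- A locally free sheaf is free on all affine opens in a neighbourhood of a point. -/
theorem exists_linearEquiv_of_isLocallyFree (M : Z.Modules) (hM : IsLocallyFree M) (z : Z) :
    ∃ U : Z.Opens, z ∈ U ∧ ∀ W, IsAffineOpen W → W ≤ U → ∃ I : Type u,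
      Nonempty ((I →₀ Γ(Z, W)) ≃ₗ[Γ(Z, W)] Γ(M, W)) := by
  obtain ⟨q, hq⟩ := hM.exists_isLocallyFreeData
  have hc := q.coversTop
  rw [Opens.coversTop_iff (T := Z)] at hc
  obtain ⟨i, hi⟩ := TopologicalSpace.Opens.mem_iSup.1 (hc.ge (show z ∈ ⊤ from trivial))
  have := hq.isIso i
  refine ⟨q.X i, hi, fun W hW h => ⟨_, nonempty_linearEquiv_of_over hW M h
    (asIso (q.generators i).π)⟩⟩

theorem exists_linearEquiv_of_isLocallyFreeOfRank (M : Z.Modules) {d : ℕ}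
    (hM : IsLocallyFreeOfRank M d) (z : Z) :
    ∃ U : Z.Opens, z ∈ U ∧ ∀ W, IsAffineOpen W → W ≤ U →
      Nonempty ((Fin d →₀ Γ(Z, W)) ≃ₗ[Γ(Z, W)] Γ(M, W)) := by
  obtain ⟨q, hq, hd⟩ := hM
  have hc := q.coversTop
  rw [Opens.coversTop_iff (T := Z)] at hc
  obtain ⟨i, hi⟩ := TopologicalSpace.Opens.mem_iSup.1 (hc.ge (show z ∈ ⊤ from trivial))
  have := hq.isIso i
  refine ⟨q.X i, hi, fun W hW h => ?_⟩
  obtain ⟨e⟩ := nonempty_linearEquiv_of_over hW M h (asIso (q.generators i).π)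
  exact ⟨(Finsupp.domLCongr (hd i).some.symm).trans e⟩

theorem isLocallyFree_of_rank (M : Z.Modules) {d : ℕ} (hM : IsLocallyFreeOfRank M d) :
    IsLocallyFree M := by
  obtain ⟨q, hq, -⟩ := hM
  exact SheafOfModules.IsLocallyFree.mk (R := Z.ringCatSheaf) (M := M) ⟨q, hq⟩

theorem isQuasicoherent_of_isLocallyFree (M : Z.Modules) (hM : IsLocallyFree M) :
    IsQuasicoherent M := by
  obtain ⟨q, hq⟩ := hM.exists_isLocallyFreeData
  exact SheafOfModules.QuasicoherentData.isQuasicoherent (M := M) q.quasiCoherentData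

end

/-! ### Pullbacks on sections -/

noncomputable section
variable {X Y : Scheme.{u}} (f : X ⟶ Y) {V : Y.Opens}

/-- The pullback of the structure sheaf is the structure sheaf. -/
def pullbackUnitIso : (Scheme.Modules.pullback f).obj (SheafOfModules.unit Y.ringCatSheaf) ≅
    SheafOfModules.unit X.ringCatSheaf :=
  have : (SheafOfModules.pushforward.{u} f.toRingCatSheafHom).IsRightAdjoint :=
    inferInstanceAs (Scheme.Modules.pushforward f).IsRightAdjoint
  have : (TopologicalSpace.Opens.map f.base).Final :=
    Functor.final_of_exists_of_isFiltered _ (fun _ => ⟨⊤, ⟨homOfLE le_top⟩⟩)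
      fun {_ V} _ _ => ⟨V, 𝟙 V, Subsingleton.elim _ _⟩
  @asIso _ _ _ _ (SheafOfModules.pullbackObjUnitToUnit f.toRingCatSheafHom)
    (SheafOfModules.instIsIsoPullbackObjUnitToUnitOfFinal f.toRingCatSheafHom)

/-- The restriction of a pullback to an affine open, as a pullback between spectra. -/
def restrictPullbackIso (hV : IsAffineOpen V) (hU : IsAffineOpen (f ⁻¹ᵁ V)) :
    Scheme.Modules.pullback f ⋙ Scheme.Modules.restrictFunctor hU.fromSpec ≅
      Scheme.Modules.restrictFunctor hV.fromSpec ⋙ Scheme.Modules.pullback (Spec.map (f.app V)) :=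
  Functor.isoWhiskerLeft _ (Scheme.Modules.restrictFunctorIsoPullback hU.fromSpec) ≪≫
    Scheme.Modules.pullbackComp hU.fromSpec f ≪≫
    Scheme.Modules.pullbackCongr (by
      have := IsAffineOpen.SpecMap_appLE_fromSpec f hV hU le_rfl
      rw [← this, Scheme.Hom.appLE_eq_app]) ≪≫
    (Scheme.Modules.pullbackComp (Spec.map (f.app V)) hV.fromSpec).symm ≪≫
    Functor.isoWhiskerRight (Scheme.Modules.restrictFunctorIsoPullback hV.fromSpec).symm _

/-- The pullback of a presentation. -/
def presentationPullback {M : Y.Modules} (P : M.Presentation) :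
    ((Scheme.Modules.pullback f).obj M).Presentation :=
  let F : SheafOfModules.{u} Y.ringCatSheaf ⥤ SheafOfModules.{u} X.ringCatSheaf :=
    Scheme.Modules.pullback f
  have : F.IsLeftAdjoint := inferInstanceAs (Scheme.Modules.pullback f).IsLeftAdjoint
  have : PreservesColimitsOfSize.{u, u} F :=
    (Adjunction.ofIsLeftAdjoint F).leftAdjoint_preservesColimits
  P.map F (pullbackUnitIso f).symm

theorem isQuasicoherent_pullback {C : Set Y.Opens} (hC : Covers C)
    (hCa : ∀ V ∈ C, IsAffineOpen V) (hCf : ∀ V ∈ C, IsAffineOpen (f ⁻¹ᵁ V)) {M : Y.Modules}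
    (hM : IsQuasicoherent M) : IsQuasicoherent ((Scheme.Modules.pullback f).obj M) := by
  refine isQuasicoherent_of_presentation (C := (f ⁻¹ᵁ ·) '' C) ?_ ?_ _ ?_
  · intro x
    obtain ⟨V, hV, hx⟩ := hC (f x)
    exact ⟨_, ⟨V, hV, rfl⟩, hx⟩
  · rintro _ ⟨V, hV, rfl⟩
    exact hCf V hV
  · rintro _ hU ⟨V, hV, rfl⟩
    obtain ⟨P⟩ := nonempty_presentation_restrict (hCa V hV) M hM
    let e := (restrictPullbackIso f (hCa V hV) hU).symm.app M
    have : IsIso (C := SheafOfModules _) e.hom := e.isIso_hom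
    exact ⟨SheafOfModules.Presentation.ofIsIso.{u, u, u} e.hom
      (presentationPullback (Spec.map (f.app V)) P)⟩

/-- The canonical map from sections of `M` to sections of the pullback of `M`. -/
def pullbackSections (M : Y.Modules) (V : Y.Opens) :
    Γ(M, V) →ₛₗ[(f.app V).hom] Γ((Scheme.Modules.pullback f).obj M, f ⁻¹ᵁ V) where
  toFun := ((Scheme.Modules.pullbackPushforwardAdjunction f).unit.app M).app V
  map_add' := map_add (((Scheme.Modules.pullbackPushforwardAdjunction f).unit.app M).app V).hom
  map_smul' :=
    Scheme.Modules.Hom.app_smul ((Scheme.Modules.pullbackPushforwardAdjunction f).unit.app M)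

theorem pullback_map_app_pullbackSections {M N : Y.Modules} (φ : M ⟶ N) (x : Γ(M, V)) :
    ((Scheme.Modules.pullback f).map φ).app (f ⁻¹ᵁ V) (pullbackSections f M V x) =
      pullbackSections f N V (φ.app V x) := by
  have := (Scheme.Modules.pullbackPushforwardAdjunction f).unit.naturality φ
  have := ConcreteCategory.congr_hom (congrArg (fun h => Scheme.Modules.Hom.app h V) this) x
  exact this.symm

section
variable {f} {M : Y.Modules} {L : X.Modules} (hV : IsAffineOpen V)
  (hL : ∀ U, Function.Bijective (res L (inf_le_left : U ⊓ f ⁻¹ᵁ V ≤ U)))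

/-- Maps from a pullback are determined on the sections that come from `M`. -/
theorem eq_zero_of_pullbackSections (hV : IsAffineOpen V) (hM : IsQuasicoherent M)
    (hL : ∀ U, Function.Bijective (res L (inf_le_left : U ⊓ f ⁻¹ᵁ V ≤ U)))
    (φ : (Scheme.Modules.pullback f).obj M ⟶ L)
    (h : ∀ x, φ.app (f ⁻¹ᵁ V) (pullbackSections f M V x) = 0) : φ = 0 := by
  apply ((Scheme.Modules.pullbackPushforwardAdjunction f).homEquiv _ _).injective
  have h1 : (Scheme.Modules.pullbackPushforwardAdjunction f).homEquiv M L φ = 0 := by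
    refine eq_zero_of_supported hV (localizes_of_isQuasicoherent hV M hM) (fun U => ?_) _
      fun x => ?_
    · exact (hL (f ⁻¹ᵁ U)).1
    · rw [Adjunction.homEquiv_unit]
      exact h x
  rw [h1]
  symm
  rw [Adjunction.homEquiv_unit, Functor.map_zero, comp_zero]

/-- A semilinear map from the sections of `M` to those of a sheaf `L` supported on an affine open
comes from a morphism from the pullback of `M` to `L`. -/
theorem exists_hom_of_pullbackSections (hV : IsAffineOpen V) (hM : IsQuasicoherent M)
    (hL : ∀ U, Function.Bijective (res L (inf_le_left : U ⊓ f ⁻¹ᵁ V ≤ U)))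
    (l : Γ(M, V) →ₛₗ[(f.app V).hom] Γ(L, f ⁻¹ᵁ V)) :
    ∃ φ : (Scheme.Modules.pullback f).obj M ⟶ L,
      ∀ x, φ.app (f ⁻¹ᵁ V) (pullbackSections f M V x) = l x := by
  let l' : Γ(M, V) →ₗ[Γ(Y, V)] Γ((Scheme.Modules.pushforward f).obj L, V) :=
    { toFun := l, map_add' := map_add l, map_smul' := map_smulₛₗ l }
  obtain ⟨ψ, hψ⟩ := exists_hom_of_supported (L := (Scheme.Modules.pushforward f).obj L) hV hM
    (fun U => hL (f ⁻¹ᵁ U)) l'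
  refine ⟨((Scheme.Modules.pullbackPushforwardAdjunction f).homEquiv _ _).symm ψ, fun x => ?_⟩
  refine Eq.trans ?_ (hψ x)
  have h1 := ((Scheme.Modules.pullbackPushforwardAdjunction f).homEquiv _ _).apply_symm_apply ψ
  rw [Adjunction.homEquiv_unit] at h1
  exact ConcreteCategory.congr_hom (congrArg (fun h => Scheme.Modules.Hom.app h V) h1) x

/-- The sections of a pullback are spanned by the sections that come from `M`: the quotient by
their span is the module of sections of a sheaf `L`, and the morphism from the pullback to `L`
vanishes. -/
theorem span_pullbackSections (hV : IsAffineOpen V) (hU : IsAffineOpen (f ⁻¹ᵁ V))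
    (hM : IsQuasicoherent M) (hM' : IsQuasicoherent ((Scheme.Modules.pullback f).obj M)) :
    Submodule.span Γ(X, f ⁻¹ᵁ V) (Set.range (pullbackSections f M V)) = ⊤ := by
  let N := Submodule.span Γ(X, f ⁻¹ᵁ V) (Set.range (pullbackSections f M V))
  obtain ⟨L, hL, ⟨e⟩⟩ := exists_supported hU
    (ModuleCat.of Γ(X, f ⁻¹ᵁ V) (Γ((Scheme.Modules.pullback f).obj M, f ⁻¹ᵁ V) ⧸ N))
  obtain ⟨φ, hφ⟩ := exists_hom_of_supported hU hM' hL (e.toLinearMap ∘ₗ N.mkQ)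
  have h0 : φ = 0 := eq_zero_of_pullbackSections hV hM hL φ fun x => by
    rw [hφ]
    have : N.mkQ (pullbackSections f M V x) = 0 :=
      (Submodule.Quotient.mk_eq_zero N).2 (Submodule.subset_span ⟨x, rfl⟩)
    rw [LinearMap.comp_apply, this, map_zero]
  refine eq_top_iff.2 fun y _ => ?_
  refine (Submodule.Quotient.mk_eq_zero N).1 (e.injective ?_)
  rw [map_zero]
  refine (hφ y).symm.trans ?_
  rw [h0]
  rfl

/-- The sections of a pullback map to the base change. -/
theorem exists_map_of_pullbackSections (hV : IsAffineOpen V) (hU : IsAffineOpen (f ⁻¹ᵁ V))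
    (hM : IsQuasicoherent M) (Q : Type u) [AddCommGroup Q] [Module Γ(X, f ⁻¹ᵁ V) Q]
    (l : Γ(M, V) →ₛₗ[(f.app V).hom] Q) :
    ∃ t : Γ((Scheme.Modules.pullback f).obj M, f ⁻¹ᵁ V) →ₗ[Γ(X, f ⁻¹ᵁ V)] Q,
      ∀ x, t (pullbackSections f M V x) = l x := by
  obtain ⟨L, hL, ⟨e⟩⟩ := exists_supported hU (ModuleCat.of Γ(X, f ⁻¹ᵁ V) Q)
  obtain ⟨φ, hφ⟩ := exists_hom_of_pullbackSections hV hM hL (e.toLinearMap.comp l)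
  refine ⟨e.symm.toLinearMap ∘ₗ appLin φ (f ⁻¹ᵁ V), fun x => ?_⟩
  have := hφ x
  simp only [LinearMap.comp_apply, appLin_apply, LinearEquiv.coe_coe] at this ⊢
  rw [this, e.symm_apply_apply]

end

end
noncomputable section
variable {Z : Scheme.{u}} {M : Z.Modules} {U V W : Z.Opens} {C : Set Z.Opens}

theorem Localizes.of_iso {M N : Z.Modules} (e : M ≅ N) (h : Localizes M W) : Localizes N W where
  exists_res_eq f s := by
    obtain ⟨n, t, ht⟩ := h.exists_res_eq f (e.inv.app _ s)
    refine ⟨n, e.hom.app W t, ?_⟩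
    rw [← app_res, ht, Scheme.Modules.Hom.app_smul, ← comp_app_apply, e.inv_hom_id]
    rfl
  exists_pow_smul_eq_zero f t ht := by
    obtain ⟨n, hn⟩ := h.exists_pow_smul_eq_zero f (e.inv.app W t) (by rw [← app_res, ht, map_zero])
    refine ⟨n, ?_⟩
    have := congrArg (e.hom.app W) hn
    rwa [Scheme.Modules.Hom.app_smul, ← comp_app_apply, e.inv_hom_id, map_zero] at this

theorem isQuasicoherent_of_iso {M N : Z.Modules} (e : M ≅ N) (h : IsQuasicoherent M) :
    IsQuasicoherent N :=
  isQuasicoherent_of_localizes covers_affine (fun _ h => h) _ fun W hW =>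
    (localizes M h W hW).of_iso e

/-! ### Quasi-coherent subsheaves and their sections over affine opens -/

/-- The sections of a subsheaf, as a submodule of the sections of the ambient sheaf. -/
def sections (G : Subobject M) (U : Z.Opens) : Submodule Γ(Z, U) Γ(M, U) :=
  LinearMap.range (appLin G.arrow U)

theorem mem_sections {G : Subobject M} {x : Γ(M, U)} :
    x ∈ sections G U ↔ ∃ y : Γ((G : Z.Modules), U), G.arrow.app U y = x := Iff.rfl

theorem res_mem_sections {G : Subobject M} (h : V ≤ U) {x : Γ(M, U)} (hx : x ∈ sections G U) :
    res M h x ∈ sections G V := by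
  obtain ⟨y, rfl⟩ := hx
  exact ⟨res _ h y, app_res G.arrow h y⟩

theorem sections_mono {G G' : Subobject M} (h : G ≤ G') (U : Z.Opens) :
    sections G U ≤ sections G' U := by
  rintro _ ⟨y, rfl⟩
  refine ⟨(Subobject.ofLE G G' h).app U y, ?_⟩
  change (Subobject.ofLE G G' h ≫ G'.arrow).app U y = G.arrow.app U y
  rw [Subobject.ofLE_arrow]

theorem sections_top (U : Z.Opens) : sections (⊤ : Subobject M) U = ⊤ := by
  rw [eq_top_iff]
  rintro x -
  obtain ⟨s, hs⟩ : ∃ s : M ⟶ ((⊤ : Subobject M) : Z.Modules), s ≫ (⊤ : Subobject M).arrow = 𝟙 M :=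
    ⟨inv (⊤ : Subobject M).arrow, IsIso.inv_hom_id _⟩
  exact ⟨s.app U x, congrArg (fun φ => Scheme.Modules.Hom.app φ U x) hs⟩

theorem le_of_sections_le (hC : Covers C) (hCa : ∀ W ∈ C, IsAffineOpen W) {G G' : Subobject M}
    (hG : IsQuasicoherent (G : Z.Modules)) (h : ∀ W ∈ C, sections G W ≤ sections G' W) :
    G ≤ G' := by
  obtain ⟨ψ, hψ⟩ := exists_factor_of_app hC hCa (fun W hW => localizes _ hG W (hCa W hW))
    G.arrow G'.arrow fun W hW x => h W hW ⟨x, rfl⟩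
  exact Subobject.le_of_comm ψ hψ

theorem exists_pow_smul_mem_sections (hM : IsQuasicoherent M) {G : Subobject M}
    (hG : IsQuasicoherent (G : Z.Modules)) (hW : IsAffineOpen W) (f : Γ(Z, W)) (x : Γ(M, W))
    (hx : res M (Z.basicOpen_le f) x ∈ sections G (Z.basicOpen f)) :
    ∃ n : ℕ, f ^ n • x ∈ sections G W := by
  obtain ⟨y, hy⟩ := mem_sections.1 hx
  obtain ⟨n, t, ht⟩ := (localizes _ hG W hW).exists_res_eq f y
  obtain ⟨m, hm⟩ := (localizes M hM W hW).exists_pow_smul_eq_zero f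
    (G.arrow.app W t - f ^ n • x) (by
      rw [map_sub, ← app_res, ht, res_smul, map_pow, Scheme.Modules.Hom.app_smul, hy, sub_self])
  refine ⟨m + n, f ^ m • t, ?_⟩
  rw [smul_sub, sub_eq_zero] at hm
  rw [pow_add, mul_smul, ← hm, map_smul, appLin_apply]

/-- A quasi-coherent subsheaf, given by its sections over affine opens. The values `obj W` for `W`
not affine play no role. -/
structure AffineSubmodules (M : Z.Modules) where
  obj (W : Z.Opens) : Submodule Γ(Z, W) Γ(M, W)
  res_mem {V W : Z.Opens} (hV : IsAffineOpen V) (hW : IsAffineOpen W) (h : V ≤ W) {x : Γ(M, W)}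
    (hx : x ∈ obj W) : res M h x ∈ obj V
  exists_pow_smul_mem {W : Z.Opens} (hW : IsAffineOpen W) (f : Γ(Z, W)) (x : Γ(M, W))
    (hx : res M (Z.basicOpen_le f) x ∈ obj (Z.basicOpen f)) : ∃ n : ℕ, f ^ n • x ∈ obj W

namespace AffineSubmodules
variable (N : AffineSubmodules M)

/-- The sections over an arbitrary open: those that lie in `N` locally. -/
def localSections (U : Z.Opens) : Submodule Γ(Z, U) Γ(M, U) where
  carrier := {x | ∀ z ∈ U, ∃ (V : Z.Opens) (hV : V ≤ U), z ∈ V ∧ IsAffineOpen V ∧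
    res M hV x ∈ N.obj V}
  zero_mem' z hz := by
    obtain ⟨V, hVU, hV, hzV⟩ := exists_affine_le hz
    exact ⟨V, hVU, hzV, hV, by rw [map_zero]; exact zero_mem _⟩
  add_mem' {x y} hx hy z hz := by
    obtain ⟨V, hVU, hzV, hV, hxV⟩ := hx z hz
    obtain ⟨V', hVU', hzV', hV', hyV'⟩ := hy z hz
    obtain ⟨W, hWV, hW, hzW⟩ := exists_affine_le (U := V ⊓ V') ⟨hzV, hzV'⟩
    refine ⟨W, (hWV.trans inf_le_left).trans hVU, hzW, hW, ?_⟩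
    rw [map_add]
    have h1 := N.res_mem hW hV (hWV.trans inf_le_left) hxV
    have h2 := N.res_mem hW hV' (hWV.trans inf_le_right) hyV'
    rw [res_res] at h1 h2
    exact add_mem h1 h2
  smul_mem' r x hx z hz := by
    obtain ⟨V, hVU, hzV, hV, hxV⟩ := hx z hz
    refine ⟨V, hVU, hzV, hV, ?_⟩
    rw [res_smul]
    exact Submodule.smul_mem _ _ hxV

theorem res_mem_localSections (h : V ≤ U) {x : Γ(M, U)} (hx : x ∈ N.localSections U) :
    res M h x ∈ N.localSections V := by
  intro z hz
  obtain ⟨V', hVU, hzV, hV', hxV⟩ := hx z (h hz)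
  obtain ⟨W, hWV, hW, hzW⟩ := exists_affine_le (U := V ⊓ V') ⟨hz, hzV⟩
  refine ⟨W, hWV.trans inf_le_left, hzW, hW, ?_⟩
  have h1 := N.res_mem hW hV' (hWV.trans inf_le_right) hxV
  rw [res_res] at h1 ⊢
  exact h1

/-- Over an affine open the local sections are the prescribed ones: the functions that multiply a
local section into the prescribed submodule generate the unit ideal. -/
theorem localSections_eq (hW : IsAffineOpen W) : N.localSections W = N.obj W := by
  refine le_antisymm (fun x hx => ?_) fun x hx z hz => ⟨W, le_rfl, hz, hW, by rwa [res_rfl]⟩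
  let I : Ideal Γ(Z, W) := (N.obj W).colon {x}
  have hI (z : Z) (hz : z ∈ W) : ∃ f ∈ I, z ∈ Z.basicOpen f := by
    obtain ⟨V, hVW, hzV, hV, hxV⟩ := hx z hz
    obtain ⟨f, hf, hzf⟩ := hW.exists_basicOpen_le ⟨z, hzV⟩ hz
    have h1 := N.res_mem (hW.basicOpen f) hV hf hxV
    rw [res_res] at h1
    obtain ⟨n, hn⟩ := N.exists_pow_smul_mem hW f x h1
    refine ⟨f ^ (n + 1), ?_, ?_⟩
    · refine Submodule.mem_colon_singleton.2 ?_
      rw [pow_succ', mul_smul]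
      exact Submodule.smul_mem _ _ hn
    · rwa [Scheme.basicOpen_pow _ _ n.succ_pos]
  have htop : Ideal.span (I : Set Γ(Z, W)) = ⊤ := by
    rw [← hW.self_le_iSup_basicOpen_iff]
    intro z hz
    obtain ⟨f, hf, hzf⟩ := hI z hz
    exact TopologicalSpace.Opens.mem_iSup.2 ⟨⟨f, hf⟩, hzf⟩
  rw [Ideal.span_eq] at htop
  have h1 : (1 : Γ(Z, W)) ∈ I := htop ▸ Submodule.mem_top
  have := Submodule.mem_colon_singleton.1 h1
  rwa [one_smul] at this

/-- The family of submodules of local sections, as a subpresheaf of modules. -/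
def subpresheaf : PresheafOfModules.Submodule M.val where
  obj U := N.localSections U.unop
  map f := fun _ hx => N.res_mem_localSections f.unop.le hx

/-- The sheaf of modules of local sections. -/
def sheaf : Z.Modules where
  val := N.subpresheaf.toPresheafOfModules
  isSheaf := by
    change TopCat.Presheaf.IsSheaf (X := Z) (N.subpresheaf.toPresheafOfModules).presheaf
    rw [TopCat.Presheaf.isSheaf_iff_isSheafUniqueGluing]
    intro ι U sf hsf
    let sf' (i : ι) : M.presheaf.obj (op (U i)) := (sf i).1
    have h1 (i j) : res M (inf_le_left : U i ⊓ U j ≤ U i) (sf i).1 =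
        res M (inf_le_right : U i ⊓ U j ≤ U j) (sf j).1 := congrArg Subtype.val (hsf i j)
    obtain ⟨s, hs, hs'⟩ := TopCat.Sheaf.existsUnique_gluing' ⟨M.presheaf, M.isSheaf⟩ U (iSup U)
      (fun i => homOfLE (le_iSup U i)) le_rfl sf' h1
    have hs1 (i) : res M (le_iSup U i) s = (sf i).1 := hs i
    refine ⟨⟨s, fun z hz => ?_⟩, fun i => Subtype.ext (hs i), fun t ht => Subtype.ext
      (hs' t.1 fun i => congrArg Subtype.val (ht i))⟩
    obtain ⟨i, hi⟩ := TopologicalSpace.Opens.mem_iSup.1 hz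
    obtain ⟨V, hV, hzV, hVa, h⟩ := (sf i).2 z hi
    refine ⟨V, hV.trans (le_iSup U i), hzV, hVa, ?_⟩
    rw [← hs1, res_res] at h
    exact h

/-- The inclusion of the sheaf of local sections. -/
def incl : N.sheaf ⟶ M where
  val := N.subpresheaf.ι

instance : Mono N.incl := mono_of_app_injective _ fun _ => Subtype.val_injective

theorem mem_range_incl {x : Γ(M, U)} : x ∈ N.localSections U ↔ ∃ y, N.incl.app U y = x :=
  ⟨fun h => ⟨⟨x, h⟩, rfl⟩, by rintro ⟨y, rfl⟩; exact y.2⟩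

theorem isQuasicoherent_sheaf (hM : IsQuasicoherent M) : IsQuasicoherent N.sheaf := by
  refine isQuasicoherent_of_localizes covers_affine (fun _ h => h) _ fun W hW => ⟨?_, ?_⟩
  · intro f s
    have hs := N.mem_range_incl.2 ⟨s, rfl⟩
    obtain ⟨n, t, ht⟩ := (localizes M hM W hW).exists_res_eq f (N.incl.app _ s)
    obtain ⟨m, hm⟩ := N.exists_pow_smul_mem hW f t (by
      rw [ht, ← N.localSections_eq (hW.basicOpen f)]
      exact Submodule.smul_mem _ _ hs)
    rw [← N.localSections_eq hW, N.mem_range_incl] at hm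
    obtain ⟨y, hy⟩ := hm
    refine ⟨m + n, y, app_injective N.incl _ ?_⟩
    rw [app_res, hy, res_smul, ht, Scheme.Modules.Hom.app_smul, map_pow, pow_add, mul_smul]
  · intro f t ht
    obtain ⟨n, hn⟩ := (localizes M hM W hW).exists_pow_smul_eq_zero f (N.incl.app W t) (by
      rw [← app_res, ht, map_zero])
    refine ⟨n, app_injective N.incl _ ?_⟩
    rw [Scheme.Modules.Hom.app_smul, hn, map_zero]

/-- A quasi-coherent subsheaf can be prescribed by its sections over affine opens. -/
theorem exists_subobject (hM : IsQuasicoherent M) : ∃ G : Subobject M,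
    IsQuasicoherent (G : Z.Modules) ∧ ∀ W, IsAffineOpen W → sections G W = N.obj W := by
  let e := Subobject.underlyingIso N.incl
  refine ⟨Subobject.mk N.incl, ?_, fun W hW => ?_⟩
  · exact isQuasicoherent_of_iso e.symm (N.isQuasicoherent_sheaf hM)
  · rw [← N.localSections_eq hW]
    ext x
    rw [N.mem_range_incl, mem_sections]
    constructor
    · rintro ⟨y, rfl⟩
      refine ⟨e.hom.app W y, ?_⟩
      rw [← comp_app_apply, Subobject.underlyingIso_hom_comp_eq_mk]
    · rintro ⟨y, rfl⟩
      refine ⟨e.inv.app W y, ?_⟩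
      rw [← comp_app_apply, Subobject.underlyingIso_arrow]

end AffineSubmodules

end

/-! ### Smooth curves over a field -/

section Algebra
open IsLocalRing

/-- A Noetherian local ring whose maximal ideal is generated by `0` or by a nonzerodivisor is a
field or a discrete valuation ring. -/
theorem isDomain_and_isPrincipalIdealRing {B : Type*} [CommRing B] [IsLocalRing B]
    [IsNoetherianRing B] {π : B} (hπ : maximalIdeal B = Ideal.span {π})
    (h : π = 0 ∨ π ∈ nonZeroDivisors B) : IsDomain B ∧ IsPrincipalIdealRing B := by
  have hdom : IsDomain B := by
    have key (x : B) (hx : x ≠ 0) : ∃ (n : ℕ) (v : B), IsUnit v ∧ x = π ^ n * v := by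
      have h1 : ∃ n, x ∉ maximalIdeal B ^ n := by
        by_contra! hn
        refine hx ?_
        have := Ideal.iInf_pow_eq_bot_of_isLocalRing (maximalIdeal B) (Ideal.IsPrime.ne_top')
        rw [← Ideal.mem_bot, ← this]
        exact (Submodule.mem_iInf _).2 hn
      classical
      obtain ⟨n, hn⟩ : ∃ n, Nat.find h1 = n + 1 := Nat.exists_eq_succ_of_ne_zero fun h0 => by
        have := Nat.find_spec h1
        rw [h0, pow_zero] at this
        exact this (by simp)
      have h2 : x ∈ maximalIdeal B ^ n := not_not.1 (Nat.find_min h1 (by omega))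
      have h3 : x ∉ maximalIdeal B ^ (n + 1) := hn ▸ Nat.find_spec h1
      rw [hπ, Ideal.span_singleton_pow, Ideal.mem_span_singleton] at h2 h3
      obtain ⟨v, rfl⟩ := h2
      refine ⟨n, v, ?_, rfl⟩
      by_contra hv
      have : v ∈ maximalIdeal B := hv
      rw [hπ, Ideal.mem_span_singleton] at this
      exact h3 (by rw [pow_succ]; exact mul_dvd_mul_left _ this)
    have : NoZeroDivisors B := by
      refine ⟨fun {x y} hxy => ?_⟩
      by_contra! hne
      obtain ⟨n, v, hv, rfl⟩ := key x hne.1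
      obtain ⟨m, w, hw, rfl⟩ := key y hne.2
      have h4 : π ^ (n + m) * (v * w) = 0 := by rw [← hxy]; ring
      rw [(hv.mul hw).mul_left_eq_zero] at h4
      rcases h with rfl | h
      · rcases n with - | n
        · rcases m with - | m
          · simp at h4
          · simp at hne
        · simp at hne
      · exact nonZeroDivisors.ne_zero (pow_mem h (n + m)) h4
    exact NoZeroDivisors.to_isDomain B
  refine ⟨hdom, ⟨fun I => ?_⟩⟩
  have hp : (maximalIdeal B).IsPrincipal := ⟨⟨π, hπ⟩⟩
  rcases eq_or_ne I ⊥ with rfl | hI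
  · infer_instance
  · obtain ⟨n, rfl⟩ := exists_maximalIdeal_pow_eq_of_principal B hp I hI
    rw [hπ, Ideal.span_singleton_pow]
    infer_instance

theorem isPrincipalIdealRing_mvPolynomial (K : Type*) [Field K] :
    IsPrincipalIdealRing (MvPolynomial (Fin 1) K) :=
  IsPrincipalIdealRing.of_surjective (MvPolynomial.uniqueAlgEquiv K (Fin 1)).symm.toRingHom
    (MvPolynomial.uniqueAlgEquiv K (Fin 1)).symm.surjective

/-- The local rings of an algebra that is étale over a principal ideal domain. -/
theorem isDomain_and_isPrincipalIdealRing_localization (R S : Type*) [CommRing R] [IsDomain R]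
    [IsPrincipalIdealRing R] [CommRing S] [Algebra R S] [Algebra.Etale R S] (p : Ideal S)
    [p.IsPrime] :
    IsDomain (Localization.AtPrime p) ∧ IsPrincipalIdealRing (Localization.AtPrime p) := by
  have : IsNoetherianRing S := Algebra.FiniteType.isNoetherianRing R S
  have : IsNoetherianRing (Localization.AtPrime p) :=
    IsLocalization.isNoetherianRing p.primeCompl _ inferInstance
  let q := p.under R
  let := Localization.AtPrime.algebraOfLiesOver q p
  have h := ((Algebra.isUnramifiedAt_iff_map_eq R q p).1 inferInstance).2
  obtain ⟨π, hπ⟩ := (inferInstance : q.IsPrincipal)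
  have hπ' : q = Ideal.span {π} := hπ
  have h2 : Module.Flat R (Localization.AtPrime p) := .trans R S _
  refine isDomain_and_isPrincipalIdealRing (π := algebraMap R _ π) ?_ ?_
  · rw [← h, hπ', Ideal.map_span, Set.image_singleton]
  · rcases eq_or_ne π 0 with rfl | h0
    · exact .inl (map_zero _)
    · right
      refine mem_nonZeroDivisors_iff_right.2 fun x hx => ?_
      have := Module.Flat.isSMulRegular_of_nonZeroDivisors (M := Localization.AtPrime p)
        (mem_nonZeroDivisors_of_ne_zero h0)
      refine this ?_
      simp only [smul_zero]
      rw [Algebra.smul_def, mul_comm, hx]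

/-- If a localization of a Noetherian ring at a prime is a domain, then a neighbourhood of the prime
is irreducible. -/
theorem exists_forall_le_of_isDomain {R : Type*} [CommRing R] [IsNoetherianRing R] (p : Ideal R)
    [p.IsPrime] [IsDomain (Localization.AtPrime p)] : ∃ (q : Ideal R) (s : R), q.IsPrime ∧ s ∉ p ∧
      s ∉ q ∧ ∀ p' : Ideal R, p'.IsPrime → s ∉ p' → q ≤ p' := by
  let q := RingHom.ker (algebraMap R (Localization.AtPrime p))
  have hq (x : R) (hx : x ∈ q) : ∃ s ∉ p, s * x = 0 := by
    obtain ⟨s, hs⟩ := (IsLocalization.map_eq_zero_iff p.primeCompl (Localization.AtPrime p) x).1 hx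
    exact ⟨s, s.2, hs⟩
  have hqp : q ≤ p := fun x hx => by
    obtain ⟨s, hs, h⟩ := hq x hx
    exact ((‹p.IsPrime›.mem_or_mem (h ▸ zero_mem p : s * x ∈ p)).resolve_left hs)
  obtain ⟨t, ht⟩ := IsNoetherian.noetherian q
  choose! s hs hsx using hq
  have hx (x) (h : x ∈ t) : x ∈ q := ht ▸ Submodule.subset_span h
  have hsp : ∏ x ∈ t, s x ∉ p := by
    rw [Ideal.IsPrime.prod_mem_iff]
    rintro ⟨x, h, hx'⟩
    exact hs x (hx x h) hx'
  refine ⟨q, ∏ x ∈ t, s x, RingHom.ker_isPrime _, hsp, fun h => hsp (hqp h), fun p' hp' hsp' => ?_⟩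
  rw [← ht]
  refine Submodule.span_le.2 fun x h => ?_
  have h1 : (∏ x ∈ t, s x) * x = 0 := by
    obtain ⟨r, hr⟩ := Finset.dvd_prod_of_mem s h
    rw [hr, mul_assoc, mul_comm r, ← mul_assoc, hsx x (hx x h), zero_mul]
  exact (hp'.mem_or_mem (h1 ▸ zero_mem p' : (∏ x ∈ t, s x) * x ∈ p')).resolve_left hsp'

end Algebra

/-- A connected space that is locally irreducible, with local generic points, is irreducible. -/
theorem irreducibleSpace_of_connectedSpace {Y : Type*} [TopologicalSpace Y] [ConnectedSpace Y]
    (h : ∀ z : Y, ∃ (U : Set Y) (η : Y), IsOpen U ∧ z ∈ U ∧ η ∈ U ∧ ∀ y ∈ U, η ⤳ y) :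
    IrreducibleSpace Y := by
  choose U η hU hzU hηU hη using h
  obtain ⟨z₀⟩ := (inferInstance : Nonempty Y)
  have hcl : IsClopen (closure {η z₀}) := by
    refine ⟨isClosed_closure, isOpen_iff_mem_nhds.2 fun z hz => ?_⟩
    have h1 : η z₀ ⤳ z := specializes_iff_mem_closure.2 hz
    have h2 : η z ⤳ η z₀ := hη z _ (h1.mem_open (hU z) (hzU z))
    have h3 : η z₀ ⤳ η z := hη z₀ _ (h2.mem_open (hU z₀) (hηU z₀))
    filter_upwards [(hU z).mem_nhds (hzU z)] with y hy
    exact specializes_iff_mem_closure.1 (h3.trans (hη z y hy))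
  have huniv := hcl.eq_univ ⟨_, subset_closure rfl⟩
  have h4 : IsIrreducible (Set.univ : Set Y) := huniv ▸ isIrreducible_singleton.closure
  exact (irreducibleSpace_def Y).2 h4

section Curve
variable {K : Type u} [Field K] {Y : Scheme.{u}} (f : Y ⟶ Spec (CommRingCat.of K))

/-- Locally, a smooth curve over a field is étale over the affine line. -/
theorem exists_etale_chart [SmoothOfRelativeDimension 1 f] (z : Y) : ∃ (U : Y.Opens),
    IsAffineOpen U ∧ z ∈ U ∧ ∃ g : MvPolynomial (Fin 1) Γ(Spec (CommRingCat.of K), ⊤) →+* Γ(Y, U),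
      g.comp MvPolynomial.C = (f.appLE ⊤ U le_top).hom ∧ g.Etale := by
  obtain ⟨V, -, U, hU, hz, e, h⟩ :=
    SmoothOfRelativeDimension.exists_isStandardSmoothOfRelativeDimension (f := f) (n := 1) z
  have hV : V = ⊤ := by
    rw [eq_top_iff]
    intro y _
    have : Subsingleton (Spec (CommRingCat.of K)) :=
      inferInstanceAs (Subsingleton (PrimeSpectrum K))
    rw [Subsingleton.elim y (f z)]
    exact e hz
  subst hV
  exact ⟨U, hU, hz, h.exists_etale_mvPolynomial⟩

theorem isField_sections_spec : IsField Γ(Spec (CommRingCat.of K), ⊤) :=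
  (Scheme.ΓSpecIso (CommRingCat.of K)).commRingCatIsoToRingEquiv.toMulEquiv.isField
    (Field.toIsField K)

theorem isLocallyNoetherian_of_smooth [SmoothOfRelativeDimension 1 f] : IsLocallyNoetherian Y := by
  have := SmoothOfRelativeDimension.smooth 1 f
  exact LocallyOfFiniteType.isLocallyNoetherian f

/-- The local rings of a smooth curve are regular, since it is étale over the affine line. -/
theorem stalk_isDomain_and_isPrincipalIdealRing [SmoothOfRelativeDimension 1 f] (z : Y) :
    IsDomain (Y.presheaf.stalk z) ∧ IsPrincipalIdealRing (Y.presheaf.stalk z) := by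
  obtain ⟨U, hU, hz, g, -, hg⟩ := exists_etale_chart f z
  let := (isField_sections_spec (K := K)).toField
  have := isPrincipalIdealRing_mvPolynomial Γ(Spec (CommRingCat.of K), ⊤)
  algebraize [g]
  let := Y.presheaf.algebra_section_stalk (⟨z, hz⟩ : U)
  have hloc := hU.isLocalization_stalk ⟨z, hz⟩
  have h := isDomain_and_isPrincipalIdealRing_localization
    (MvPolynomial (Fin 1) Γ(Spec (CommRingCat.of K), ⊤)) Γ(Y, U) (hU.primeIdealOf ⟨z, hz⟩).asIdeal
  let e := IsLocalization.algEquiv (hU.primeIdealOf ⟨z, hz⟩).asIdeal.primeCompl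
    (Localization.AtPrime (hU.primeIdealOf ⟨z, hz⟩).asIdeal)
    (Y.presheaf.stalk ((⟨z, hz⟩ : U) : Y))
  have := h.1
  have := h.2
  exact ⟨e.symm.toMulEquiv.isDomain, IsPrincipalIdealRing.of_surjective e.toRingHom e.surjective⟩

theorem isDomain_localization_of_stalk {U : Y.Opens} (hU : IsAffineOpen U) (p : Ideal Γ(Y, U))
    [hp : p.IsPrime]
    (h : ∀ z : Y, IsDomain (Y.presheaf.stalk z) ∧ IsPrincipalIdealRing (Y.presheaf.stalk z)) :
    IsDomain (Localization.AtPrime p) ∧ IsPrincipalIdealRing (Localization.AtPrime p) := by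
  let y : PrimeSpectrum Γ(Y, U) := ⟨p, hp⟩
  have hy : hU.fromSpec y ∈ U := (hU.isoSpec.inv y).2
  let := TopCat.Presheaf.algebra_section_stalk Y.presheaf ⟨_, hy⟩
  have hloc : IsLocalization.AtPrime (Y.presheaf.stalk (hU.fromSpec y)) p :=
    hU.isLocalization_stalk' y hy
  let e := IsLocalization.algEquiv p.primeCompl (Localization.AtPrime p)
    (Y.presheaf.stalk (hU.fromSpec y))
  have := (h (hU.fromSpec y)).1
  have := (h (hU.fromSpec y)).2
  exact ⟨e.toMulEquiv.isDomain,
    IsPrincipalIdealRing.of_surjective e.symm.toRingHom e.symm.surjective⟩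

/-- A connected smooth curve is reduced and irreducible, since its local rings are domains. -/
theorem isIntegral_of_smooth [SmoothOfRelativeDimension 1 f] [ConnectedSpace Y] : IsIntegral Y := by
  have hst := stalk_isDomain_and_isPrincipalIdealRing f
  have := fun z => (hst z).1
  have hred : IsReduced Y := isReduced_of_isReduced_stalk Y
  have := isLocallyNoetherian_of_smooth f
  have hirr : IrreducibleSpace Y := by
    refine irreducibleSpace_of_connectedSpace fun z => ?_
    obtain ⟨U, -, hU, hz⟩ := exists_affine_le (U := (⊤ : Y.Opens)) (z := z) trivial
    have : IsNoetherianRing Γ(Y, U) := IsLocallyNoetherian.component_noetherian ⟨U, hU⟩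
    let p := hU.primeIdealOf ⟨z, hz⟩
    have := (isDomain_localization_of_stalk hU p.asIdeal hst).1
    obtain ⟨q, s, hq, hsp, hsq, hle⟩ := exists_forall_le_of_isDomain p.asIdeal
    let D : (Spec Γ(Y, U)).Opens := PrimeSpectrum.basicOpen s
    refine ⟨hU.fromSpec '' D, hU.fromSpec ⟨q, hq⟩,
      hU.fromSpec.isOpenEmbedding.isOpenMap _ D.2, ?_, ?_, ?_⟩
    · exact ⟨p, hsp, hU.fromSpec_primeIdealOf ⟨z, hz⟩⟩
    · exact ⟨_, hsq, rfl⟩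
    · rintro _ ⟨y, hy, rfl⟩
      exact ((PrimeSpectrum.le_iff_specializes _ _).1 (hle y.asIdeal y.2 hy)).map
        hU.fromSpec.continuous
  exact isIntegral_of_irreducibleSpace_of_isReduced Y

/-- The functions on an affine open of a smooth integral curve form a Dedekind domain, since the
local rings are fields or discrete valuation rings. -/
theorem isDedekindDomain_sections [SmoothOfRelativeDimension 1 f] [IsIntegral Y] {U : Y.Opens}
    (hU : IsAffineOpen U) [Nonempty U] : IsDedekindDomain Γ(Y, U) := by
  have hst := stalk_isDomain_and_isPrincipalIdealRing f
  have := isLocallyNoetherian_of_smooth f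
  have : IsNoetherianRing Γ(Y, U) := IsLocallyNoetherian.component_noetherian ⟨U, hU⟩
  have : IsDedekindDomainDvr Γ(Y, U) :=
    { is_dvr_at_nonzero_prime := fun p hp _ => by
        have := (isDomain_localization_of_stalk hU p hst).1
        have := (isDomain_localization_of_stalk hU p hst).2
        have h := IsLocalization.AtPrime.not_isField Γ(Y, U) hp (Localization.AtPrime p)
        exact { not_a_field' := fun h' => h (IsLocalRing.isField_iff_maximalIdeal_eq.2 h') } }
  infer_instance

end Curve

/-! ### The product of a curve with a field, and its partial Frobenius endomorphisms -/

section FrobeniusBasis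

/-- A field has a basis over the image of an endomorphism. -/
theorem exists_frobenius_basis {E : Type u} [Field E] (τ : E →+* E) : ∃ (ι : Type u) (b : ι → E),
    Function.Bijective fun x : ι →₀ E => x.sum fun i c => b i * τ c := by
  let m : Module E E := Module.compHom E τ
  let b := @Module.Basis.ofVectorSpace E E _ _ m
  refine ⟨_, b, ?_⟩
  have h : (fun x : _ →₀ E => x.sum fun i c => b i * τ c) =
      fun x => (@Module.Basis.repr _ E E _ _ m b).symm x := by
    funext x
    rw [Module.Basis.repr_symm_apply, Finsupp.linearCombination_apply]
    exact Finsupp.sum_congr fun i _ => mul_comm _ _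
  rw [h]
  exact (@Module.Basis.repr _ E E _ _ m b).symm.bijective

/-- If `A` has an `E`-basis `e` fixed by `σ`, then a basis `b` of `E` over `τ E` is a basis of `A`
over `σ A`: an element of `A` is expanded first in `e` and then, coefficient by coefficient,
in `b`. -/
theorem bijective_sum_of_bijective_sum {E A : Type u} [Field E] [CommRing A] (j : E →+* A)
    (τ : E →+* E) (σ : A →+* A) (hσ : ∀ c, σ (j c) = j (τ c)) {κ : Type u} {e : κ → A}
    (he : ∀ k, σ (e k) = e k)
    (hbij : Function.Bijective fun x : κ →₀ E => x.sum fun k c => j c * e k)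
    {ι : Type u} {b : ι → E}
    (hb : Function.Bijective fun x : ι →₀ E => x.sum fun i c => b i * τ c) :
    Function.Bijective fun x : ι →₀ A => x.sum fun i a => j (b i) * σ a := by
  let f₁ : (κ →₀ E) ≃+ A := AddEquiv.ofBijective
    (Finsupp.liftAddHom fun k => (AddMonoidHom.mulRight (e k)).comp j.toAddMonoidHom) hbij
  let f₂ : (ι →₀ E) ≃+ E := AddEquiv.ofBijective
    (Finsupp.liftAddHom fun i => (AddMonoidHom.mulLeft (b i)).comp τ.toAddMonoidHom) hb
  let f : (ι →₀ A) →+ A :=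
    Finsupp.liftAddHom fun i => (AddMonoidHom.mulLeft (j (b i))).comp σ.toAddMonoidHom
  let sw : (ι →₀ κ →₀ E) ≃+ (κ →₀ ι →₀ E) :=
    (Finsupp.curryAddEquiv (α := ι) (β := κ) (M := E)).symm.trans
      ((Finsupp.domCongr (Equiv.prodComm ι κ)).trans Finsupp.curryAddEquiv)
  have h : f.comp (Finsupp.mapRange.addEquiv f₁).toAddMonoidHom =
      (f₁.toAddMonoidHom.comp (Finsupp.mapRange.addEquiv f₂).toAddMonoidHom).comp
        sw.toAddMonoidHom := by
    refine Finsupp.addHom_ext' fun i => Finsupp.addHom_ext fun k c => ?_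
    have h₁ (k c) : f₁ (Finsupp.single k c) = j c * e k :=
      Finsupp.liftAddHom_apply_single _ _ _
    have h₂ (i c) : f₂ (Finsupp.single i c) = b i * τ c :=
      Finsupp.liftAddHom_apply_single _ _ _
    have h₃ (i a) : f (Finsupp.single i a) = j (b i) * σ a :=
      Finsupp.liftAddHom_apply_single _ _ _
    have h₄ : sw (Finsupp.single i (Finsupp.single k c)) =
        Finsupp.single k (Finsupp.single i c) := by
      simp [sw, Finsupp.curryAddEquiv]
    change f (Finsupp.mapRange.addEquiv f₁ (Finsupp.single i (Finsupp.single k c))) =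
      f₁ (Finsupp.mapRange.addEquiv f₂ (sw (Finsupp.single i (Finsupp.single k c))))
    rw [h₄, Finsupp.mapRange.addEquiv_apply, Finsupp.mapRange.addEquiv_apply,
      Finsupp.mapRange_single, Finsupp.mapRange_single]
    rw [h₁, h₂, h₃, h₁, map_mul, map_mul, hσ, he, mul_assoc]
  have h' : (f : (ι →₀ A) → A) ∘ (Finsupp.mapRange.addEquiv f₁) =
      f₁ ∘ (Finsupp.mapRange.addEquiv f₂) ∘ sw := funext fun x => DFunLike.congr_fun h x
  have h5 : Function.Bijective f := by
    rw [← Function.Bijective.of_comp_iff _ (Finsupp.mapRange.addEquiv f₁).bijective, h']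
    exact f₁.bijective.comp ((Finsupp.mapRange.addEquiv f₂).bijective.comp sw.bijective)
  exact h5

end FrobeniusBasis
noncomputable section
variable {Fq : Type u} [Field Fq] (X : Over (Spec (CommRingCat.of Fq)))
  (E : Type u) [Field E] [Algebra Fq E]

variable (Fq) in
/-- The spectrum of `E`, as a scheme over `𝔽_q`. -/
abbrev specOver : Over (Spec (CommRingCat.of Fq)) :=
  Over.mk (Spec.map (CommRingCat.ofHom (algebraMap Fq E)))

variable {X E} in
/-- The structure of an `E`-algebra on functions on `X ⊗ E`. -/
def scalars (W : (prod X (specOver Fq E)).Opens) : E →+* Γ(prod X (specOver Fq E), W) :=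
  ((Scheme.ΓSpecIso (CommRingCat.of E)).inv ≫
    (pullback.snd X.hom (specOver Fq E).hom).appLE ⊤ W le_top).hom

instance (W : (prod X (specOver Fq E)).Opens) : Algebra E Γ(prod X (specOver Fq E), W) :=
  (scalars W).toAlgebra

instance (W : (prod X (specOver Fq E)).Opens) (M : (prod X (specOver Fq E)).Modules) :
    Module E Γ(M, W) := Module.compHom _ (scalars W)

instance (W : (prod X (specOver Fq E)).Opens) (M : (prod X (specOver Fq E)).Modules) :
    IsScalarTower E Γ(prod X (specOver Fq E), W) Γ(M, W) where
  smul_assoc c a m := mul_smul (scalars W c) a m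

/-- The preimage in `X ⊗ E` of an open of `X`. -/
abbrev cyl (V : X.left.Opens) : (prod X (specOver Fq E)).Opens :=
  pullback.fst X.hom (specOver Fq E).hom ⁻¹ᵁ V

variable {X}

theorem isAffineOpen_cyl {V : X.left.Opens} (hV : IsAffineOpen V) : IsAffineOpen (cyl X E V) := by
  have : IsAffineHom (specOver Fq E).hom :=
    inferInstanceAs (IsAffineHom (Spec.map (CommRingCat.ofHom (algebraMap Fq E))))
  have : IsAffineHom (pullback.fst X.hom (specOver Fq E).hom) :=
    MorphismProperty.of_isPullback (P := @IsAffineHom)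
      (IsPullback.of_hasPullback X.hom (specOver Fq E).hom).flip this
  exact hV.preimage _

variable (X) in
/-- The cover of `X ⊗ E` by the preimages of affine opens of `X`. -/
def cylinders : Set (prod X (specOver Fq E)).Opens := {W | ∃ V, IsAffineOpen V ∧ W = cyl X E V}

theorem covers_cylinders : Covers (cylinders X E) := fun z =>
  let ⟨V, _, hV, hz⟩ := exists_affine_le (U := (⊤ : X.left.Opens))
    (z := pullback.fst X.hom (specOver Fq E).hom z) trivial
  ⟨_, ⟨V, hV, rfl⟩, hz⟩

theorem isAffineOpen_of_mem_cylinders : ∀ W ∈ cylinders X E, IsAffineOpen W := by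
  rintro _ ⟨V, hV, rfl⟩
  exact isAffineOpen_cyl E hV

theorem Phi_fst [Fintype Fq] : Phi X (specOver Fq E) ≫ pullback.fst X.hom (specOver Fq E).hom =
    pullback.fst X.hom (specOver Fq E).hom := pullback.lift_fst _ _ _

theorem Phi_preimage_cyl [Fintype Fq] (V : X.left.Opens) :
    Phi X (specOver Fq E) ⁻¹ᵁ (cyl X E V) = cyl X E V := by
  conv_rhs => rw [cyl, ← Phi_fst]
  rfl

instance : IsAffine (specOver Fq E).left := inferInstanceAs (IsAffine (Spec _))

/-- The functions on `V ⊗ E` have an `E`-basis that consists of functions on `V`. -/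
theorem exists_sections_basis {V : X.left.Opens} (hV : IsAffineOpen V) :
    ∃ (κ : Type u) (e : κ → Γ(X.left, V)), Function.Bijective fun x : κ →₀ E => x.sum fun k c =>
      scalars (cyl X E V) c *
        (pullback.fst X.hom (specOver Fq E).hom).appLE V (cyl X E V) le_rfl (e k) := by
  have H := IsPullback.of_hasPullback X.hom (specOver Fq E).hom
  have h1 := (isIso_pushoutSection_iff H (US := ⊤) (UT := ⊤) (UX := V) (UY := cyl X E V) le_top
    le_top (inf_top_eq _).symm).1 (isIso_pushoutSection_of_isAffineOpen H _ _ _ (isAffineOpen_top _)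
      (isAffineOpen_top _) hV)
  have hk := isField_sections_spec (K := Fq)
  let := hk.toField
  let : Algebra Γ(Spec (CommRingCat.of Fq), ⊤) Γ(X.left, V) :=
    (X.hom.appLE ⊤ V le_top).hom.toAlgebra
  let : Algebra Γ(Spec (CommRingCat.of Fq), ⊤) Γ((specOver Fq E).left, ⊤) :=
    ((specOver Fq E).hom.appLE ⊤ ⊤ le_top).hom.toAlgebra
  let : Algebra Γ(X.left, V) Γ(prod X (specOver Fq E), cyl X E V) :=
    ((pullback.fst X.hom (specOver Fq E).hom).appLE V (cyl X E V) le_rfl).hom.toAlgebra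
  let : Algebra Γ((specOver Fq E).left, ⊤) Γ(prod X (specOver Fq E), cyl X E V) :=
    ((pullback.snd X.hom (specOver Fq E).hom).appLE ⊤ (cyl X E V) le_top).hom.toAlgebra
  let : Algebra Γ(Spec (CommRingCat.of Fq), ⊤) Γ(prod X (specOver Fq E), cyl X E V) :=
    (X.hom.appLE ⊤ V le_top ≫
      (pullback.fst X.hom (specOver Fq E).hom).appLE V (cyl X E V) le_rfl).hom.toAlgebra
  have : IsScalarTower Γ(Spec (CommRingCat.of Fq), ⊤) Γ(X.left, V)
    Γ(prod X (specOver Fq E), cyl X E V) := .of_algebraMap_eq' rfl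
  have : IsScalarTower Γ(Spec (CommRingCat.of Fq), ⊤) Γ((specOver Fq E).left, ⊤)
    Γ(prod X (specOver Fq E), cyl X E V) :=
      .of_algebraMap_eq' (congrArg CommRingCat.Hom.hom h1.w)
  have h2 := (CommRingCat.isPushout_iff_isPushout (R := Γ(Spec (CommRingCat.of Fq), ⊤))
    (S := Γ(X.left, V)) (R' := Γ((specOver Fq E).left, ⊤))
    (S' := Γ(prod X (specOver Fq E), cyl X E V))).1 h1.flip
  let b := Module.Basis.ofVectorSpace Γ(Spec (CommRingCat.of Fq), ⊤) Γ(X.left, V)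
  let b' := h2.out.basis b
  let i : E ≃+* Γ((specOver Fq E).left, ⊤) :=
    (Scheme.ΓSpecIso (CommRingCat.of E)).symm.commRingCatIsoToRingEquiv
  refine ⟨_, b, ?_⟩
  have h : (fun x : _ →₀ E => x.sum fun k c => scalars (cyl X E V) c *
      (pullback.fst X.hom (specOver Fq E).hom).appLE V (cyl X E V) le_rfl (b k)) =
      b'.repr.symm ∘ Finsupp.mapRange.addEquiv i.toAddEquiv := by
    funext x
    rw [Function.comp_apply, Module.Basis.repr_symm_apply, Finsupp.linearCombination_apply,
      Finsupp.mapRange.addEquiv_apply]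
    refine Eq.trans ?_ (Finsupp.sum_mapRange_index (fun k => zero_smul _ (b' k))).symm
    refine Finsupp.sum_congr fun k _ => ?_
    rw [IsBaseChange.basis_apply, Algebra.smul_def]
    rfl
  rw [h]
  exact b'.repr.symm.bijective.comp (AddEquiv.bijective _)

end

noncomputable section

theorem appLE_appLE_apply {X Y Z : Scheme.{u}} {f : X ⟶ Y} {g : Y ⟶ Z} {k : X ⟶ Z} (hk : f ≫ g = k)
    {U : Z.Opens} {V : Y.Opens} {W : X.Opens} (e₁ : V ≤ g ⁻¹ᵁ U) (e₂ : W ≤ f ⁻¹ᵁ V)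
    (e₃ : W ≤ k ⁻¹ᵁ U) (x : Γ(Z, U)) : f.appLE V W e₂ (g.appLE U V e₁ x) = k.appLE U W e₃ x := by
  subst hk
  rw [← CommRingCat.comp_apply, Scheme.Hom.appLE_comp_appLE]

section
variable {Fq : Type u} [Field Fq] [Fintype Fq]

theorem frobScheme_appLE_apply (S : Over (Spec (CommRingCat.of Fq))) {U V : S.left.Opens}
    (h : V ≤ U) (x : Γ(S.left, U)) :
    (frobScheme S).appLE U V h x = rres h x ^ Fintype.card Fq :=
  map_pow (S.left.presheaf.map (homOfLE h).op).hom x _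

theorem frobScheme_naturality {S T : Over (Spec (CommRingCat.of Fq))} (h : S ⟶ T) :
    frobScheme S ≫ h.left = h.left ≫ frobScheme T := by
  refine Scheme.Hom.ext rfl fun U => ?_
  ext x
  refine (ConcreteCategory.congr_hom (S.left.presheaf.map_id _) _).trans ?_
  change (h.left.app U x) ^ Fintype.card Fq = h.left.app U (x ^ Fintype.card Fq)
  rw [map_pow]

variable (X S : Over (Spec (CommRingCat.of Fq)))

/-- The endomorphism `Fr_X × Id_S` of `X × S`. -/
def Psi : prod X S ⟶ prod X S :=
  pullback.lift (pullback.fst X.hom S.hom ≫ (frob X).left) (pullback.snd X.hom S.hom) (by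
    rw [Category.assoc, Over.w, pullback.condition])

/-- The two partial Frobenius endomorphisms compose to the Frobenius endomorphism. -/
theorem Phi_comp_Psi :
    Phi X S ≫ Psi X S = frobScheme (Over.mk (pullback.fst X.hom S.hom ≫ X.hom)) := by
  let Z : Over (Spec (CommRingCat.of Fq)) := Over.mk (pullback.fst X.hom S.hom ≫ X.hom)
  let p : Z ⟶ X := Over.homMk (pullback.fst X.hom S.hom) rfl
  let r : Z ⟶ S := Over.homMk (pullback.snd X.hom S.hom) pullback.condition.symm
  refine pullback.hom_ext ?_ ?_
  · refine Eq.trans ?_ (frobScheme_naturality p).symm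
    rw [Category.assoc, Psi, pullback.lift_fst, Phi, ← Category.assoc, pullback.lift_fst]
    rfl
  · refine Eq.trans ?_ (frobScheme_naturality r).symm
    rw [Category.assoc, Psi, pullback.lift_snd, Phi, pullback.lift_snd]
    rfl

theorem Psi_Phi_apply (z : prod X S) : Psi X S (Phi X S z) = z := by
  rw [← Scheme.Hom.comp_apply, Phi_comp_Psi]
  rfl

variable {X S}

theorem graph_comp_Psi (γ : S ⟶ X) : graph γ ≫ Psi X S = graph (γ ≫ frob X) := by
  refine pullback.hom_ext ?_ ?_
  · rw [Category.assoc, Psi, pullback.lift_fst, graph, graph, pullback.lift_fst,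
      ← Category.assoc, pullback.lift_fst, Over.comp_left]
  · rw [Category.assoc, Psi, pullback.lift_snd, graph, graph, pullback.lift_snd, pullback.lift_snd]

/-- `Ψ` moves the graph of `γ` to that of `Fr_X ∘ γ`. -/
theorem iterate_Psi_graph (γ : S ⟶ X) (i : ℕ) (s : S.left) :
    (Psi X S)^[i] (graph γ s) = graph (γ ≫ frobPow X i) s := by
  induction i with
  | zero => rw [Function.iterate_zero, id, frobPow, Category.comp_id]
  | succ i ih =>
    rw [Function.iterate_succ_apply', ih, frobPow, ← Category.assoc, ← graph_comp_Psi]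
    rfl

/-- The `Φ`-orbit of the graph of `γ`, in both directions: the points `z` of `X × S` such that some
forward iterate of `z` is a forward iterate of a point of the graph. -/
def orbitPoints (γ : S ⟶ X) : Set (prod X S) :=
  {z | ∃ (i j : ℕ) (s : S.left), (Phi X S)^[i] z = (Phi X S)^[j] (graph γ s)}

theorem graph_mem_orbitPoints (γ : S ⟶ X) (s : S.left) : graph γ s ∈ orbitPoints γ :=
  ⟨0, 0, s, rfl⟩

theorem Phi_mem_orbitPoints_iff {γ : S ⟶ X} {z : prod X S} :
    Phi X S z ∈ orbitPoints γ ↔ z ∈ orbitPoints γ := by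
  constructor
  · rintro ⟨i, j, s, h⟩
    exact ⟨i + 1, j, s, h⟩
  · rintro ⟨i, j, s, h⟩
    refine ⟨i, j + 1, s, ?_⟩
    rw [← Function.iterate_succ_apply, Function.iterate_succ_apply', h,
      Function.iterate_succ_apply']

theorem iterate_Psi_Phi (n m : ℕ) (z : prod X S) :
    (Psi X S)^[m + n] ((Phi X S)^[n] z) = (Psi X S)^[m] z := by
  rw [Function.iterate_add_apply]
  exact congrArg _ (Function.LeftInverse.iterate (Psi_Phi_apply X S) n z)

/-- The graph of `β` is disjoint from the `Φ`-orbit of the graph of `α`: apply `Ψ ^ (i + j)`, which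
undoes `Φ` on points, to an equality `Φ ^ i (β, s) = Φ ^ j (α, t)`. -/
theorem graph_notMem_orbitPoints {α β : S ⟶ X} (h : FrobDisjoint α β) (s : S.left) :
    graph β s ∉ orbitPoints α := by
  rintro ⟨i, j, t, hij⟩
  have h1 := congrArg (Psi X S)^[j + i] hij
  rw [iterate_Psi_Phi, add_comm j i, iterate_Psi_Phi, iterate_Psi_graph, iterate_Psi_graph] at h1
  exact Set.disjoint_left.1 (h i j) ⟨t, rfl⟩ ⟨s, h1⟩

end

variable {Fq : Type u} [Field Fq] [Fintype Fq] {X : Over (Spec (CommRingCat.of Fq))}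
  {E : Type u} [Field E] [Algebra Fq E]

/-- The endomorphism of the functions on an open that is stable under `Φ`. -/
def frobRing {W : (prod X (specOver Fq E)).Opens} (h : W ≤ Phi X (specOver Fq E) ⁻¹ᵁ W) :
    Γ(prod X (specOver Fq E), W) →+* Γ(prod X (specOver Fq E), W) :=
  ((Phi X (specOver Fq E)).appLE W W h).hom

theorem frobRing_scalars {W : (prod X (specOver Fq E)).Opens}
    (h : W ≤ Phi X (specOver Fq E) ⁻¹ᵁ W) (c : E) :
    frobRing h (scalars W c) = scalars W (c ^ Fintype.card Fq) := by
  let s : Γ((specOver Fq E).left, ⊤) := (Scheme.ΓSpecIso (CommRingCat.of E)).inv c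
  let p := pullback.snd X.hom (specOver Fq E).hom
  refine (appLE_appLE_apply (g := p) (k := p ≫ frobScheme (specOver Fq E)) (U := ⊤)
    (pullback.lift_snd _ _ _) le_top h le_top s).trans ?_
  refine (appLE_appLE_apply (f := p) (V := ⊤) rfl le_top le_top le_top s).symm.trans ?_
  rw [frobScheme_appLE_apply, rres_rfl, ← map_pow]
  rfl

theorem frobRing_fst {W : (prod X (specOver Fq E)).Opens}
    (h : W ≤ Phi X (specOver Fq E) ⁻¹ᵁ W) {V : X.left.Opens} (hV : W ≤ cyl X E V)
    (s : Γ(X.left, V)) :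
    frobRing h ((pullback.fst X.hom (specOver Fq E).hom).appLE V W hV s) =
      (pullback.fst X.hom (specOver Fq E).hom).appLE V W hV s := by
  exact appLE_appLE_apply (pullback.lift_fst _ _ _) hV h hV s

/-- The function `a` divides `a ^ q = Φ^* (Ψ^* a)`. -/
theorem exists_dvd_frobRing [IsReduced (prod X (specOver Fq E))] {V : X.left.Opens}
    (a : Γ(prod X (specOver Fq E), cyl X E V)) (ha : a ≠ 0) :
    ∃ a' ≠ 0, a ∣ frobRing (Phi_preimage_cyl E V).ge a' := by
  have hΨ : cyl X E V ≤ Psi X (specOver Fq E) ⁻¹ᵁ (cyl X E V) := by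
    have h : Psi X (specOver Fq E) ≫ pullback.fst X.hom (specOver Fq E).hom =
      pullback.fst X.hom (specOver Fq E).hom ≫ frobScheme X := pullback.lift_fst _ _ _
    intro z hz
    exact (congrArg (fun k : prod X (specOver Fq E) ⟶ X.left => k z ∈ V) h).mpr hz
  have h : frobRing (Phi_preimage_cyl E V).ge ((Psi X (specOver Fq E)).appLE _ _ hΨ a) =
      a ^ Fintype.card Fq := by
    refine (appLE_appLE_apply (Phi_comp_Psi X (specOver Fq E)) hΨ (Phi_preimage_cyl E V).ge le_rfl
      a).trans ?_
    refine (frobScheme_appLE_apply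
      (Over.mk (pullback.fst X.hom (specOver Fq E).hom ≫ X.hom)) (U := cyl X E V) le_rfl a).trans ?_
    rw [rres_rfl]
  refine ⟨(Psi X (specOver Fq E)).appLE _ _ hΨ a, fun h0 => ?_, ?_⟩
  · rw [h0, map_zero] at h
    exact ha (pow_eq_zero_iff Fintype.card_ne_zero |>.1 h.symm)
  · rw [h]
    exact dvd_pow_self a Fintype.card_ne_zero

/-- The data of the endomorphism `Φ` on the functions on `V ⊗ E`. -/
def frobData [IsReduced (prod X (specOver Fq E))] {V : X.left.Opens} (hV : IsAffineOpen V) :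
    FrobData E Γ(prod X (specOver Fq E), cyl X E V) where
  τ := (FiniteField.frobeniusAlgHom Fq E).toRingHom
  σ := frobRing (Phi_preimage_cyl E V).ge
  σ_algebraMap c := frobRing_scalars _ c
  ι := (exists_frobenius_basis (FiniteField.frobeniusAlgHom Fq E).toRingHom).choose
  b := (exists_frobenius_basis (FiniteField.frobeniusAlgHom Fq E).toRingHom).choose_spec.choose
  bijE :=
    (exists_frobenius_basis (FiniteField.frobeniusAlgHom Fq E).toRingHom).choose_spec.choose_spec
  bijA := by
    obtain ⟨κ, e, he⟩ := exists_sections_basis E hV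
    exact bijective_sum_of_bijective_sum (scalars _) _ _ (fun c => frobRing_scalars _ c)
      (fun k => frobRing_fst _ le_rfl (e k)) he
      (exists_frobenius_basis (FiniteField.frobeniusAlgHom Fq E).toRingHom).choose_spec.choose_spec
  exists_dvd a ha := exists_dvd_frobRing a ha

end

/-! ### The ideal of a graph -/

/-- An étale, hence flat, map from a polynomial ring to a nonzero ring does not kill `X - c`. -/
theorem map_X_sub_C_ne_zero {K A : Type*} [CommRing K] (hK : IsField K) [CommRing A] [Nontrivial A]
    (g : MvPolynomial (Fin 1) K →+* A) (hg : g.Etale) (c : K) :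
    g (MvPolynomial.X 0 - MvPolynomial.C c) ≠ 0 := by
  let := hK.toField
  algebraize [g]
  have h5 : MvPolynomial.X 0 - MvPolynomial.C c ≠ (0 : MvPolynomial (Fin 1) K) := fun h0 => by
    have := congrArg (MvPolynomial.eval fun _ => c + 1) h0
    simp at this
  intro h0
  have := Module.Flat.isSMulRegular_of_nonZeroDivisors (M := A) (mem_nonZeroDivisors_of_ne_zero h5)
  refine one_ne_zero (this (?_ : _ • (1 : A) = _ • (0 : A)))
  rw [smul_zero, Algebra.smul_def, mul_one]
  exact h0

section
variable {Z : Scheme.{u}} {W : Z.Opens}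

theorem fromSpec_mem_basicOpen_iff (hW : IsAffineOpen W) (y : PrimeSpectrum Γ(Z, W)) (a : Γ(Z, W)) :
    hW.fromSpec y ∈ Z.basicOpen a ↔ a ∉ y.asIdeal := by
  have h : y ∈ hW.fromSpec ⁻¹ᵁ Z.basicOpen a ↔ y ∈ PrimeSpectrum.basicOpen a :=
    (SetLike.ext_iff.1 (hW.fromSpec_preimage_basicOpen a)) y
  exact h

theorem res_top_injective {T : Scheme.{u}} {U : T.Opens} (h : ⊤ ≤ U) :
    Function.Injective (T.presheaf.map (homOfLE h).op) := by
  obtain rfl : U = ⊤ := top_le_iff.1 h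
  intro x y hxy
  have key (x) : T.presheaf.map (homOfLE h).op x = x :=
    ConcreteCategory.congr_hom (T.presheaf.map_id (op ⊤)) x
  rwa [key, key] at hxy

theorem mem_idealSections_iff {T : Scheme.{u}} {γ : T ⟶ Z} (h : ⊤ ≤ γ ⁻¹ᵁ W) {a : Γ(Z, W)} :
    a ∈ idealSections γ W ↔ γ.appLE W ⊤ h a = 0 := by
  refine ⟨fun h0 => ?_, fun h0 => res_top_injective h ?_⟩
  · have h1 : γ.app W a = 0 := h0
    change T.presheaf.map (homOfLE h).op (γ.app W a) = 0
    rw [h1, map_zero]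
  · exact Eq.trans h0 (map_zero _).symm

theorem idealSections_eq_top {T : Scheme.{u}} {γ : T ⟶ Z} (h : γ ⁻¹ᵁ W = ⊥) :
    idealSections γ W = ⊤ := by
  rw [Ideal.eq_top_iff_one]
  change γ.app W 1 = 0
  have : Subsingleton Γ(T, γ ⁻¹ᵁ W) :=
    h ▸ (CommRingCat.subsingleton_of_isTerminal T.sheaf.isTerminalOfEmpty)
  exact Subsingleton.elim _ _
end

section Graph

variable {Fq : Type u} [Field Fq] {X : Over (Spec (CommRingCat.of Fq))}
  {E : Type u} [Field E] [Algebra Fq E] (γ : specOver Fq E ⟶ X)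

instance : Subsingleton (specOver Fq E).left := inferInstanceAs (Subsingleton (PrimeSpectrum E))
instance : Nonempty (specOver Fq E).left := inferInstanceAs (Nonempty (PrimeSpectrum E))

section
variable {γ} {W : (prod X (specOver Fq E)).Opens}

theorem preimage_graph_cases (W : (prod X (specOver Fq E)).Opens) :
    graph γ ⁻¹ᵁ W = ⊥ ∨ ⊤ ≤ graph γ ⁻¹ᵁ W := by
  by_cases h : ∃ s, graph γ s ∈ W
  · obtain ⟨s, hs⟩ := h
    exact .inr fun t _ => Subsingleton.elim s t ▸ hs
  · left
    ext t
    exact ⟨fun ht => h ⟨t, ht⟩, fun ht => ht.elim⟩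

theorem mem_basicOpen_iff (h : ⊤ ≤ graph γ ⁻¹ᵁ W) (s : (specOver Fq E).left)
    (a : Γ(prod X (specOver Fq E), W)) :
    graph γ s ∈ (prod X (specOver Fq E)).basicOpen a ↔ (graph γ).appLE W ⊤ h a ≠ 0 := by
  have h1 := Scheme.basicOpen_appLE (graph γ) ⊤ W h a
  have h2 : graph γ s ∈ (prod X (specOver Fq E)).basicOpen a ↔
      s ∈ (specOver Fq E).left.basicOpen ((graph γ).appLE W ⊤ h a) := by
    rw [h1, top_inf_eq]
    rfl
  rw [h2]
  constructor
  · intro hs h0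
    rw [h0, Scheme.basicOpen_zero] at hs
    exact hs
  · intro h0
    have hu : IsUnit ((graph γ).appLE W ⊤ h a) := by
      obtain ⟨b, hb⟩ := (isField_sections_spec (K := E)).mul_inv_cancel h0
      exact IsUnit.of_mul_eq_one b hb
    rw [Scheme.basicOpen_of_isUnit _ hu]
    trivial

theorem graph_appLE_snd (h : ⊤ ≤ graph γ ⁻¹ᵁ W) (c : Γ((specOver Fq E).left, ⊤)) :
    (graph γ).appLE W ⊤ h ((pullback.snd X.hom (specOver Fq E).hom).appLE ⊤ W le_top c) = c := by
  refine (appLE_appLE_apply (k := 𝟙 _) (pullback.lift_snd _ _ _) le_top h le_top c).trans ?_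
  exact ConcreteCategory.congr_hom ((specOver Fq E).left.presheaf.map_id (op ⊤)) c

theorem sub_mem_idealSections (h : ⊤ ≤ graph γ ⁻¹ᵁ W) (a : Γ(prod X (specOver Fq E), W)) :
    a - (pullback.snd X.hom (specOver Fq E).hom).appLE ⊤ W le_top
      ((graph γ).appLE W ⊤ h a) ∈ idealSections (graph γ) W := by
  rw [mem_idealSections_iff h, map_sub, graph_appLE_snd, sub_self]

/-- A prime that contains the ideal of the graph of `γ` is the prime of the point of the graph. -/
theorem fromSpec_eq_graph_of_idealSections_le (hW : IsAffineOpen W)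
    (y : PrimeSpectrum Γ(prod X (specOver Fq E), W))
    (hy : idealSections (graph γ) W ≤ y.asIdeal) (s : (specOver Fq E).left) :
    hW.fromSpec y = graph γ s := by
  rcases preimage_graph_cases (γ := γ) W with h | h
  · rw [idealSections_eq_top h] at hy
    exact absurd (top_le_iff.1 hy) y.2.ne_top
  · have hs : graph γ s ∈ W := h (x := s) trivial
    refine Eq.trans ?_ (hW.fromSpec_primeIdealOf ⟨_, hs⟩)
    refine congrArg _ (PrimeSpectrum.ext (Ideal.ext fun a => ?_))
    have h1 := fromSpec_mem_basicOpen_iff hW (hW.primeIdealOf ⟨_, hs⟩) a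
    rw [hW.fromSpec_primeIdealOf ⟨_, hs⟩, mem_basicOpen_iff h] at h1
    rw [← not_iff_not, ← h1]
    constructor
    · intro ha h0
      exact ha (hy ((mem_idealSections_iff h).2 h0))
    · intro h0 ha
      obtain ⟨b, hb⟩ := (isField_sections_spec (K := E)).mul_inv_cancel h0
      have h2 := y.asIdeal.sub_mem ha (hy (sub_mem_idealSections h a))
      rw [sub_sub_cancel] at h2
      refine y.2.ne_top (Ideal.eq_top_of_isUnit_mem _ h2 (IsUnit.map _ ?_))
      exact IsUnit.of_mul_eq_one b hb

/-- The graph of `γ` is not all of the curve `X ⊗ E`: otherwise the functions near it are constants,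
whereas the coordinate of an étale chart is not constant. -/
theorem idealSections_ne_bot [SmoothOfRelativeDimension 1 (pullback.snd X.hom (specOver Fq E).hom)]
    [IsIntegral (prod X (specOver Fq E))] (hW : IsAffineOpen W) [Nonempty W] :
    idealSections (graph γ) W ≠ ⊥ := by
  intro hI
  rcases preimage_graph_cases (γ := γ) W with h | h
  · rw [idealSections_eq_top h] at hI
    exact top_ne_bot hI
  obtain ⟨s⟩ := (inferInstance : Nonempty (specOver Fq E).left)
  have hs : graph γ s ∈ W := h (x := s) trivial
  obtain ⟨U, hU, hsU, g, hgC, hg⟩ := exists_etale_chart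
    (K := E) (pullback.snd X.hom (specOver Fq E).hom) (graph γ s)
  -- functions on `W` are constants, so `W` lies in the chart
  have hWU : W ≤ U := by
    obtain ⟨f, hf, hsf⟩ := hW.exists_basicOpen_le ⟨_, hsU⟩ hs
    have h1 := sub_mem_idealSections h f
    rw [hI, Ideal.mem_bot, sub_eq_zero] at h1
    have h2 : IsUnit f := by
      rw [h1]
      refine IsUnit.map _ ?_
      obtain ⟨b, hb⟩ := (isField_sections_spec (K := E)).mul_inv_cancel
        ((mem_basicOpen_iff h s f).1 hsf)
      exact IsUnit.of_mul_eq_one b hb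
    rwa [Scheme.basicOpen_of_isUnit _ h2] at hf
  have hU' : ⊤ ≤ graph γ ⁻¹ᵁ U := fun t ht => hWU (h ht)
  have : Nonempty U := ⟨⟨_, hsU⟩⟩
  let c : Γ((specOver Fq E).left, ⊤) := (graph γ).appLE U ⊤ hU' (g (MvPolynomial.X 0))
  have h3 := sub_mem_idealSections hU' (g (MvPolynomial.X 0))
  have h4 : g (MvPolynomial.C c) = (pullback.snd X.hom (specOver Fq E).hom).appLE ⊤ U le_top c :=
    DFunLike.congr_fun hgC c
  have h6 := map_X_sub_C_ne_zero (isField_sections_spec (K := E)) g hg c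
  rw [← h4, ← map_sub] at h3
  have h8 := map_mem_idealSections (graph γ) hWU h3
  rw [hI, Ideal.mem_bot] at h8
  refine h6 (map_injective_of_isIntegral _ (homOfLE hWU) ?_)
  rw [h8, map_zero]

end

section Instances
variable [SmoothOfRelativeDimension 1 X.hom]

instance smooth_snd : SmoothOfRelativeDimension 1 (pullback.snd X.hom (specOver Fq E).hom) :=
  have := smoothOfRelativeDimension_isStableUnderBaseChange 1
  MorphismProperty.of_isPullback (P := @SmoothOfRelativeDimension 1)
      (IsPullback.of_hasPullback X.hom (specOver Fq E).hom) ‹_›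

instance isIntegral_prod [GeometricallyConnected X.hom] :
    IsIntegral (prod X (specOver Fq E)) := by
  have : SmoothOfRelativeDimension 1 (pullback.snd X.hom (specOver Fq E).hom) := smooth_snd
  have : GeometricallyConnected (pullback.snd X.hom (specOver Fq E).hom) :=
    MorphismProperty.of_isPullback (P := @GeometricallyConnected)
      (IsPullback.of_hasPullback X.hom (specOver Fq E).hom) ‹_›
  have : ConnectedSpace (prod X (specOver Fq E)) :=
    GeometricallyConnected.connectedSpace_of_subsingleton
      (pullback.snd X.hom (specOver Fq E).hom)
  exact isIntegral_of_smooth (K := E) (pullback.snd X.hom (specOver Fq E).hom)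

theorem finiteType_sections {W : (prod X (specOver Fq E)).Opens} (hW : IsAffineOpen W) :
    Algebra.FiniteType E Γ(prod X (specOver Fq E), W) := by
  have : Smooth (pullback.snd X.hom (specOver Fq E).hom) := SmoothOfRelativeDimension.smooth 1 _
  have h := (pullback.snd X.hom (specOver Fq E).hom).finiteType_appLE (isAffineOpen_top _) hW le_top
  have h2 : (scalars W).FiniteType := h.comp (RingHom.FiniteType.of_surjective _
    (Scheme.ΓSpecIso (CommRingCat.of E)).symm.commRingCatIsoToRingEquiv.surjective)
  exact h2

end Instances

variable [Fintype Fq]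

/-- The primes of the functions on `W` whose points lie in the `Φ`-orbit of the graph of `γ`. -/
def orbitPrimes (γ : specOver Fq E ⟶ X) {W : (prod X (specOver Fq E)).Opens}
    (hW : IsAffineOpen W) : Set (Ideal Γ(prod X (specOver Fq E), W)) :=
  {p | ∃ hp : p.IsPrime, hW.fromSpec (⟨p, hp⟩ : PrimeSpectrum _) ∈ orbitPoints γ}

theorem stable_orbitPrimes [IsReduced (prod X (specOver Fq E))] {V : X.left.Opens}
    (hV : IsAffineOpen V) : (frobData hV).Stable (orbitPrimes γ (isAffineOpen_cyl E hV)) := by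
  intro p hp
  have h1 := IsAffineOpen.SpecMap_appLE_fromSpec (Phi X (specOver Fq E)) (isAffineOpen_cyl E hV)
    (isAffineOpen_cyl E hV) (Phi_preimage_cyl E V).ge
  have h2 : (isAffineOpen_cyl E hV).fromSpec
      (⟨p.comap (frobData hV).σ, hp.comap _⟩ : PrimeSpectrum _) =
      Phi X (specOver Fq E) ((isAffineOpen_cyl E hV).fromSpec (⟨p, hp⟩ : PrimeSpectrum _)) :=
    congrArg (fun k : Spec _ ⟶ prod X (specOver Fq E) => k (⟨p, hp⟩ : PrimeSpectrum _)) h1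
  constructor
  · rintro ⟨_, h⟩
    exact ⟨hp, Phi_mem_orbitPoints_iff.1 (h2 ▸ h)⟩
  · rintro ⟨_, h⟩
    exact ⟨hp.comap _, h2.symm ▸ Phi_mem_orbitPoints_iff.2 h⟩

theorem mem_orbitPrimes {W : (prod X (specOver Fq E)).Opens} (hW : IsAffineOpen W)
    (p : Ideal Γ(prod X (specOver Fq E), W)) (hp : p.IsPrime) (h : idealSections (graph γ) W ≤ p) :
    p ∈ orbitPrimes γ hW := by
  obtain ⟨s⟩ := (inferInstance : Nonempty (specOver Fq E).left)
  refine ⟨hp, ?_⟩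
  rw [fromSpec_eq_graph_of_idealSections_le hW ⟨p, hp⟩ h s]
  exact graph_mem_orbitPoints γ s

theorem notMem_orbitPrimes {α β : specOver Fq E ⟶ X} (hαβ : FrobDisjoint α β)
    {W : (prod X (specOver Fq E)).Opens} (hW : IsAffineOpen W)
    (p : Ideal Γ(prod X (specOver Fq E), W)) (hp : p.IsPrime) (h : idealSections (graph β) W ≤ p) :
    p ∉ orbitPrimes α hW := by
  obtain ⟨s⟩ := (inferInstance : Nonempty (specOver Fq E).left)
  rintro ⟨_, h'⟩
  rw [fromSpec_eq_graph_of_idealSections_le hW ⟨p, hp⟩ h s] at h'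
  exact graph_notMem_orbitPoints hαβ s h'

end Graph

noncomputable section

/-! ### Locally free sheaves on regular curves -/

attribute [local instance] RingHomInvPair.of_ringEquiv in
/-- A finitely generated flat module over a noetherian ring is free near each prime. -/
theorem exists_free_of_flat {R M : Type*} [CommRing R] [IsNoetherianRing R] [AddCommGroup M]
    [Module R M] [Module.Finite R M] [Module.Flat R M] (p : Ideal R) [p.IsPrime] :
    ∃ r ∉ p, ∀ (R' M' : Type u) [CommRing R'] [Algebra R R'] [IsLocalization.Away r R']
      [AddCommGroup M'] [Module R M'] [Module R' M'] [IsScalarTower R R' M'] (f : M →ₗ[R] M')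
      [IsLocalizedModule (.powers r) f], Module.Free R' M' := by
  have : Module.FinitePresentation R M := Module.finitePresentation_of_finite R M
  have : Module.Free (Localization.AtPrime p) (LocalizedModule p.primeCompl M) :=
    Module.free_of_flat_of_isLocalRing
  obtain ⟨r, hr, h, -⟩ := Module.FinitePresentation.exists_free_localizedModule_powers
    p.primeCompl (LocalizedModule.mkLinearMap p.primeCompl M) (Localization.AtPrime p)
  refine ⟨r, hr, ?_⟩
  intro R' M' _ _ _ _ _ _ _ f _
  set e := (IsLocalization.algEquiv (.powers r) (Localization (.powers r)) R').toRingEquiv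
  refine (Module.Free.iff_of_equiv (σ := e) ?_).1 h
  refine { __ := IsLocalizedModule.iso (.powers r) f, map_smul' := ?_ }
  intro a x
  obtain ⟨a, s, rfl⟩ := IsLocalization.exists_mk'_eq (.powers r) a
  apply ((Module.End.isUnit_iff _).mp (IsLocalizedModule.map_units f s)).1
  simp [e, ← map_smul, ← smul_assoc]

section
variable {Z : Scheme.{u}} {M : Z.Modules} {U V W : Z.Opens}

/-- Restriction of scalars along the restriction of functions. -/
abbrev moduleRes (M : Z.Modules) (h : V ≤ W) : Module Γ(Z, W) Γ(M, V) :=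
  Module.compHom _ (rres h)

/-- Restriction of sections as a linear map. -/
def resLin (M : Z.Modules) (h : V ≤ W) :
    letI := moduleRes M h
    Γ(M, W) →ₗ[Γ(Z, W)] Γ(M, V) :=
  letI := moduleRes M h
  { toFun := res M h, map_add' := map_add _, map_smul' := res_smul h }

theorem Localizes.isLocalizedModule (hM : Localizes M W) (f : Γ(Z, W)) :
    letI := moduleRes M (Z.basicOpen_le f)
    IsLocalizedModule (.powers f) (resLin M (Z.basicOpen_le f)) := by
  let := moduleRes M (Z.basicOpen_le f)
  refine ⟨?_, ?_, ?_⟩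
  · rintro ⟨_, n, rfl⟩
    have h := (isUnit_rres_basicOpen (f := f) le_rfl).pow n
    rw [← map_pow] at h
    exact (Module.End.isUnit_iff _).2
      ⟨fun x y hxy => h.smul_left_cancel.1 hxy, fun y => by
        obtain ⟨v, hv⟩ := h
        refine ⟨(v⁻¹ : Γ(Z, Z.basicOpen f)ˣ).1 • y, ?_⟩
        change rres (Z.basicOpen_le f) (f ^ n) • ((v⁻¹ : Γ(Z, Z.basicOpen f)ˣ).1 • y) = y
        rw [← hv]
        exact smul_inv_smul v y⟩
  · intro s
    obtain ⟨n, t, ht⟩ := hM.exists_res_eq f s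
    refine ⟨⟨t, ⟨f ^ n, n, rfl⟩⟩, ?_⟩
    rw [← map_pow] at ht
    exact ht.symm
  · intro x y hxy
    obtain ⟨n, hn⟩ := hM.exists_pow_smul_eq_zero f (x - y) (by
      rw [map_sub, sub_eq_zero]; exact hxy)
    refine ⟨⟨f ^ n, n, rfl⟩, ?_⟩
    rw [smul_sub, sub_eq_zero] at hn
    exact hn

/-- On a regular scheme of dimension one, a quasi-coherent sheaf with finitely generated
torsion-free modules of sections is locally free. -/
theorem isLocallyFree_of_isTorsionFree (hM : IsQuasicoherent M)
    (hZ : ∀ W : Z.Opens, IsAffineOpen W → Nonempty W → IsDedekindDomain Γ(Z, W))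
    (hfin : ∀ W : Z.Opens, IsAffineOpen W → Module.Finite Γ(Z, W) Γ(M, W))
    (htf : ∀ W : Z.Opens, IsAffineOpen W → ∀ (c : Γ(Z, W)) (x : Γ(M, W)),
      c • x = 0 → c = 0 ∨ x = 0) :
    IsLocallyFree M := by
  refine isLocallyFree_of_linearEquiv M hM fun z => ?_
  obtain ⟨W, -, hW, hz⟩ := exists_affine_le (U := (⊤ : Z.Opens)) (z := z) trivial
  have := hZ W hW ⟨⟨z, hz⟩⟩
  have := hfin W hW
  have : Module.IsTorsionFree Γ(Z, W) Γ(M, W) := .of_smul_eq_zero (htf W hW)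
  obtain ⟨r, hr, h⟩ := exists_free_of_flat (M := Γ(M, W)) (hW.primeIdealOf ⟨z, hz⟩).asIdeal
  refine ⟨Z.basicOpen r, hW.basicOpen r, ?_, ?_⟩
  · have := fromSpec_mem_basicOpen_iff hW (hW.primeIdealOf ⟨z, hz⟩) r
    rw [hW.fromSpec_primeIdealOf ⟨z, hz⟩] at this
    exact this.2 hr
  · have := hW.isLocalization_basicOpen r
    let := moduleRes M (Z.basicOpen_le r)
    have : IsScalarTower Γ(Z, W) Γ(Z, Z.basicOpen r) Γ(M, Z.basicOpen r) :=
      ⟨fun a b x => mul_smul (rres (Z.basicOpen_le r) a) b x⟩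
    have := (localizes M hM W hW).isLocalizedModule r
    have := h Γ(Z, Z.basicOpen r) Γ(M, Z.basicOpen r) (resLin M (Z.basicOpen_le r))
    exact ⟨_, ⟨(Module.Free.chooseBasis Γ(Z, Z.basicOpen r) Γ(M, Z.basicOpen r)).repr.symm⟩⟩

theorem finite_sections {d : ℕ} (hM : IsLocallyFreeOfRank M d) (hW : IsAffineOpen W) :
    Module.Finite Γ(Z, W) Γ(M, W) := by
  have hqc := isQuasicoherent_of_isLocallyFree M (isLocallyFree_of_rank M hM)
  let t : Set Γ(Z, W) := {f | Module.Finite Γ(Z, Z.basicOpen f) Γ(M, Z.basicOpen f)}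
  have ht : Ideal.span t = ⊤ := by
    rw [← hW.self_le_iSup_basicOpen_iff]
    intro z hz
    obtain ⟨U, hzU, hU⟩ := exists_linearEquiv_of_isLocallyFreeOfRank M hM z
    obtain ⟨f, hf, hzf⟩ := hW.exists_basicOpen_le ⟨z, hzU⟩ hz
    obtain ⟨e⟩ := hU _ (hW.basicOpen f) hf
    exact TopologicalSpace.Opens.mem_iSup.2 ⟨⟨f, Module.Finite.equiv e⟩, hzf⟩
  obtain ⟨s, hs, hs'⟩ := (Ideal.span_eq_top_iff_finite t).1 ht
  have (g : s) := hW.isLocalization_basicOpen g.1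
  let (g : s) := moduleRes M (Z.basicOpen_le g.1)
  have (g : s) : IsScalarTower Γ(Z, W) Γ(Z, Z.basicOpen g.1) Γ(M, Z.basicOpen g.1) :=
      ⟨fun a b x => mul_smul (rres (Z.basicOpen_le g.1) a) b x⟩
  have (g : s) := (localizes M hqc W hW).isLocalizedModule g.1
  exact Module.Finite.of_localizationSpan_finite' s hs' (Rₚ := fun g => Γ(Z, Z.basicOpen g.1))
    (fun g => resLin M (Z.basicOpen_le g.1)) fun g => hs g.2

/-- A locally free sheaf on an integral scheme is torsion-free. -/
theorem eq_zero_of_smul_eq_zero [IsIntegral Z] (hM : IsLocallyFree M) {c : Γ(Z, W)} (hc : c ≠ 0)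
    {x : Γ(M, W)} (hx : c • x = 0) : x = 0 := by
  refine eq_zero_of_locally fun z hz => ?_
  obtain ⟨U, hzU, hU⟩ := exists_linearEquiv_of_isLocallyFree M hM z
  obtain ⟨V, hVU, hV, hzV⟩ := exists_affine_le (U := U ⊓ W) ⟨hzU, hz⟩
  refine ⟨V, hVU.trans inf_le_right, hzV, ?_⟩
  obtain ⟨I, ⟨e⟩⟩ := hU V hV (hVU.trans inf_le_left)
  have : Nonempty V := ⟨⟨z, hzV⟩⟩
  have h1 : rres (hVU.trans inf_le_right) c ≠ 0 := fun h => hc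
    (map_injective_of_isIntegral _ (homOfLE (hVU.trans inf_le_right))
      (h.trans (map_zero (rres (hVU.trans inf_le_right))).symm))
  have h2 := congrArg (res M (hVU.trans inf_le_right)) hx
  rw [res_smul, map_zero] at h2
  have h3 := congrArg e.symm h2
  rw [map_smul, map_zero] at h3
  exact e.symm.injective (((smul_eq_zero.1 h3).resolve_left h1).trans (map_zero _).symm)

end

end

noncomputable section

/-! ### The pullback along `Φ` on sections -/

open scoped TensorProduct in
/-- If `F'` has the universal property of the base change of `F` along `σ`, and `b` is a basis of
`B` over `A`, then the decomposition along `b` of an element of `F'` is unique. -/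
theorem injective_sum_of_universal {A B : Type u} [CommRing A] [CommRing B] (σ : A →+* B)
    {ι : Type u} (b : ι → B) (hb : Function.Bijective fun x : ι →₀ A => x.sum fun i a => b i * σ a)
    {F F' : Type u} [AddCommGroup F] [Module A F] [AddCommGroup F'] [Module B F']
    (l : F →ₛₗ[σ] F') (hl : ∀ (Q : Type u) [AddCommGroup Q] [Module B Q] (m : F →ₛₗ[σ] Q),
      ∃ t : F' →ₗ[B] Q, ∀ x, t (l x) = m x) :
    Function.Injective fun y : ι →₀ F => y.sum fun i m => b i • l m := by
  let := σ.toAlgebra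
  let e : (ι →₀ A) →ₗ[A] B := Finsupp.linearCombination A b
  have he : (fun x : ι →₀ A => x.sum fun i a => b i * σ a) = e := by
    funext x
    rw [Finsupp.linearCombination_apply]
    exact Finsupp.sum_congr fun i _ => by rw [Algebra.smul_def, mul_comm]; rfl
  rw [he] at hb
  let 𝓑 : Module.Basis ι A B := .ofRepr (LinearEquiv.ofBijective e hb).symm
  have h𝓑 (i : ι) : 𝓑 i = b i := (Finsupp.linearCombination_single A 1 i).trans (one_smul _ _)
  let m : F →ₛₗ[σ] B ⊗[A] F :=
    { toFun x := 1 ⊗ₜ x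
      map_add' x y := TensorProduct.tmul_add _ _ _
      map_smul' a x := by
        rw [TensorProduct.tmul_smul]
        exact (algebraMap_smul B a _).symm }
  obtain ⟨t, ht⟩ := hl (B ⊗[A] F) m
  refine Function.Injective.of_comp (f := t) ?_
  convert TensorProduct.sum_tmul_basis_left_injective (N := F) 𝓑 using 1
  funext y
  simp only [Function.comp_apply, Finsupp.sum, map_sum, map_smul, ht, Finsupp.lsum_apply,
    TensorProduct.mk_apply, h𝓑]
  refine Finset.sum_congr rfl fun i _ => ?_
  change b i • ((1 : B) ⊗ₜ[A] y i) = _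
  rw [TensorProduct.smul_tmul', smul_eq_mul, mul_one]

section
variable {Z : Scheme.{u}} (f : Z ⟶ Z) {W : Z.Opens}

/-- The canonical map from sections of `M` over `W` to sections of the pullback of `M` over `W`,
for an open `W` with `f W ⊆ W`. -/
def unitSections (M : Z.Modules) (h : W ≤ f ⁻¹ᵁ W) :
    Γ(M, W) →ₛₗ[(f.appLE W W h).hom] Γ((Scheme.Modules.pullback f).obj M, W) where
  toFun x := res _ h (pullbackSections f M W x)
  map_add' x y := by rw [map_add, map_add]
  map_smul' r x := by
    rw [map_smulₛₗ, res_smul]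
    rfl

variable {f}

theorem pullback_map_app_unitSections {M N : Z.Modules} (φ : M ⟶ N) (h : W ≤ f ⁻¹ᵁ W)
    (x : Γ(M, W)) : ((Scheme.Modules.pullback f).map φ).app W (unitSections f M h x) =
      unitSections f N h (φ.app W x) := by
  refine (app_res _ h _).trans ?_
  rw [pullback_map_app_pullbackSections]
  rfl

theorem exists_app_eq_unitSections {M : Z.Modules} (hW : f ⁻¹ᵁ W = W)
    (y : Γ((Scheme.Modules.pullback f).obj M, W)) :
    ∃ y' : Γ((Scheme.Modules.pullback f).obj M, f ⁻¹ᵁ W), res _ hW.ge y' = y :=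
  ⟨res _ hW.le y, by rw [res_res, res_rfl]⟩

theorem span_unitSections {M : Z.Modules} (hWa : IsAffineOpen W) (hW : f ⁻¹ᵁ W = W)
    (hM : IsQuasicoherent M) (hM' : IsQuasicoherent ((Scheme.Modules.pullback f).obj M)) :
    Submodule.span Γ(Z, W) (Set.range (unitSections f M hW.ge)) = ⊤ := by
  have h := span_pullbackSections (f := f) hWa (hW.symm ▸ hWa) hM hM'
  rw [eq_top_iff]
  rintro y -
  obtain ⟨y, rfl⟩ := exists_app_eq_unitSections hW y
  have hy : y ∈ Submodule.span Γ(Z, f ⁻¹ᵁ W) (Set.range (pullbackSections f M W)) := h ▸ trivial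
  induction hy using Submodule.span_induction with
  | mem y hy => obtain ⟨x, rfl⟩ := hy; exact Submodule.subset_span ⟨x, rfl⟩
  | zero => rw [map_zero]; exact zero_mem _
  | add x y _ _ hx hy => rw [map_add]; exact add_mem hx hy
  | smul a x _ hx => rw [res_smul]; exact Submodule.smul_mem _ _ hx

/-- The universal property of the sections of a pullback as a base change. -/
theorem exists_map_of_unitSections {M : Z.Modules} (hWa : IsAffineOpen W) (hW : f ⁻¹ᵁ W = W)
    (hM : IsQuasicoherent M) (Q : Type u) [AddCommGroup Q] [Module Γ(Z, W) Q]
    (l : Γ(M, W) →ₛₗ[(f.appLE W W hW.ge).hom] Q) :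
    ∃ t : Γ((Scheme.Modules.pullback f).obj M, W) →ₗ[Γ(Z, W)] Q,
      ∀ x, t (unitSections f M hW.ge x) = l x := by
  let : Module Γ(Z, f ⁻¹ᵁ W) Q := Module.compHom Q (rres hW.ge)
  let l' : Γ(M, W) →ₛₗ[(f.app W).hom] Q :=
    { toFun := l, map_add' := map_add l, map_smul' := map_smulₛₗ l }
  obtain ⟨t, ht⟩ := exists_map_of_pullbackSections (f := f) hWa (hW.symm ▸ hWa) hM Q l'
  refine ⟨{ toFun y := t (res _ hW.le y), map_add' x y := by rw [map_add, map_add],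
            map_smul' a x := ?_ }, fun x => ?_⟩
  · rw [res_smul, map_smul]
    change rres hW.ge (rres hW.le a) • t (res _ hW.le x) = a • t (res _ hW.le x)
    rw [rres_rres, rres_rfl]
  · change t (res _ hW.le (res _ hW.ge _)) = _
    rw [res_res, res_rfl, ht]
    rfl

end

variable {Fq : Type u} [Field Fq] [Fintype Fq] {X : Over (Spec (CommRingCat.of Fq))}
  {E : Type u} [Field E] [Algebra Fq E]

theorem isQuasicoherent_pullback_Phi {M : (prod X (specOver Fq E)).Modules}
    (hM : IsQuasicoherent M) :
    IsQuasicoherent ((Scheme.Modules.pullback (Phi X (specOver Fq E))).obj M) := by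
  refine isQuasicoherent_pullback _ (covers_cylinders E) (isAffineOpen_of_mem_cylinders E) ?_ hM
  rintro _ ⟨V, hV, rfl⟩
  rw [Phi_preimage_cyl]
  exact isAffineOpen_cyl E hV

variable [IsReduced (prod X (specOver Fq E))] {V : X.left.Opens} (hV : IsAffineOpen V)

/-- The canonical map from sections of `M` over `V ⊗ E` to sections of `Φ^* M`. -/
def frobUnit (M : (prod X (specOver Fq E)).Modules) : Γ(M, cyl X E V) →ₛₗ[(frobData (E := E) hV).σ]
    Γ((Scheme.Modules.pullback (Phi X (specOver Fq E))).obj M, cyl X E V) :=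
  unitSections (Phi X (specOver Fq E)) M (Phi_preimage_cyl E V).ge

theorem frobUnit_natural {M N : (prod X (specOver Fq E)).Modules} (φ : M ⟶ N)
    (x : Γ(M, cyl X E V)) :
    ((Scheme.Modules.pullback (Phi X (specOver Fq E))).map φ).app (cyl X E V)
      (frobUnit hV M x) = frobUnit hV N (φ.app _ x) :=
  pullback_map_app_unitSections φ _ x

theorem frobSpan_frobUnit_top {M : (prod X (specOver Fq E)).Modules} (hM : IsQuasicoherent M) :
    (frobData hV).frobSpan (frobUnit hV M) ⊤ = ⊤ := by
  rw [FrobData.frobSpan, Submodule.top_coe, Set.image_univ]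
  exact span_unitSections (isAffineOpen_cyl E hV) (Phi_preimage_cyl E V) hM
    (isQuasicoherent_pullback_Phi hM)

/-- The sections of `Φ^* M` over `V ⊗ E` are the base change of the sections of `M`: in terms of the
basis, each of them is a unique sum `∑ b i • Φ^* (m i)`. -/
theorem bijective_twistSum_frobUnit {M : (prod X (specOver Fq E)).Modules}
    (hM : IsQuasicoherent M) :
    Function.Bijective ((frobData (E := E) hV).twistSum (frobUnit hV M).toAddMonoidHom) := by
  constructor
  · exact injective_sum_of_universal _ _ (frobData hV).bijA (frobUnit hV M) fun Q _ _ m =>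
      exists_map_of_unitSections (isAffineOpen_cyl E hV) (Phi_preimage_cyl E V) hM Q m
  · intro y
    have hy : y ∈ (frobData hV).frobSpan (frobUnit hV M) ⊤ :=
      frobSpan_frobUnit_top hV hM ▸ Submodule.mem_top
    obtain ⟨x, -, hx⟩ := (frobData hV).mem_frobSpan_iff.1 hy
    exact ⟨x, hx⟩

end

noncomputable section

/-! ### Shtukas on sections -/

section Images

variable {C : Type*} [Category* C] [Abelian C] {A B P : C}

theorem exists_epi_of_imageSubobject_eq {q : A ⟶ P} {m : B ⟶ P} [Mono m]
    (h : imageSubobject q = imageSubobject m) : ∃ h : A ⟶ B, Epi h ∧ h ≫ m = q := by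
  rw [imageSubobject_mono m] at h
  refine ⟨factorThruImageSubobject q ≫ Subobject.ofLE _ _ h.le ≫
    (Subobject.underlyingIso m).hom, ?_, ?_⟩
  · have : IsIso (Subobject.ofLE _ _ h.le) :=
      ⟨Subobject.ofLE _ _ h.ge, by simp, by simp⟩
    infer_instance
  · simp

theorem imageSubobject_eq_of_epi {q : A ⟶ P} {m : B ⟶ P} [Mono m] (h : A ⟶ B) [Epi h]
    (hq : h ≫ m = q) : imageSubobject q = imageSubobject m := by
  subst hq
  refine le_antisymm (imageSubobject_comp_le h m) ?_
  have : IsIso (Subobject.ofLE _ _ (imageSubobject_comp_le h m)) := isIso_of_mono_of_epi _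
  exact Subobject.le_of_comm (inv (Subobject.ofLE _ _ (imageSubobject_comp_le h m))) (by simp)

theorem imageSubobject_le_iff {q : A ⟶ P} {m : B ⟶ P} [Mono m] :
    imageSubobject q ≤ imageSubobject m ↔ ∃ h : A ⟶ B, h ≫ m = q := by
  constructor
  · intro h
    rw [imageSubobject_mono m] at h
    exact ⟨factorThruImageSubobject q ≫ Subobject.ofLE _ _ h ≫ (Subobject.underlyingIso m).hom,
      by simp⟩
  · rintro ⟨h, rfl⟩
    exact imageSubobject_comp_le h m

end Images

section Twist

variable {T Z : Scheme.{u}} (γ : T ⟶ Z) {M N : Z.Modules} {U : Z.Opens}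

/-- The morphism from `N` to the twist of `M` is injective when `N` is torsion-free and the ideal
of `γ` does not vanish. -/
theorem mono_colonHom [IsIntegral Z] (φ : M ⟶ N) [Mono φ]
    (hφ : ∀ (U : Z.Opens) (a : idealSections γ U) (n : Γ(N, U)),
      ∃ m : Γ(M, U), φ.app U m = a.1 • n) (hN : IsLocallyFree N)
    (hγ : ∀ W : Z.Opens, IsAffineOpen W → Nonempty W → idealSections γ W ≠ ⊥) :
    Mono (colonHom γ φ hφ) := by
  refine mono_of_app_injective _ fun U => (injective_iff_map_eq_zero
    ((colonHom γ φ hφ).app U).hom).2 fun n hn => eq_zero_of_locally fun z hz => ?_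
  obtain ⟨V, hVU, hV, hzV⟩ := exists_affine_le hz
  refine ⟨V, hVU, hzV, ?_⟩
  obtain ⟨a, ha, ha0⟩ := Submodule.exists_mem_ne_zero_of_ne_bot (hγ V hV ⟨⟨z, hzV⟩⟩)
  have h1 : colonSections γ φ hφ U n = 0 := hn
  have h2 : colonLin γ φ hφ V (res N hVU n) ⟨a, ha⟩ = 0 :=
    congrArg (fun s : TwistSections γ M U => s.toLin V hVU ⟨a, ha⟩) h1
  refine eq_zero_of_smul_eq_zero hN ha0 ?_
  have h3 := app_colonLin γ φ hφ V (res N hVU n) ⟨a, ha⟩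
  rw [h2, map_zero] at h3
  exact h3.symm

theorem mono_toTwist [IsIntegral Z] (hN : IsLocallyFree N)
    (hγ : ∀ W : Z.Opens, IsAffineOpen W → Nonempty W → idealSections γ W ≠ ⊥) :
    Mono (toTwist γ N) := mono_colonHom γ _ _ hN hγ

theorem comp_colonHom (φ : M ⟶ N) [Mono φ]
    (hφ : ∀ (U : Z.Opens) (a : idealSections γ U) (n : Γ(N, U)),
      ∃ m : Γ(M, U), φ.app U m = a.1 • n) : φ ≫ colonHom γ φ hφ = toTwist γ M := by
  refine Scheme.Modules.hom_ext _ _ fun U => ?_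
  ext m
  refine TwistSections.ext ?_
  funext V hV
  refine LinearMap.ext fun a => app_injective φ V ?_
  refine (app_colonLin γ φ hφ V (res N hV (φ.app U m)) a).trans ?_
  rw [← app_res, ← Scheme.Modules.Hom.app_smul]
  exact congrArg _ (app_colonLin γ (𝟙 M) _ V (res M hV m) a).symm

end Twist

namespace FrobData

variable {E A : Type u} [Field E] [CommRing A] [Algebra E A] (D : FrobData E A)
  {F W W' : Type*} [AddCommGroup F] [Module A F]
  [AddCommGroup W] [Module A W] [Module E W] [IsScalarTower E A W]
  [AddCommGroup W'] [Module A W'] [Module E W'] [IsScalarTower E A W']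

theorem twistSum_comp (l : W →ₗ[A] W') (φ : F →ₛₗ[D.σ] W) (y : D.ι →₀ F) :
    D.twistSum (l.comp φ).toAddMonoidHom y = l (D.twistSum φ.toAddMonoidHom y) := by
  rw [twistSum_apply, twistSum_apply, Finsupp.sum, Finsupp.sum, map_sum]
  refine Finset.sum_congr rfl fun i _ => ?_
  rw [LinearMap.map_smul_of_tower]
  rfl

theorem frobSpan_comp (l : W →ₗ[A] W') (φ : F →ₛₗ[D.σ] W) (Y : Submodule A F) :
    D.frobSpan (l.comp φ) Y = (D.frobSpan φ Y).map l := by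
  rw [frobSpan, frobSpan, Submodule.map_span, ← Set.image_comp]
  rfl

end FrobData

variable {Fq : Type u} [Field Fq] [Fintype Fq] {X : Over (Spec (CommRingCat.of Fq))}
  {E : Type u} [Field E] [Algebra Fq E] [SmoothOfRelativeDimension 1 X.hom]
  [GeometricallyConnected X.hom] {V : X.left.Opens}

theorem isDedekindDomain_prod {W : (prod X (specOver Fq E)).Opens} (hW : IsAffineOpen W)
    (h : Nonempty W) : IsDedekindDomain Γ(prod X (specOver Fq E), W) :=
  isDedekindDomain_sections (K := E) (pullback.snd X.hom (specOver Fq E).hom) hW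

namespace Shtuka

variable {α β : specOver Fq E ⟶ X} {d : ℕ} (𝓕 : Shtuka α β d) (hV : IsAffineOpen V)

/-- The semilinear map `F → F'` on sections over `V ⊗ E`. -/
def frobLin : Γ(𝓕.F, cyl X E V) →ₛₗ[(frobData (E := E) hV).σ] Γ(𝓕.F', cyl X E V) :=
  (appLin 𝓕.f (cyl X E V)).comp (frobUnit hV 𝓕.F)

theorem isQuasicoherent : IsQuasicoherent 𝓕.F :=
  isQuasicoherent_of_isLocallyFree _ (isLocallyFree_of_rank _ 𝓕.locallyFree)

theorem injective_twistSum_frobLin :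
    Function.Injective ((frobData (E := E) hV).twistSum (𝓕.frobLin hV).toAddMonoidHom) := by
  have := 𝓕.mono_f
  intro x y hxy
  rw [frobLin, FrobData.twistSum_comp, FrobData.twistSum_comp] at hxy
  exact (bijective_twistSum_frobUnit hV 𝓕.isQuasicoherent).1 (app_injective 𝓕.f _ hxy)

theorem injective_appLin_g (W : (prod X (specOver Fq E)).Opens) :
    Function.Injective (appLin 𝓕.g W) :=
  have := 𝓕.mono_g
  app_injective 𝓕.g W

theorem frobSpan_frobLin_top :
    (frobData (E := E) hV).frobSpan (𝓕.frobLin hV) ⊤ = LinearMap.range (appLin 𝓕.f _) := by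
  rw [frobLin, FrobData.frobSpan_comp, frobSpan_frobUnit_top hV 𝓕.isQuasicoherent,
    Submodule.map_top]

/-- The cokernel of `f` is killed by the ideal of the graph of `α`. -/
theorem smul_mem_frobSpan_top {a : Γ(prod X (specOver Fq E), cyl X E V)}
    (ha : a ∈ idealSections (graph α) (cyl X E V)) (w : Γ(𝓕.F', cyl X E V)) :
    a • w ∈ (frobData (E := E) hV).frobSpan (𝓕.frobLin hV) ⊤ := by
  have := 𝓕.mono_f
  obtain ⟨L, -, ⟨e⟩⟩ := 𝓕.cokernel_f
  rw [frobSpan_frobLin_top]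
  exact exists_app_eq_smul (graph α) 𝓕.f L e _ ⟨a, ha⟩ w

theorem smul_mem_range_g {W : (prod X (specOver Fq E)).Opens} {a : Γ(prod X (specOver Fq E), W)}
    (ha : a ∈ idealSections (graph β) W) (w : Γ(𝓕.F', W)) :
    a • w ∈ LinearMap.range (appLin 𝓕.g W) := 𝓕.exists_g_eq_smul W ⟨a, ha⟩ w

/-- The linear extension of `φ` sends the base change of the sections of `G` to the sections of the
image of `Φ^* G`. -/
theorem frobSpan_sections {G : Subobject 𝓕.F}
    (hG : IsQuasicoherent (G : (prod X (specOver Fq E)).Modules)) :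
    (frobData (E := E) hV).frobSpan (𝓕.frobLin hV) (sections G _) =
      LinearMap.range (appLin ((Scheme.Modules.pullback (Phi X (specOver Fq E))).map G.arrow ≫ 𝓕.f)
        (cyl X E V)) := by
  have h1 : (𝓕.frobLin hV).comp (appLin G.arrow (cyl X E V)) =
      (appLin ((Scheme.Modules.pullback (Phi X (specOver Fq E))).map G.arrow ≫ 𝓕.f)
        (cyl X E V)).comp (frobUnit hV (G : (prod X (specOver Fq E)).Modules)) := by
    ext x
    exact congrArg (𝓕.f.app _) (frobUnit_natural hV G.arrow x).symm
  have h2 := (frobData (E := E) hV).frobSpan_comp (appLin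
    ((Scheme.Modules.pullback (Phi X (specOver Fq E))).map G.arrow ≫ 𝓕.f) (cyl X E V))
    (frobUnit hV (G : (prod X (specOver Fq E)).Modules)) ⊤
  rw [frobSpan_frobUnit_top hV hG, Submodule.map_top] at h2
  rw [← h2, ← h1, FrobData.frobSpan, FrobData.frobSpan]
  congr 1
  rw [Submodule.top_coe, Set.image_univ]
  change _ = Set.range (𝓕.frobLin hV ∘ appLin G.arrow (cyl X E V))
  rw [Set.range_comp]
  rfl

instance mono_toPole : Mono 𝓕.toPole :=
  have := 𝓕.mono_g
  mono_colonHom _ _ _ (isLocallyFree_of_rank _ 𝓕.locallyFree')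
    fun _ hW _ => idealSections_ne_bot hW

theorem g_toPole : 𝓕.g ≫ 𝓕.toPole = toTwist (graph β) 𝓕.F :=
  have := 𝓕.mono_g
  comp_colonHom _ _ _

/-- Membership in the second poset on sections over the cylinders. -/
theorem isTrivialSub_iff {G : Subobject 𝓕.F} : 𝓕.IsTrivialSub G ↔
    IsQuasicoherent (G : (prod X (specOver Fq E)).Modules) ∧
      ∀ (V : X.left.Opens) (hV : IsAffineOpen V),
        (frobData (E := E) hV).frobSpan (𝓕.frobLin hV) (sections G _) =
          (sections G _).map (appLin 𝓕.g _) := by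
  have := 𝓕.mono_g
  have : Mono (toTwist (graph β) 𝓕.F) := 𝓕.g_toPole ▸ mono_comp _ _
  have hm (W) : LinearMap.range (appLin (G.arrow ≫ 𝓕.g) W) = (sections G W).map (appLin 𝓕.g W) :=
    LinearMap.range_comp (appLin G.arrow W) (appLin 𝓕.g W)
  have e1 : (Scheme.Modules.pullback (Phi X (specOver Fq E))).map G.arrow ≫ 𝓕.phi =
    ((Scheme.Modules.pullback (Phi X (specOver Fq E))).map G.arrow ≫ 𝓕.f) ≫ 𝓕.toPole :=
      (Category.assoc _ _ _).symm
  have e2 : G.arrow ≫ toTwist (graph β) 𝓕.F = (G.arrow ≫ 𝓕.g) ≫ 𝓕.toPole := by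
    rw [Category.assoc, g_toPole]
  constructor
  · rintro ⟨hG, h⟩
    refine ⟨hG, fun V hV => ?_⟩
    rw [frobSpan_sections 𝓕 hV hG, ← hm]
    obtain ⟨k, hk, hk'⟩ := exists_epi_of_imageSubobject_eq h
    rw [e1, e2, ← Category.assoc, cancel_mono] at hk'
    have hs := app_surjective_of_epi (isAffineOpen_cyl E hV) (isQuasicoherent_pullback_Phi hG) hG k
    rw [← hk']
    refine le_antisymm ?_ ?_
    · rintro _ ⟨x, rfl⟩
      exact ⟨k.app _ x, rfl⟩
    · rintro _ ⟨y, rfl⟩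
      obtain ⟨x, rfl⟩ := hs y
      exact ⟨x, rfl⟩
  · rintro ⟨hG, h⟩
    refine ⟨hG, ?_⟩
    have h' (V : X.left.Opens) (hV : IsAffineOpen V) := (𝓕.frobSpan_sections hV hG).symm.trans
      ((h V hV).trans (hm _).symm)
    obtain ⟨k, hk⟩ := exists_factor_of_app (covers_cylinders E) (isAffineOpen_of_mem_cylinders E)
      (fun W hW => localizes _ (isQuasicoherent_pullback_Phi hG) W
        (isAffineOpen_of_mem_cylinders E W hW))
      ((Scheme.Modules.pullback (Phi X (specOver Fq E))).map G.arrow ≫ 𝓕.f) (G.arrow ≫ 𝓕.g) (by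
        rintro _ ⟨V, hV, rfl⟩ x
        exact (h' V hV).le ⟨x, rfl⟩)
    have : Epi k := epi_of_app_surjective (covers_cylinders E) (isAffineOpen_of_mem_cylinders E)
      (fun W hW => localizes _ hG W (isAffineOpen_of_mem_cylinders E W hW)) k (by
        rintro _ ⟨V, hV, rfl⟩ y
        obtain ⟨x, hx⟩ := (h' V hV).ge ⟨y, rfl⟩
        refine ⟨x, app_injective (G.arrow ≫ 𝓕.g) _ ?_⟩
        rw [← comp_app_apply, hk]
        exact hx)
    exact imageSubobject_eq_of_epi k (by rw [e1, e2, ← Category.assoc, hk])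

end Shtuka

end

noncomputable section

/-! ### Sums and saturations of subsheaves -/

section
variable {Z : Scheme.{u}} {M : Z.Modules} {W : Z.Opens}

/-- The sum of a family of quasi-coherent subsheaves. -/
def sumSections (hM : IsQuasicoherent M) (S : Set (Subobject M))
    (hS : ∀ G ∈ S, IsQuasicoherent (G : Z.Modules)) : AffineSubmodules M where
  obj W := ⨆ G : S, sections G.1 W
  res_mem {V W} _ _ h x hx := by
    refine Submodule.iSup_induction (fun G : S => sections G.1 W)
      (motive := fun x => res M h x ∈ ⨆ G : S, sections G.1 V) hx ?_ ?_ ?_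
    · exact fun G x hx => le_iSup (fun G : S => sections G.1 V) G (res_mem_sections h hx)
    · rw [map_zero]; exact zero_mem _
    · intro x y hx hy; rw [map_add]; exact add_mem hx hy
  exists_pow_smul_mem {W} hW f x hx := by
    have key : ∃ (n : ℕ), ∃ t ∈ ⨆ G : S, sections G.1 W,
        res M (Z.basicOpen_le f) t =
          rres (Z.basicOpen_le f) f ^ n • res M (Z.basicOpen_le f) x := by
      refine Submodule.iSup_induction (fun G : S => sections G.1 (Z.basicOpen f))
        (motive := fun x => ∃ (n : ℕ), ∃ t ∈ ⨆ G : S, sections G.1 W,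
          res M (Z.basicOpen_le f) t = rres (Z.basicOpen_le f) f ^ n • x) hx ?_ ?_ ?_
      · rintro G _ ⟨y, rfl⟩
        obtain ⟨n, t, ht⟩ := (localizes _ (hS G.1 G.2) W hW).exists_res_eq f y
        refine ⟨n, G.1.arrow.app W t, le_iSup (fun G : S => sections G.1 W) G ⟨t, rfl⟩, ?_⟩
        rw [← app_res, ht, Scheme.Modules.Hom.app_smul, appLin_apply]
      · exact ⟨0, 0, zero_mem _, by rw [map_zero, smul_zero]⟩
      · rintro x y ⟨n, t, ht, htx⟩ ⟨m, s, hs, hsy⟩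
        refine ⟨n + m, f ^ m • t + f ^ n • s,
          add_mem (Submodule.smul_mem _ _ ht) (Submodule.smul_mem _ _ hs), ?_⟩
        rw [map_add, res_smul, res_smul, htx, hsy, map_pow, map_pow, smul_add, ← mul_smul,
          ← mul_smul, ← pow_add, ← pow_add, add_comm m n]
    obtain ⟨n, t, ht, htx⟩ := key
    obtain ⟨m, hm⟩ := (localizes M hM W hW).exists_pow_smul_eq_zero f (t - f ^ n • x) (by
      rw [map_sub, htx, res_smul, map_pow, sub_self])
    refine ⟨m + n, ?_⟩
    rw [smul_sub, sub_eq_zero] at hm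
    rw [pow_add, mul_smul, ← hm]
    exact Submodule.smul_mem _ _ ht

theorem res_ne_zero [IsIntegral Z] {V : Z.Opens} (h : V ≤ W) [Nonempty V] {c : Γ(Z, W)}
    (hc : c ≠ 0) : rres h c ≠ 0 := fun h0 =>
  hc (map_injective_of_isIntegral _ (homOfLE h) (h0.trans (map_zero (rres h)).symm))

theorem subsingleton_of_isEmpty (h : ¬ Nonempty W) : Subsingleton Γ(Z, W) := by
  have : W = ⊥ := by
    ext z
    exact ⟨fun hz => (h ⟨⟨z, hz⟩⟩).elim, fun hz => hz.elim⟩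
  subst this
  exact CommRingCat.subsingleton_of_isTerminal Z.sheaf.isTerminalOfEmpty

/-- The subsheaf of sections with a nonzero multiple in a given subsheaf. The use of nonzero
divisors makes this meaningful also over the empty open. -/
def saturatedSections [IsIntegral Z] (hM : IsQuasicoherent M) (G : Subobject M)
    (hG : IsQuasicoherent (G : Z.Modules)) : AffineSubmodules M where
  obj W :=
    { carrier := {x | ∃ c ∈ nonZeroDivisors Γ(Z, W), c • x ∈ sections G W}
      zero_mem' := ⟨1, one_mem _, by rw [smul_zero]; exact zero_mem _⟩
      add_mem' := by
        rintro x y ⟨c, hc, hx⟩ ⟨d, hd, hy⟩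
        refine ⟨c * d, mul_mem hc hd, ?_⟩
        rw [smul_add]
        refine add_mem ?_ ?_
        · rw [mul_comm, mul_smul]; exact Submodule.smul_mem _ _ hx
        · rw [mul_smul]; exact Submodule.smul_mem _ _ hy
      smul_mem' := by
        rintro r x ⟨c, hc, hx⟩
        exact ⟨c, hc, by rw [smul_comm]; exact Submodule.smul_mem _ _ hx⟩ }
  res_mem {V W} _ _ h x := by
    rintro ⟨c, hc, hx⟩
    refine ⟨rres h c, ?_, by rw [← res_smul]; exact res_mem_sections h hx⟩
    by_cases hV : Nonempty V
    · have : Nonempty W := hV.map fun z => ⟨z.1, h z.2⟩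
      exact mem_nonZeroDivisors_of_ne_zero (res_ne_zero h (nonZeroDivisors.ne_zero hc))
    · have := subsingleton_of_isEmpty hV
      rw [Subsingleton.elim (rres h c) 1]
      exact one_mem _
  exists_pow_smul_mem {W} hW f x := by
    rintro ⟨c, hc, hx⟩
    by_cases hV : Nonempty (Z.basicOpen f)
    · have : Nonempty W := hV.map fun z => ⟨z.1, Z.basicOpen_le f z.2⟩
      have := hW.isLocalization_basicOpen f
      obtain ⟨⟨c₀, ⟨_, n, rfl⟩⟩, hc₀⟩ := IsLocalization.surj (.powers f) c
      have h1 : c * rres (Z.basicOpen_le f) (f ^ n) = rres (Z.basicOpen_le f) c₀ := hc₀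
      have h2 : c₀ ≠ 0 := by
        rintro rfl
        rw [map_zero, map_pow] at h1
        refine nonZeroDivisors.ne_zero hc
          (((isUnit_rres_basicOpen (f := f) le_rfl).pow n).mul_left_eq_zero.1 h1)
      obtain ⟨m, hm⟩ := exists_pow_smul_mem_sections hM hG hW f (c₀ • x) (by
        rw [res_smul, ← h1, mul_comm, mul_smul]
        exact Submodule.smul_mem _ _ hx)
      exact ⟨m, c₀, mem_nonZeroDivisors_of_ne_zero h2, by rwa [smul_comm]⟩
    · have h0 : f = 0 := (basicOpen_eq_bot_iff f).1 (by
        ext z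
        exact ⟨fun hz => (hV ⟨⟨z, hz⟩⟩).elim, fun hz => hz.elim⟩)
      refine ⟨1, 1, one_mem _, ?_⟩
      rw [h0, pow_one, zero_smul, smul_zero]
      exact zero_mem _

theorem saturatedSections_obj [IsIntegral Z] (hM : IsQuasicoherent M) (G : Subobject M)
    (hG : IsQuasicoherent (G : Z.Modules)) [Nonempty W] :
    (saturatedSections hM G hG).obj W = saturation (sections G W) := by
  ext x
  exact ⟨fun ⟨c, hc, hx⟩ => ⟨c, nonZeroDivisors.ne_zero hc, hx⟩,
    fun ⟨c, hc, hx⟩ => ⟨c, mem_nonZeroDivisors_of_ne_zero hc, hx⟩⟩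

/-- A subsheaf whose sections over affine opens are saturated. -/
def IsSaturated (G : Subobject M) : Prop :=
  ∀ W : Z.Opens, IsAffineOpen W → ∀ (c : Γ(Z, W)) (x : Γ(M, W)), c ≠ 0 → c • x ∈ sections G W →
    x ∈ sections G W

theorem cokernel_app_eq_zero_iff {G : Subobject M} {x : Γ(M, W)} :
    (cokernel.π G.arrow).app W x = 0 ↔ x ∈ sections G W := by
  constructor
  · exact exists_app_eq_of_cokernel G.arrow W x
  · rintro ⟨y, rfl⟩
    change (G.arrow ≫ cokernel.π G.arrow).app W y = 0
    rw [cokernel.condition]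
    rfl

theorem isLocallyFree_cokernel {d : ℕ} (hM : IsLocallyFreeOfRank M d) {G : Subobject M}
    (hG : IsQuasicoherent (G : Z.Modules))
    (hZ : ∀ W : Z.Opens, IsAffineOpen W → Nonempty W → IsDedekindDomain Γ(Z, W))
    (hs : IsSaturated G) : IsLocallyFree (cokernel G.arrow) := by
  have hqc := isQuasicoherent_of_isLocallyFree M (isLocallyFree_of_rank M hM)
  have hQ := isQuasicoherent_cokernel hG hqc G.arrow
  refine isLocallyFree_of_isTorsionFree hQ hZ (fun W hW => ?_) fun W hW c y hy => ?_
  · have := finite_sections hM hW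
    exact Module.Finite.of_surjective (appLin (cokernel.π G.arrow) W)
      (app_surjective_of_epi hW hqc hQ (cokernel.π G.arrow))
  · obtain ⟨x, rfl⟩ := app_surjective_of_epi hW hqc hQ (cokernel.π G.arrow) y
    rw [← Scheme.Modules.Hom.app_smul, cokernel_app_eq_zero_iff] at hy
    rw [cokernel_app_eq_zero_iff]
    exact or_iff_not_imp_left.2 fun hc => hs W hW c x hc hy

theorem isSaturated_of_isLocallyFree [IsIntegral Z] {G : Subobject M}
    (h : IsLocallyFree (cokernel G.arrow)) : IsSaturated G := by
  intro W _ c x hc hx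
  rw [← cokernel_app_eq_zero_iff, Scheme.Modules.Hom.app_smul] at hx
  exact cokernel_app_eq_zero_iff.1 (eq_zero_of_smul_eq_zero h hc hx)

end

variable {Fq : Type u} [Field Fq] [Fintype Fq] {X : Over (Spec (CommRingCat.of Fq))}
  {E : Type u} [Field E] [Algebra Fq E] [SmoothOfRelativeDimension 1 X.hom]
  [GeometricallyConnected X.hom] {V : X.left.Opens}

theorem finite_saturation_quotient {M : (prod X (specOver Fq E)).Modules} {d : ℕ}
    (hM : IsLocallyFreeOfRank M d) {W : (prod X (specOver Fq E)).Opens} (hW : IsAffineOpen W)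
    [Nonempty W] (Y : Submodule Γ(prod X (specOver Fq E), W) Γ(M, W)) :
    Module.Finite E (saturation Y ⧸ Y.submoduleOf (saturation Y)) := by
  have := isDedekindDomain_prod (E := E) hW ‹_›
  have := finite_sections hM hW
  have := finiteType_sections (E := E) hW
  refine finite_of_torsion (A := Γ(prod X (specOver Fq E), W)) fun t => ?_
  obtain ⟨⟨t, c, hc, ht⟩, rfl⟩ := Submodule.Quotient.mk_surjective _ t
  exact ⟨c, hc, (Submodule.Quotient.mk_eq_zero _).2 ht⟩

namespace Shtuka

variable {α β : specOver Fq E ⟶ X} {d : ℕ} (𝓕 : Shtuka α β d)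

/-- The saturation of a member of the second poset is a member. -/
theorem isTrivialSub_saturation (hαβ : FrobDisjoint α β) {G : Subobject 𝓕.F}
    (hG : 𝓕.IsTrivialSub G) : ∃ H : Subobject 𝓕.F, 𝓕.IsTrivialSub H ∧
      ∀ W, IsAffineOpen W → sections H W =
        (saturatedSections 𝓕.isQuasicoherent G hG.quasicoherent).obj W := by
  obtain ⟨H, hH, hHs⟩ := (saturatedSections 𝓕.isQuasicoherent G
    hG.quasicoherent).exists_subobject 𝓕.isQuasicoherent
  refine ⟨H, 𝓕.isTrivialSub_iff.2 ⟨hH, fun V hV => ?_⟩, hHs⟩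
  by_cases hne : Nonempty (cyl X E V)
  · rw [hHs _ (isAffineOpen_cyl E hV), saturatedSections_obj]
    have := finite_saturation_quotient 𝓕.locallyFree (isAffineOpen_cyl E hV)
      (sections G (cyl X E V))
    exact (frobData hV).frobSpan_saturation_eq (S := orbitPrimes α (isAffineOpen_cyl E hV))
      (I := idealSections (graph β) _) (J := idealSections (graph α) _)
      (stable_orbitPrimes α hV) (𝓕.injective_twistSum_frobLin hV)
      (𝓕.injective_appLin_g _) (fun p hp h => notMem_orbitPrimes hαβ _ p hp h)
      (fun p hp h => mem_orbitPrimes α _ p hp h) (fun a ha w => 𝓕.smul_mem_range_g ha w)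
      (fun a ha w => 𝓕.smul_mem_frobSpan_top hV ha w) ((𝓕.isTrivialSub_iff.1 hG).2 V hV)
  · have := subsingleton_of_isEmpty hne
    have := Module.subsingleton Γ(prod X (specOver Fq E), cyl X E V) Γ(𝓕.F', cyl X E V)
    exact Subsingleton.elim _ _

/-- The sum of all members of the second poset is a member, and hence the greatest one. -/
theorem exists_isGreatest_isTrivialSub : ∃ F_II : Subobject 𝓕.F,
    IsGreatest {G : Subobject 𝓕.F | 𝓕.IsTrivialSub G} F_II := by
  obtain ⟨H, hH, hHs⟩ := (sumSections 𝓕.isQuasicoherent {G | 𝓕.IsTrivialSub G}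
    fun G hG => hG.quasicoherent).exists_subobject 𝓕.isQuasicoherent
  refine ⟨H, 𝓕.isTrivialSub_iff.2 ⟨hH, fun V hV => ?_⟩, fun G hG => ?_⟩
  · rw [hHs _ (isAffineOpen_cyl E hV)]
    change (frobData (E := E) hV).frobSpan (𝓕.frobLin hV) (⨆ G : {G | 𝓕.IsTrivialSub G}, _) =
      (⨆ G : {G | 𝓕.IsTrivialSub G}, _ : Submodule _ _).map _
    rw [FrobData.frobSpan_iSup, Submodule.map_iSup]
    exact iSup_congr fun G => (𝓕.isTrivialSub_iff.1 G.2).2 V hV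
  · refine le_of_sections_le covers_affine (fun _ h => h) hG.quasicoherent fun W hW => ?_
    rw [hHs W hW]
    exact le_iSup (fun G : {G | 𝓕.IsTrivialSub G} => sections G.1 W) ⟨G, hG⟩

/-- The greatest member of the second poset equals its saturation, so that its quotient is locally
free. -/
theorem isLocallyFree_cokernel_of_isGreatest (hαβ : FrobDisjoint α β) {G : Subobject 𝓕.F}
    (hG : IsGreatest {G : Subobject 𝓕.F | 𝓕.IsTrivialSub G} G) :
    IsLocallyFree (cokernel G.arrow) := by
  refine isLocallyFree_cokernel 𝓕.locallyFree hG.1.quasicoherent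
    (fun W hW h => isDedekindDomain_prod hW h) fun W hW c x hc hx => ?_
  by_cases hne : Nonempty W
  · obtain ⟨H, hH, hHs⟩ := 𝓕.isTrivialSub_saturation hαβ hG.1
    refine sections_mono (hG.2 hH) W ?_
    rw [hHs W hW]
    exact ⟨c, mem_nonZeroDivisors_of_ne_zero hc, hx⟩
  · have := subsingleton_of_isEmpty hne
    exact (hc (Subsingleton.elim _ _)).elim

end Shtuka

end

/-! ### Trivial quotients -/

namespace FrobData

variable {E A : Type u} [Field E] [CommRing A] [Algebra E A] (D : FrobData E A)
variable {F W : Type*} [AddCommGroup F] [Module A F]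
  [AddCommGroup W] [Module A W] (φ : F →ₛₗ[D.σ] W)
  (g : F →ₗ[A] W) (I : Ideal A)

section
variable {Q Q' : Type*} [AddCommGroup Q] [Module A Q] [Module E Q] [IsScalarTower E A Q]
  [AddCommGroup Q'] [Module A Q'] [Module E Q'] [IsScalarTower E A Q']

/-- The semilinear correspondence from `F` to itself given by `g⁻¹ ∘ φ`, which is defined up to
denominators in `I`, induces on the quotient `Q` of `F` a semilinear endomorphism that identifies
`Q` with its own base change. -/
def TrivialQuotient (π : F →ₗ[A] Q) : Prop :=
  ∃ Θ : Q →ₛₗ[D.σ] Q, Function.Bijective (D.twistSum Θ.toAddMonoidHom) ∧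
    ∀ a ∈ I, ∀ x m : F, g m = a • φ x → a • Θ (π x) = π m

variable {D φ g I}

theorem TrivialQuotient.of_linearEquiv {π : F →ₗ[A] Q} (h : D.TrivialQuotient φ g I π)
    (e : Q ≃ₗ[A] Q') : D.TrivialQuotient φ g I (e.toLinearMap ∘ₗ π) := by
  obtain ⟨Θ, hΘ, h⟩ := h
  let Θ' : Q' →ₛₗ[D.σ] Q' :=
    { toFun q := e (Θ (e.symm q))
      map_add' x y := by simp
      map_smul' a x := by simp }
  refine ⟨Θ', ?_, fun a ha x m hm => ?_⟩
  · have h1 : ⇑(D.twistSum Θ'.toAddMonoidHom) =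
        e ∘ D.twistSum Θ.toAddMonoidHom ∘ Finsupp.mapRange.addEquiv e.symm.toAddEquiv := by
      funext y
      rw [Function.comp_apply, Function.comp_apply, twistSum_apply, twistSum_apply,
        Finsupp.mapRange.addEquiv_apply, Finsupp.sum_mapRange_index (by simp), Finsupp.sum,
        Finsupp.sum, map_sum]
      refine Finset.sum_congr rfl fun i _ => ?_
      exact (LinearMap.map_smul_of_tower e.toLinearMap (D.b i) _).symm
    rw [h1]
    exact e.bijective.comp (hΘ.comp (AddEquiv.bijective _))
  · change a • e (Θ (e.symm (e (π x)))) = e (π m)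
    rw [e.symm_apply_apply, ← h a ha x m hm, map_smul]

theorem TrivialQuotient.of_ker_eq {π : F →ₗ[A] Q} {π' : F →ₗ[A] Q'}
    (h : D.TrivialQuotient φ g I π) (hπ : Function.Surjective π) (hπ' : Function.Surjective π')
    (hk : LinearMap.ker π = LinearMap.ker π') : D.TrivialQuotient φ g I π' := by
  let e : Q ≃ₗ[A] Q' := (π.quotKerEquivOfSurjective hπ).symm ≪≫ₗ
    Submodule.quotEquivOfEq _ _ hk ≪≫ₗ π'.quotKerEquivOfSurjective hπ'
  have he : e.toLinearMap ∘ₗ π = π' := by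
    ext x
    have h1 : (π.quotKerEquivOfSurjective hπ).symm (π x) = Submodule.Quotient.mk x :=
      (LinearEquiv.symm_apply_eq _).2 rfl
    change π'.quotKerEquivOfSurjective hπ' (Submodule.quotEquivOfEq _ _ hk
      ((π.quotKerEquivOfSurjective hπ).symm (π x))) = π' x
    rw [h1]
    rfl
  exact he ▸ h.of_linearEquiv e

theorem trivialQuotient_of_subsingleton [Subsingleton Q] (π : F →ₗ[A] Q) :
    D.TrivialQuotient φ g I π :=
  ⟨0, ⟨fun _ _ _ => Finsupp.ext fun _ => Subsingleton.elim _ _,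
    fun _ => ⟨0, Subsingleton.elim _ _⟩⟩, fun _ _ _ _ _ => Subsingleton.elim _ _⟩

end

variable {Q₁ Q₂ : Type*} [AddCommGroup Q₁] [Module A Q₁] [Module E Q₁] [IsScalarTower E A Q₁]
  [AddCommGroup Q₂] [Module A Q₂] [Module E Q₂] [IsScalarTower E A Q₂]
  [Module E W] [IsScalarTower E A W] {D φ g I}

variable (D) in
/-- The product of two semilinear endomorphisms. -/
def prodEnd (Θ₁ : Q₁ →ₛₗ[D.σ] Q₁) (Θ₂ : Q₂ →ₛₗ[D.σ] Q₂) : Q₁ × Q₂ →ₛₗ[D.σ] Q₁ × Q₂ where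
  toFun q := (Θ₁ q.1, Θ₂ q.2)
  map_add' _ _ := Prod.ext (map_add Θ₁ _ _) (map_add Θ₂ _ _)
  map_smul' _ _ := Prod.ext (map_smulₛₗ Θ₁ _ _) (map_smulₛₗ Θ₂ _ _)

theorem bijective_twistSum_prodEnd {Θ₁ : Q₁ →ₛₗ[D.σ] Q₁} {Θ₂ : Q₂ →ₛₗ[D.σ] Q₂}
    (h₁ : Function.Bijective (D.twistSum Θ₁.toAddMonoidHom))
    (h₂ : Function.Bijective (D.twistSum Θ₂.toAddMonoidHom)) :
    Function.Bijective (D.twistSum (D.prodEnd Θ₁ Θ₂).toAddMonoidHom) := by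
  have key (y : D.ι →₀ Q₁ × Q₂) : D.twistSum (D.prodEnd Θ₁ Θ₂).toAddMonoidHom y =
      (D.twistSum Θ₁.toAddMonoidHom (y.mapRange Prod.fst rfl),
        D.twistSum Θ₂.toAddMonoidHom (y.mapRange Prod.snd rfl)) := by
    rw [twistSum_apply, twistSum_apply, twistSum_apply, Finsupp.sum_mapRange_index (by simp),
      Finsupp.sum_mapRange_index (by simp)]
    refine Prod.ext ?_ ?_
    · rw [Finsupp.sum, Prod.fst_sum]; rfl
    · rw [Finsupp.sum, Prod.snd_sum]; rfl
  constructor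
  · intro x y hxy
    rw [key, key, Prod.mk.injEq] at hxy
    ext i
    · exact DFunLike.congr_fun (h₁.1 hxy.1) i
    · exact DFunLike.congr_fun (h₂.1 hxy.2) i
  · rintro ⟨w₁, w₂⟩
    obtain ⟨y₁, rfl⟩ := h₁.2 w₁
    obtain ⟨y₂, rfl⟩ := h₂.2 w₂
    refine ⟨y₁.mapRange (fun q => (q, 0)) rfl + y₂.mapRange (fun q => (0, q)) rfl, ?_⟩
    rw [key]
    congr 2
    · ext i; simp
    · ext i; simp

/-- The quotient of `F` by the intersection of the kernels of two trivial quotients is trivial.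
This quotient is the image `H` of `F` in the product of the two quotients, and the base change of
`H` differs from `H` only by a quotient supported on the zero and a quotient supported on the
pole of the shtuka. -/
theorem TrivialQuotient.prod [IsDomain A] [IsNoetherianRing A] [Ring.DimensionLEOne A]
    [Algebra.FiniteType E A] [Module.Finite A Q₁] [Module.Finite A Q₂] {S : Set (Ideal A)}
    {J : Ideal A} (hS : D.Stable S) (hg : Function.Injective g)
    (hI : ∀ p : Ideal A, p.IsPrime → I ≤ p → p ∉ S) (hJ : ∀ p : Ideal A, p.IsPrime → J ≤ p → p ∈ S)
    (hI0 : I ≠ ⊥) (hJ0 : J ≠ ⊥) (hIg : ∀ a ∈ I, ∀ w : W, a • w ∈ LinearMap.range g)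
    (hJφ : ∀ a ∈ J, ∀ w : W, a • w ∈ D.frobSpan φ ⊤) {π₁ : F →ₗ[A] Q₁} {π₂ : F →ₗ[A] Q₂}
    (htf₁ : ∀ (c : A) (q : Q₁), c • q = 0 → c = 0 ∨ q = 0)
    (htf₂ : ∀ (c : A) (q : Q₂), c • q = 0 → c = 0 ∨ q = 0)
    (h₁ : D.TrivialQuotient φ g I π₁) (h₂ : D.TrivialQuotient φ g I π₂) :
    D.TrivialQuotient φ g I (π₁.prod π₂).rangeRestrict := by
  obtain ⟨Θ₁, hΘ₁, h₁⟩ := h₁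
  obtain ⟨Θ₂, hΘ₂, h₂⟩ := h₂
  let Θ : Q₁ × Q₂ →ₛₗ[D.σ] Q₁ × Q₂ := D.prodEnd Θ₁ Θ₂
  let π : F →ₗ[A] Q₁ × Q₂ := π₁.prod π₂
  have hΘ : Function.Bijective (D.twistSum Θ.toAddMonoidHom) := bijective_twistSum_prodEnd hΘ₁ hΘ₂
  have hrel (a) (ha : a ∈ I) (x m : F) (hm : g m = a • φ x) : a • Θ (π x) = π m :=
    Prod.ext (h₁ a ha x m hm) (h₂ a ha x m hm)
  have htf (c : A) (hc : c ≠ 0) (q : Q₁ × Q₂) (hq : c • q = 0) : q = 0 :=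
    Prod.ext ((htf₁ c q.1 (congrArg Prod.fst hq)).resolve_left hc)
      ((htf₂ c q.2 (congrArg Prod.snd hq)).resolve_left hc)
  have hfin : Module.Finite E
      (saturation (LinearMap.range π) ⧸ (LinearMap.range π).submoduleOf (saturation _)) := by
    refine finite_of_torsion (A := A) fun t => ?_
    obtain ⟨⟨t, c, hc, ht⟩, rfl⟩ := Submodule.Quotient.mk_surjective _ t
    exact ⟨c, hc, (Submodule.Quotient.mk_eq_zero _).2 ht⟩
  have htop : D.frobSpan Θ ⊤ = LinearMap.range (LinearMap.id : Q₁ × Q₂ →ₗ[A] Q₁ × Q₂) := by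
    rw [LinearMap.range_id, eq_top_iff]
    intro w _
    obtain ⟨y, rfl⟩ := hΘ.2 w
    exact D.mem_frobSpan_iff.2 ⟨y, fun _ => trivial, rfl⟩
  have hIH (a) (ha : a ∈ I) (w) (hw : w ∈ D.frobSpan Θ (LinearMap.range π)) :
      a • w ∈ LinearMap.range π := by
    induction hw using Submodule.span_induction with
    | mem w hw =>
      obtain ⟨_, ⟨x, rfl⟩, rfl⟩ := hw
      obtain ⟨m, hm⟩ := hIg a ha (φ x)
      exact ⟨m, (hrel a ha x m hm).symm⟩
    | zero => rw [smul_zero]; exact zero_mem _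
    | add x y _ _ hx hy => rw [smul_add]; exact add_mem hx hy
    | smul b x _ hx => rw [smul_comm]; exact Submodule.smul_mem _ _ hx
  have hJH (a) (ha : a ∈ J) (w) (hw : w ∈ LinearMap.range π) :
      a • w ∈ D.frobSpan Θ (LinearMap.range π) := by
    obtain ⟨m, rfl⟩ := hw
    obtain ⟨y, -, hy⟩ := D.mem_frobSpan_iff.1 (hJφ a ha (g m))
    refine D.mem_frobSpan_iff.2 ⟨y.mapRange π (map_zero π), fun i => ⟨y i, rfl⟩, ?_⟩
    obtain ⟨c, hc, hc0⟩ := Submodule.exists_mem_ne_zero_of_ne_bot hI0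
    choose n hn using fun i => hIg c hc (φ (y i))
    -- after multiplication by a denominator `c` both sides come from the same element of `F`
    have h3 : y.sum (fun i _ => algebraMap E A (D.b i) • n i) = c • a • m := by
      refine hg ?_
      rw [map_smul, map_smul, ← hy, twistSum_apply, Finsupp.sum, Finsupp.sum, map_sum,
        Finset.smul_sum]
      refine Finset.sum_congr rfl fun i _ => ?_
      rw [map_smul, hn, ← algebraMap_smul A (D.b i), smul_comm]
      rfl
    rw [← sub_eq_zero]
    refine htf c hc0 _ ?_
    rw [smul_sub, sub_eq_zero, ← map_smul π a, ← map_smul π c, ← h3, twistSum_apply,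
      Finsupp.sum_mapRange_index (by simp), Finsupp.sum, Finsupp.sum, map_sum, Finset.smul_sum]
    refine Finset.sum_congr rfl fun i _ => ?_
    rw [map_smul, ← hrel c hc (y i) (n i) (hn i), ← algebraMap_smul A (D.b i), smul_comm]
    rfl
  have key := D.frobSpan_eq_map_of_smul_mem hS hΘ.1 (g := LinearMap.id) Function.injective_id
    hI hJ hI0 hJ0 htop (H := LinearMap.range π) (by rwa [Submodule.map_id])
    (by rwa [Submodule.map_id])
  rw [Submodule.map_id] at key
  let Θ' : LinearMap.range π →ₛₗ[D.σ] LinearMap.range π :=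
    Θ.restrict fun x hx => key ▸ D.mem_frobSpan_of_mem hx
  have hval (y : D.ι →₀ LinearMap.range π) : (D.twistSum Θ'.toAddMonoidHom y : Q₁ × Q₂) =
      D.twistSum Θ.toAddMonoidHom (y.mapRange Subtype.val rfl) := by
    rw [twistSum_apply, twistSum_apply, Finsupp.sum_mapRange_index (by simp), Finsupp.sum,
      Finsupp.sum, AddSubmonoidClass.coe_finsetSum]
    rfl
  refine ⟨Θ', ⟨fun x y hxy => ?_, fun w => ?_⟩, fun a ha x m hm => Subtype.ext (hrel a ha x m hm)⟩
  · have h4 := congrArg Subtype.val hxy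
    rw [hval, hval] at h4
    exact Finsupp.mapRange_injective _ rfl Subtype.val_injective (hΘ.1 h4)
  · obtain ⟨y, hy, hyw⟩ := D.mem_frobSpan_iff.1 (key.ge w.2)
    refine ⟨Finsupp.onFinset y.support (fun i => ⟨y i, hy i⟩) fun i h => ?_, Subtype.ext ?_⟩
    · rw [Finsupp.mem_support_iff]
      exact fun h' => h (Subtype.ext h')
    · rw [hval, ← hyw]
      exact congrArg _ (Finsupp.ext fun i => rfl)

end FrobData

noncomputable section

/-! ### Trivial quotients of shtukas -/

section Twist

variable {T Z : Scheme.{u}} (γ : T ⟶ Z) {M N : Z.Modules} {U : Z.Opens}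

theorem mono_twistMap (φ : M ⟶ N) [Mono φ] : Mono (twistMap γ φ) := by
  refine mono_of_app_injective _ fun U s t hst => ?_
  refine TwistSections.ext ?_
  funext V hV
  refine LinearMap.ext fun a => app_injective φ V ?_
  exact congrArg (fun s : TwistSections γ N U => s.toLin V hV a) hst

/-- The twist is left exact. -/
theorem exists_twistMap_eq (φ : M ⟶ N) [Mono φ] (s : TwistSections γ N U)
    (hs : (twistMap γ (cokernel.π φ)).app U s = 0) :
    ∃ t : TwistSections γ M U, (twistMap γ φ).app U t = s := by
  have h1 (V : Z.Opens) (hV : V ≤ U) (a : idealSections γ V) :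
      ∃ m : Γ(M, V), φ.app V m = s.toLin V hV a :=
    exists_app_eq_of_cokernel φ V _
      (congrArg (fun s : TwistSections γ (cokernel φ) U => s.toLin V hV a) hs)
  choose m hm using h1
  have hadd (V) (hV : V ≤ U) (a b) : m V hV (a + b) = m V hV a + m V hV b :=
    app_injective φ V (by rw [map_add, hm, hm, hm, map_add])
  have hsmul (V) (hV : V ≤ U) (r : Γ(Z, V)) (a) : m V hV (r • a) = r • m V hV a :=
    app_injective φ V (by rw [Scheme.Modules.Hom.app_smul, hm, hm, map_smul])
  have hres (V W) (h : V ≤ U) (h' : W ≤ V) (a) :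
      m W (h'.trans h) (idealRes γ h' a) = res M h' (m V h a) :=
    app_injective φ W (by rw [hm, s.compat V W h h', app_res, hm]; rfl)
  let l (V) (hV : V ≤ U) : idealSections γ V →ₗ[Γ(Z, V)] Γ(M, V) :=
    { toFun := m V hV, map_add' := hadd V hV, map_smul' := hsmul V hV }
  refine ⟨⟨l, hres⟩, ?_⟩
  refine TwistSections.ext ?_
  funext V hV
  exact LinearMap.ext fun a => hm V hV a

/-- A section of the twist of a torsion-free sheaf is determined by one of its values. -/
theorem twistSections_ext [IsIntegral Z] (hM : IsLocallyFree M) {s t : TwistSections γ M U}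
    {c : idealSections γ U} (hc : c.1 ≠ 0) (h : s.toLin U le_rfl c = t.toLin U le_rfl c) :
    s = t := by
  refine TwistSections.ext ?_
  funext V hV
  refine LinearMap.ext fun a => ?_
  by_cases hne : Nonempty V
  · rw [← sub_eq_zero]
    refine eq_zero_of_smul_eq_zero hM (res_ne_zero hV hc) ?_
    have key (s : TwistSections γ M U) :
        rres hV c.1 • s.toLin V hV a = a.1 • res M hV (s.toLin U le_rfl c) := by
      have h1 := s.compat U V le_rfl hV c
      change _ = res M hV (s.toLin U le_rfl c) at h1
      rw [← h1, ← map_smul, ← map_smul]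
      congr 1
      exact Subtype.ext (mul_comm _ _)
    rw [smul_sub, key, key, h, sub_self]
  · have := subsingleton_of_isEmpty hne
    have := Module.subsingleton Γ(Z, V) Γ(M, V)
    exact Subsingleton.elim _ _

end Twist

variable {Fq : Type u} [Field Fq] [Fintype Fq] {X : Over (Spec (CommRingCat.of Fq))}
  {E : Type u} [Field E] [Algebra Fq E] [SmoothOfRelativeDimension 1 X.hom]
  [GeometricallyConnected X.hom] {V : X.left.Opens}

/-- Morphisms from `Φ^* M` are determined on the sections over cylinders that come from `M`. -/
theorem pullback_hom_ext {M N : (prod X (specOver Fq E)).Modules} (hM : IsQuasicoherent M)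
    {φ ψ : (Scheme.Modules.pullback (Phi X (specOver Fq E))).obj M ⟶ N}
    (h : ∀ (V : X.left.Opens) (hV : IsAffineOpen V) (x : Γ(M, cyl X E V)),
      φ.app _ (frobUnit hV M x) = ψ.app _ (frobUnit hV M x)) : φ = ψ := by
  rw [← sub_eq_zero]
  refine eq_zero_of_app_eq_zero (covers_cylinders E) (isAffineOpen_of_mem_cylinders E)
    (fun W hW => localizes _ (isQuasicoherent_pullback_Phi hM) W
      (isAffineOpen_of_mem_cylinders E W hW)) _ ?_
  rintro _ ⟨V, hV, rfl⟩ y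
  have h1 : LinearMap.ker (appLin (φ - ψ) (cyl X E V)) = ⊤ := by
    rw [eq_top_iff, ← frobSpan_frobUnit_top hV hM]
    refine Submodule.span_le.2 ?_
    rintro _ ⟨x, -, rfl⟩
    exact sub_eq_zero.2 (h V hV x)
  exact (h1.ge trivial : y ∈ LinearMap.ker (appLin (φ - ψ) (cyl X E V)))

/-- A morphism from `Φ^* M` factors through a monomorphism if it does so on the sections over
cylinders that come from `M`. -/
theorem exists_pullback_factor {M N P : (prod X (specOver Fq E)).Modules} (hM : IsQuasicoherent M)
    (φ : (Scheme.Modules.pullback (Phi X (specOver Fq E))).obj M ⟶ P) (i : N ⟶ P) [Mono i]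
    (h : ∀ (V : X.left.Opens) (hV : IsAffineOpen V) (x : Γ(M, cyl X E V)),
      ∃ y, i.app _ y = φ.app _ (frobUnit hV M x)) : ∃ ψ, ψ ≫ i = φ := by
  refine exists_factor_of_app (covers_cylinders E) (isAffineOpen_of_mem_cylinders E)
    (fun W hW => localizes _ (isQuasicoherent_pullback_Phi hM) W
      (isAffineOpen_of_mem_cylinders E W hW)) φ i ?_
  rintro _ ⟨V, hV, rfl⟩ y
  have h1 : (LinearMap.range (appLin i (cyl X E V))).comap (appLin φ (cyl X E V)) = ⊤ := by
    rw [eq_top_iff, ← frobSpan_frobUnit_top hV hM]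
    refine Submodule.span_le.2 ?_
    rintro _ ⟨x, -, rfl⟩
    exact h V hV x
  exact (h1.ge trivial : y ∈ _)

namespace Shtuka

variable {α β : specOver Fq E ⟶ X} {d : ℕ} (𝓕 : Shtuka α β d)

/-- A section `n` of `F'`, as a section of the twist of `F`, has value `a • n` at `a`. -/
theorem toPole_app_toLin {U : (prod X (specOver Fq E)).Opens} (n : Γ(𝓕.F', U))
    (a : idealSections (graph β) U) (m : Γ(𝓕.F, U)) (h : 𝓕.g.app U m = a.1 • n) :
    TwistSections.toLin (𝓕.toPole.app U n : TwistSections (graph β) 𝓕.F U) U le_rfl a = m := by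
  have := 𝓕.mono_g
  refine app_injective 𝓕.g U ?_
  refine (app_colonLin (graph β) 𝓕.g 𝓕.exists_g_eq_smul U (res 𝓕.F' le_rfl n) a).trans ?_
  rw [h, res_rfl]

theorem toTwist_app_toLin {U : (prod X (specOver Fq E)).Opens}
    {M : (prod X (specOver Fq E)).Modules} (n : Γ(M, U)) (a : idealSections (graph β) U) :
    TwistSections.toLin ((toTwist (graph β) M).app U n : TwistSections (graph β) M U) U le_rfl a =
      a.1 • n := by
  refine (app_colonLin (graph β) (𝟙 M) (fun _ a n => ⟨a.1 • n, rfl⟩) U (res M le_rfl n) a).trans ?_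
  rw [res_rfl]

/-- The quotients by the members of the first poset are trivial on cylinders. -/
theorem trivialQuotient_of_isTrivialQuotientSub {G : Subobject 𝓕.F}
    (hG : 𝓕.IsTrivialQuotientSub G) (hV : IsAffineOpen V) :
    (frobData (E := E) hV).TrivialQuotient (𝓕.frobLin hV) (appLin 𝓕.g _)
      (idealSections (graph β) _) (appLin (cokernel.π G.arrow) (cyl X E V)) := by
  obtain ⟨θ, hθ⟩ := hG.exists_iso
  have hQ := isQuasicoherent_cokernel hG.quasicoherent 𝓕.isQuasicoherent G.arrow
  refine ⟨(appLin θ.hom _).comp (frobUnit hV _), ?_, fun a ha x m hm => ?_⟩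
  · have h1 : ⇑((frobData (E := E) hV).twistSum ((appLin θ.hom (cyl X E V)).comp
        (frobUnit hV (cokernel G.arrow))).toAddMonoidHom) =
        appLin θ.hom (cyl X E V) ∘
          (frobData (E := E) hV).twistSum (frobUnit hV (cokernel G.arrow)).toAddMonoidHom :=
      funext fun y => FrobData.twistSum_comp _ _ _ y
    rw [h1]
    refine Function.Bijective.comp ⟨app_injective θ.hom _, fun y => ⟨θ.inv.app _ y, ?_⟩⟩
      (bijective_twistSum_frobUnit hV hQ)
    exact congrArg (fun φ => Scheme.Modules.Hom.app φ (cyl X E V) y) θ.inv_hom_id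
  · have h1 := congrArg (fun φ => Scheme.Modules.Hom.app φ (cyl X E V) (frobUnit hV 𝓕.F x)) hθ
    have h2 := congrArg (fun s : TwistSections (graph β) (cokernel G.arrow) (cyl X E V) =>
      s.toLin _ le_rfl ⟨a, ha⟩) h1
    have h3 := toTwist_app_toLin (β := β) (θ.hom.app _
      (((Scheme.Modules.pullback (Phi X (specOver Fq E))).map (cokernel.π G.arrow)).app _
        (frobUnit hV 𝓕.F x))) ⟨a, ha⟩
    rw [frobUnit_natural] at h3
    refine h3.symm.trans ?_
    rw [← frobUnit_natural]
    refine h2.trans ?_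
    exact congrArg ((cokernel.π G.arrow).app _) (𝓕.toPole_app_toLin (𝓕.frobLin hV x) ⟨a, ha⟩ m hm)

end Shtuka
end

noncomputable section

variable {Fq : Type u} [Field Fq] [Fintype Fq] {X : Over (Spec (CommRingCat.of Fq))}
  {E : Type u} [Field E] [Algebra Fq E]

/-- `Φ^*` is right exact. -/
theorem exists_pullback_desc {M N P : (prod X (specOver Fq E)).Modules} (i : M ⟶ N)
    (τ : (Scheme.Modules.pullback (Phi X (specOver Fq E))).obj N ⟶ P)
    (h : (Scheme.Modules.pullback (Phi X (specOver Fq E))).map i ≫ τ = 0) :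
    ∃ θ : (Scheme.Modules.pullback (Phi X (specOver Fq E))).obj (cokernel i) ⟶ P,
      (Scheme.Modules.pullback (Phi X (specOver Fq E))).map (cokernel.π i) ≫ θ = τ := by
  have : PreservesColimitsOfSize.{0, 0} (Scheme.Modules.pullback (Phi X (specOver Fq E))) :=
    (Adjunction.ofIsLeftAdjoint _).leftAdjoint_preservesColimits
  refine ⟨(PreservesCokernel.iso (Scheme.Modules.pullback (Phi X (specOver Fq E))) i).hom ≫
    cokernel.desc _ τ h, ?_⟩
  rw [PreservesCokernel.π_iso_hom_assoc, cokernel.π_desc]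

variable [SmoothOfRelativeDimension 1 X.hom] [GeometricallyConnected X.hom] {V : X.left.Opens}

namespace Shtuka

variable {α β : specOver Fq E ⟶ X} {d : ℕ} (𝓕 : Shtuka α β d)

/-- The map `Φ^* F → F(Γ_β) → Q(Γ_β)` to the twist of the quotient `Q` is the composite of
`Φ^* F → Φ^* Q`, the linear extension of `Θ`, and the canonical map `Q → Q(Γ_β)`. -/
theorem phi_twistMap_app {G : Subobject 𝓕.F} (hQ : IsLocallyFree (cokernel G.arrow))
    (hV : IsAffineOpen V)
    (Θ : Γ(cokernel G.arrow, cyl X E V) →ₛₗ[(frobData (E := E) hV).σ]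
      Γ(cokernel G.arrow, cyl X E V))
    (hΘ : ∀ a ∈ idealSections (graph β) (cyl X E V), ∀ x m : Γ(𝓕.F, cyl X E V),
      appLin 𝓕.g _ m = a • 𝓕.frobLin hV x →
        a • Θ (appLin (cokernel.π G.arrow) _ x) = appLin (cokernel.π G.arrow) _ m)
    (x : Γ(𝓕.F, cyl X E V)) :
    (𝓕.phi ≫ twistMap (graph β) (cokernel.π G.arrow)).app _ (frobUnit hV 𝓕.F x) =
      (toTwist (graph β) (cokernel G.arrow)).app _ (Θ ((cokernel.π G.arrow).app _ x)) := by
  by_cases hne : Nonempty (cyl X E V)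
  · obtain ⟨c, hc, hc0⟩ := Submodule.exists_mem_ne_zero_of_ne_bot
      (idealSections_ne_bot (γ := β) (isAffineOpen_cyl E hV))
    obtain ⟨m, hm⟩ := 𝓕.smul_mem_range_g hc (𝓕.frobLin hV x)
    refine twistSections_ext (graph β) hQ (c := ⟨c, hc⟩) hc0 ?_
    refine Eq.trans ?_ (toTwist_app_toLin _ ⟨c, hc⟩).symm
    refine Eq.trans ?_ (hΘ c hc x m hm).symm
    exact congrArg ((cokernel.π G.arrow).app _) (𝓕.toPole_app_toLin (𝓕.frobLin hV x) ⟨c, hc⟩ m hm)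
  · have := subsingleton_of_isEmpty hne
    have := Module.subsingleton Γ(prod X (specOver Fq E), cyl X E V)
      (TwistSections (graph β) (cokernel G.arrow) (cyl X E V))
    exact Subsingleton.elim (α := TwistSections (graph β) (cokernel G.arrow) (cyl X E V)) _ _

/-- A saturated subsheaf is a member of the first poset if its quotient is trivial on cylinders. The
semilinear endomorphisms on the cylinders glue, since a section of the twist of the quotient
determines them. -/
theorem isTrivialQuotientSub_of_trivialQuotient {G : Subobject 𝓕.F}
    (hG : IsQuasicoherent (G : (prod X (specOver Fq E)).Modules)) (hs : IsSaturated G)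
    (h : ∀ (V : X.left.Opens) (hV : IsAffineOpen V),
      (frobData (E := E) hV).TrivialQuotient (𝓕.frobLin hV) (appLin 𝓕.g _)
        (idealSections (graph β) _) (appLin (cokernel.π G.arrow) (cyl X E V))) :
    𝓕.IsTrivialQuotientSub G := by
  have hQ := isLocallyFree_cokernel 𝓕.locallyFree hG (fun W hW h => isDedekindDomain_prod hW h) hs
  have hQqc := isQuasicoherent_of_isLocallyFree _ hQ
  choose Θ hΘ hrel using h
  have key (V) (hV : IsAffineOpen V) (x : Γ(𝓕.F, cyl X E V)) :=
    𝓕.phi_twistMap_app hQ hV (Θ V hV) (hrel V hV) x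
  have hm : Mono (toTwist (graph β) (cokernel G.arrow)) :=
    mono_toTwist _ hQ fun _ hW _ => idealSections_ne_bot hW
  have hm' : Mono (twistMap (graph β) G.arrow) := mono_twistMap _ _
  have hzero (V) (x : Γ((G : (prod X (specOver Fq E)).Modules), cyl X E V)) :
      (cokernel.π G.arrow).app _ (G.arrow.app _ x) = 0 := cokernel_app_eq_zero_iff.2 ⟨x, rfl⟩
  refine ⟨hG, imageSubobject_le_iff.2 (exists_pullback_factor hG _ _ fun V hV x => ?_), hQ, ?_⟩
  · refine exists_twistMap_eq (graph β) G.arrow _ ?_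
    have h1 := key V hV (G.arrow.app _ x)
    rw [hzero, map_zero, map_zero, ← frobUnit_natural] at h1
    exact h1
  · obtain ⟨τ, hτ⟩ := exists_pullback_factor 𝓕.isQuasicoherent
      (𝓕.phi ≫ twistMap (graph β) (cokernel.π G.arrow)) (toTwist (graph β) (cokernel G.arrow))
      fun V hV x => ⟨_, (key V hV x).symm⟩
    have hτΘ (V) (hV : IsAffineOpen V) (x : Γ(𝓕.F, cyl X E V)) :
        τ.app _ (frobUnit hV 𝓕.F x) = Θ V hV ((cokernel.π G.arrow).app _ x) := by
      refine app_injective (toTwist (graph β) (cokernel G.arrow)) _ ?_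
      rw [← key V hV x, ← hτ]
      rfl
    obtain ⟨θ, hθ⟩ := exists_pullback_desc G.arrow τ (by
      refine pullback_hom_ext hG fun V hV x => ?_
      rw [comp_app_apply, frobUnit_natural, hτΘ, hzero, map_zero]
      rfl)
    have hθΘ (V) (hV : IsAffineOpen V) :
        (appLin θ (cyl X E V)).comp (frobUnit hV (cokernel G.arrow)) = Θ V hV := by
      ext q
      obtain ⟨x, rfl⟩ := app_surjective_of_epi (isAffineOpen_cyl E hV) 𝓕.isQuasicoherent hQqc
        (cokernel.π G.arrow) q
      rw [← hτΘ, ← hθ, comp_app_apply, frobUnit_natural]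
      rfl
    have hbij (V) (hV : IsAffineOpen V) : Function.Bijective (θ.app (cyl X E V)) := by
      have h1 := hΘ V hV
      have h2 : ⇑((frobData (E := E) hV).twistSum (Θ V hV).toAddMonoidHom) =
          θ.app (cyl X E V) ∘
            (frobData (E := E) hV).twistSum (frobUnit hV (cokernel G.arrow)).toAddMonoidHom := by
        rw [← hθΘ V hV]
        exact funext fun y => FrobData.twistSum_comp _ _ _ y
      rw [h2] at h1
      exact (Function.Bijective.of_comp_iff _ (bijective_twistSum_frobUnit hV hQqc)).1 h1
    have hmono : Mono θ := mono_of_app_injective _ (app_injective_of_cover (covers_cylinders E)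
      (isAffineOpen_of_mem_cylinders E) (fun W hW => localizes _ (isQuasicoherent_pullback_Phi hQqc)
        W (isAffineOpen_of_mem_cylinders E W hW))
      (fun W hW => localizes _ hQqc W (isAffineOpen_of_mem_cylinders E W hW)) θ (by
        rintro _ ⟨V, hV, rfl⟩
        exact (hbij V hV).1))
    have hepi : Epi θ := epi_of_app_surjective (covers_cylinders E)
      (isAffineOpen_of_mem_cylinders E)
      (fun W hW => localizes _ hQqc W (isAffineOpen_of_mem_cylinders E W hW)) θ (by
        rintro _ ⟨V, hV, rfl⟩
        exact (hbij V hV).2)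
    have : IsIso θ := isIso_of_mono_of_epi θ
    refine ⟨asIso θ, ?_⟩
    rw [asIso_hom, ← Category.assoc, hθ, hτ]

end Shtuka
end

noncomputable section

/-! ### Intersections of subsheaves and the least element -/

/-- A saturated submodule contains every larger submodule of the same rank. -/
theorem le_of_finrank_eq {A F : Type*} [CommRing A] [IsDomain A] [IsNoetherianRing A]
    [AddCommGroup F] [Module A F] [Module.Finite A F] {Y Y' : Submodule A F} (h : Y ≤ Y')
    (hs : ∀ (c : A) (x : F), c ≠ 0 → c • x ∈ Y → x ∈ Y)
    (hr : Module.finrank A Y' ≤ Module.finrank A Y) : Y' ≤ Y := by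
  have h1 := Submodule.finrank_quotient_add_finrank (Y.submoduleOf Y')
  rw [(Submodule.submoduleOfEquivOfLe h).finrank_eq] at h1
  have h2 : Module.finrank A (Y' ⧸ Y.submoduleOf Y') = 0 := by omega
  rw [Module.finrank_eq_zero_iff_isTorsion] at h2
  intro x hx
  obtain ⟨⟨c, hc⟩, hcx⟩ := @h2 (Submodule.Quotient.mk ⟨x, hx⟩)
  have hcx' : c • (⟨x, hx⟩ : Y') ∈ Y.submoduleOf Y' := (Submodule.Quotient.mk_eq_zero _).1 hcx
  exact hs c x (nonZeroDivisors.ne_zero hc) hcx'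

section
variable {Z : Scheme.{u}} {M : Z.Modules} {W : Z.Opens}

/-- The intersection of two quasi-coherent subsheaves. -/
def interSections (hM : IsQuasicoherent M) (G G' : Subobject M)
    (hG : IsQuasicoherent (G : Z.Modules)) (hG' : IsQuasicoherent (G' : Z.Modules)) :
    AffineSubmodules M where
  obj W := sections G W ⊓ sections G' W
  res_mem _ _ h _ hx := ⟨res_mem_sections h hx.1, res_mem_sections h hx.2⟩
  exists_pow_smul_mem hW f x hx := by
    obtain ⟨n, hn⟩ := exists_pow_smul_mem_sections hM hG hW f x hx.1
    obtain ⟨m, hm⟩ := exists_pow_smul_mem_sections hM hG' hW f x hx.2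
    refine ⟨n + m, ?_, ?_⟩
    · rw [add_comm, pow_add, mul_smul]; exact Submodule.smul_mem _ _ hn
    · rw [pow_add, mul_smul]; exact Submodule.smul_mem _ _ hm

/-- On an integral scheme, inclusions into a saturated subsheaf can be checked on a nonempty affine
open. -/
theorem le_of_isSaturated [IsIntegral Z] (hM : IsQuasicoherent M) {G G' : Subobject M}
    (hG : IsQuasicoherent (G : Z.Modules)) (hG' : IsQuasicoherent (G' : Z.Modules))
    (hs : IsSaturated G') (hW : IsAffineOpen W) [hne : Nonempty W]
    (h : sections G W ≤ sections G' W) : G ≤ G' := by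
  refine le_of_sections_le covers_affine (fun _ h => h) hG fun U hU x hx => ?_
  by_cases hneU : Nonempty U
  · obtain ⟨z, hzU, hzW⟩ : ((U : Set Z) ∩ (W : Set Z)).Nonempty :=
      nonempty_preirreducible_inter U.2 W.2 (hneU.elim fun z => ⟨z.1, z.2⟩)
        (hne.elim fun z => ⟨z.1, z.2⟩)
    obtain ⟨f, f', hff', hzf⟩ := exists_basicOpen_le_affine_inter hU hW z ⟨hzU, hzW⟩
    have key : res M (Z.basicOpen_le f) x ∈ sections G' (Z.basicOpen f) := by
      have hx' := res_mem_sections (Z.basicOpen_le f) hx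
      generalize res M (Z.basicOpen_le f) x = y at hx' ⊢
      revert y
      rw [hff']
      intro y hy
      obtain ⟨y, rfl⟩ := hy
      obtain ⟨n, t, ht⟩ := (localizes _ hG W hW).exists_res_eq f' y
      have h1 := res_mem_sections (Z.basicOpen_le f') (h ⟨t, rfl⟩)
      rw [appLin_apply, ← app_res, ht, Scheme.Modules.Hom.app_smul] at h1
      obtain ⟨v, hv⟩ := (isUnit_rres_basicOpen (f := f') le_rfl).pow n
      rw [← hv] at h1
      have h2 := Submodule.smul_mem _ (v⁻¹ : Γ(Z, Z.basicOpen f')ˣ).1 h1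
      rwa [← mul_smul, Units.inv_mul, one_smul] at h2
    obtain ⟨n, hn⟩ := exists_pow_smul_mem_sections hM hG' hU f x key
    refine hs U hU (f ^ n) x (pow_ne_zero n ?_) hn
    rintro rfl
    rw [Scheme.basicOpen_zero] at hzf
    exact hzf
  · have := subsingleton_of_isEmpty hneU
    have := Module.subsingleton Γ(Z, U) Γ(M, U)
    rw [Subsingleton.elim x 0]
    exact zero_mem _

end

variable {Fq : Type u} [Field Fq] [Fintype Fq] {X : Over (Spec (CommRingCat.of Fq))}
  {E : Type u} [Field E] [Algebra Fq E] [SmoothOfRelativeDimension 1 X.hom]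
  [GeometricallyConnected X.hom] {V : X.left.Opens}

namespace Shtuka

variable {α β : specOver Fq E ⟶ X} {d : ℕ} (𝓕 : Shtuka α β d)

theorem isTrivialQuotientSub_top : 𝓕.IsTrivialQuotientSub ⊤ := by
  refine 𝓕.isTrivialQuotientSub_of_trivialQuotient ?_ (fun W _ c x _ _ => ?_) fun V hV => ?_
  · exact isQuasicoherent_of_iso (asIso (⊤ : Subobject 𝓕.F).arrow).symm 𝓕.isQuasicoherent
  · rw [sections_top]; trivial
  · have : IsZero (cokernel (⊤ : Subobject 𝓕.F).arrow) := isZero_cokernel_of_epi _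
    have : Subsingleton Γ(cokernel (⊤ : Subobject 𝓕.F).arrow, cyl X E V) := ⟨fun x y => by
      have h1 (x : Γ(cokernel (⊤ : Subobject 𝓕.F).arrow, cyl X E V)) : x = 0 :=
        congrArg (fun φ => Scheme.Modules.Hom.app φ (cyl X E V) x) (this.eq_of_src (𝟙 _) 0)
      rw [h1 x, h1 y]⟩
    exact FrobData.trivialQuotient_of_subsingleton _

/-- The intersection of two members of the first poset is a member. -/
theorem exists_inter_isTrivialQuotientSub (hαβ : FrobDisjoint α β) {G G' : Subobject 𝓕.F}
    (hG : 𝓕.IsTrivialQuotientSub G) (hG' : 𝓕.IsTrivialQuotientSub G') :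
    ∃ H, 𝓕.IsTrivialQuotientSub H ∧ H ≤ G ∧ H ≤ G' := by
  obtain ⟨H, hH, hHs⟩ := (interSections 𝓕.isQuasicoherent G G' hG.quasicoherent
    hG'.quasicoherent).exists_subobject 𝓕.isQuasicoherent
  have hHs' (W) (hW : IsAffineOpen W) : sections H W = sections G W ⊓ sections G' W := hHs W hW
  refine ⟨H, 𝓕.isTrivialQuotientSub_of_trivialQuotient hH (fun W hW c x hc hx => ?_)
    fun V hV => ?_, ?_, ?_⟩
  · rw [hHs' W hW] at hx ⊢
    exact ⟨isSaturated_of_isLocallyFree hG.locallyFree W hW c x hc hx.1,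
      isSaturated_of_isLocallyFree hG'.locallyFree W hW c x hc hx.2⟩
  · have hW := isAffineOpen_cyl E hV
    by_cases hne : Nonempty (cyl X E V)
    · have := isDedekindDomain_prod hW hne
      have := finite_sections 𝓕.locallyFree hW
      have := finiteType_sections (E := E) hW
      have hs {K : Subobject 𝓕.F} (hK : IsQuasicoherent (K : (prod X (specOver Fq E)).Modules)) :
          Function.Surjective (appLin (cokernel.π K.arrow) (cyl X E V)) :=
        app_surjective_of_epi hW 𝓕.isQuasicoherent
          (isQuasicoherent_cokernel hK 𝓕.isQuasicoherent K.arrow) (cokernel.π K.arrow)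
      have hk (K : Subobject 𝓕.F) :
          LinearMap.ker (appLin (cokernel.π K.arrow) (cyl X E V)) = sections K _ :=
        Submodule.ext fun x => cokernel_app_eq_zero_iff
      have := Module.Finite.of_surjective _ (hs hG.quasicoherent)
      have := Module.Finite.of_surjective _ (hs hG'.quasicoherent)
      have htf {K : Subobject 𝓕.F} (hK : IsLocallyFree (cokernel K.arrow))
          (c : Γ(prod X (specOver Fq E), cyl X E V)) (q : Γ(cokernel K.arrow, cyl X E V))
          (hq : c • q = 0) : c = 0 ∨ q = 0 :=
        or_iff_not_imp_left.2 fun hc => eq_zero_of_smul_eq_zero hK hc hq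
      refine FrobData.TrivialQuotient.of_ker_eq (FrobData.TrivialQuotient.prod
        (S := orbitPrimes α hW) (J := idealSections (graph α) _)
        (stable_orbitPrimes α hV)
        (𝓕.injective_appLin_g _) (fun p hp h => notMem_orbitPrimes hαβ _ p hp h)
        (fun p hp h => mem_orbitPrimes α _ p hp h) (idealSections_ne_bot hW)
        (idealSections_ne_bot hW) (fun a ha w => 𝓕.smul_mem_range_g ha w)
        (fun a ha w => 𝓕.smul_mem_frobSpan_top hV ha w)
        (htf hG.locallyFree) (htf hG'.locallyFree)
        (𝓕.trivialQuotient_of_isTrivialQuotientSub hG hV)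
        (𝓕.trivialQuotient_of_isTrivialQuotientSub hG' hV))
        (LinearMap.surjective_rangeRestrict _) (hs hH) ?_
      rw [LinearMap.ker_rangeRestrict, LinearMap.ker_prod, hk, hk, hk, hHs' _ hW]
    · have := subsingleton_of_isEmpty hne
      have := Module.subsingleton Γ(prod X (specOver Fq E), cyl X E V)
        Γ(cokernel H.arrow, cyl X E V)
      exact FrobData.trivialQuotient_of_subsingleton _
  · exact le_of_sections_le covers_affine (fun _ h => h) hH fun W hW => by
      rw [hHs' W hW]; exact inf_le_left
  · exact le_of_sections_le covers_affine (fun _ h => h) hH fun W hW => by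
      rw [hHs' W hW]; exact inf_le_right

theorem exists_isLeast_isTrivialQuotientSub (hαβ : FrobDisjoint α β) : ∃ F_I : Subobject 𝓕.F,
    IsLeast {G : Subobject 𝓕.F | 𝓕.IsTrivialQuotientSub G} F_I := by
  obtain ⟨z⟩ : Nonempty (prod X (specOver Fq E)) := inferInstance
  obtain ⟨W, -, hW, hz⟩ := exists_affine_le (U := (⊤ : (prod X (specOver Fq E)).Opens)) (z := z)
    trivial
  have hne : Nonempty W := ⟨⟨z, hz⟩⟩
  have := isDedekindDomain_prod hW hne
  have := finite_sections 𝓕.locallyFree hW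
  -- a member of minimal rank is contained in all others, as its intersection with another member
  -- is a saturated subsheaf of the same rank
  let r (G : Subobject 𝓕.F) : ℕ := Module.finrank Γ(prod X (specOver Fq E), W) (sections G W)
  obtain ⟨G, hG, hmin⟩ := exists_minimalFor_of_wellFoundedLT
    (fun G : Subobject 𝓕.F => 𝓕.IsTrivialQuotientSub G) r ⟨⊤, 𝓕.isTrivialQuotientSub_top⟩
  refine ⟨G, hG, fun G' hG' => ?_⟩
  obtain ⟨H, hH, hHG, hHG'⟩ := 𝓕.exists_inter_isTrivialQuotientSub hαβ hG hG'
  have hs := isSaturated_of_isLocallyFree hH.locallyFree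
  refine le_trans ?_ hHG'
  refine le_of_isSaturated 𝓕.isQuasicoherent hG.quasicoherent hH.quasicoherent hs hW ?_
  refine le_of_finrank_eq (sections_mono hHG W) (hs W hW) ?_
  have h1 : r H ≤ r G := Submodule.finrank_mono (sections_mono hHG W)
  exact hmin hH h1

end Shtuka
end

end Drinfeld

theorem mainTheorem9 {Fq : Type u} [Field Fq] [Fintype Fq]
    (X : Over (Spec (CommRingCat.of Fq)))
    [SmoothOfRelativeDimension 1 X.hom] [IsProper X.hom] [GeometricallyConnected X.hom]
    (E : Type u) [Field E] [Algebra Fq E]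
    (α β : Over.mk (Spec.map (CommRingCat.ofHom (algebraMap Fq E))) ⟶ X)
    (hαβ : Drinfeld.FrobDisjoint α β) (d : ℕ) (𝓕 : Drinfeld.Shtuka α β d) :
    (∃ F_I : Subobject 𝓕.F, IsLeast {G : Subobject 𝓕.F | 𝓕.IsTrivialQuotientSub G} F_I) ∧
    (∃ F_II : Subobject 𝓕.F, IsGreatest {G : Subobject 𝓕.F | 𝓕.IsTrivialSub G} F_II ∧
      Drinfeld.IsLocallyFree (cokernel F_II.arrow)) := by
  obtain ⟨F_II, hF_II⟩ := 𝓕.exists_isGreatest_isTrivialSub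
  exact ⟨𝓕.exists_isLeast_isTrivialQuotientSub hαβ, F_II, hF_II,
    𝓕.isLocallyFree_cokernel_of_isGreatest hαβ hF_II⟩
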